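/- **Setting.** Let $n\ge 1$. A *weak tropical complex* $\Delta$ of dimension $n$ is a finite connected $\Delta$-complex (not necessarily regular) with simplices of dimension at most $n$, together with integers $\alpha(v,r)$ for every *ridge* ($(n-1)$-simplex) $r$ and every vertex $v$ of its parametrizing simplex $\tilde r$, such that $\sum_{v\in\tilde r_0}\alpha(v,r)=\deg(r)$. Here $\deg(r)$ is the number of vertices of $\operatorname{link}_\Delta(r)$, i.e. of pairs consisting of a *facet* ($n$-simplex) and an identification of $r$ with one of the codimension one faces of its parametrizing simplex. We also write $\Delta$ for the geometric realization. A *PL function* on an open $U\subset\Delta$ is a continuous $\phi\colon U\to\mathbb R$ such that each parametrizing simplex is a finite union of polyhedra on each of which, where defined, $\phi$ is an affine function of the barycentric coordinates with integral slopes and real constant term. A *formal sum of polyhedra in $U$* is a finite integral combination of sets $[P]=[P\cap U]$, where $P$ is an $(n-1)$-dimensional polyhedron contained in a single simplex, modulo $[P]=0$ if $P\cap U=\emptyset$ and $[P_1\cup\dots\cup P_k]=[P_1]+\dots+[P_k]$ whenever $P_1\cup\dots\cup P_k$ is convex and the pairwise intersections of the $P_i$ have dimension at most $n-2$. For a ridge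 $r$ let $N_r$ be the simplicial complex obtained by attaching to $\tilde r$ one $n$-simplex for each vertex of $\operatorname{link}_\Delta(r)$, let $\pi_r\colon N_r\to\Delta$ be the natural map, and let $L_r$ be the quotient of the real vector space with basis the vertices of $N_r$ by the line spanned by the vector with entry $1$ at the vertices outside $\tilde r$ and $-\alpha(v,r)$ at the vertices $v$ of $\tilde r$. Let $\phi_r\colon N_r\to L_r$ be linear on simplices and send each vertex to the class of the corresponding basis vector. A function $\phi$ on $U$ is *linear* if it is, locally on the parametrizing simplex of each facet, affine with integral slopes, and if for each ridge $r$ and each $p\in\tilde r$ with $\pi_r(p)\in U$ one has $\phi\circ\pi_r=\ell\circ\phi_r$ near $p$ in $N_r$, for some affine function $\ell\colon L_r\to\mathbb R$ whose slopes are integral on the lattice generated by the classes of the basis vectors. **Proposition.** For every weak tropical complex $\Delta$ of dimension $n\geq 1$ there is a unique function $\operatorname{div}$, taking each PL function $\phi$ on each open $U\subset\Delta$ to a formal sum of polyhedra $\operatorname{div}(\phi)$ in $U$, with the following properties. 1. (i) $\operatorname{div}(\phi+\phi')=\operatorname{div}(\phi)+\operatorname{div}(\phi')$ for PL functions $\phi,\phi'$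 on $U$. 2. (ii) If $V\subset U$ is open, then $\operatorname{div}(\phi|_V)=\operatorname{div}(\phi)|_V$. 3. (iii) $\operatorname{div}(\phi)=0$ if and only if $\phi|_V$ is linear for some open $V\subset U$ such that $U\setminus V$ has empty interior and is contained in the union of the ridges that lie in no facet. (So if every ridge lies in a facet, $\operatorname{div}(\phi)=0$ if and only if $\phi$ is linear.) 4. (iv) Let $f$ be a facet with parametrization $\sigma\colon\tilde f\to\Delta$, and let $W$ be an open and closed subset of $\sigma^{-1}(U)$ (for instance all of it). Let $\lambda\cdot x+c$ be an affine function on $\tilde f$ with primitive integral slope vector $\lambda$ and real constant $c$ which is positive somewhere on $\tilde f$. Suppose that $\phi(\sigma(x))=\max\{\lambda\cdot x+c,0\}$ for $x\in W$, and that every point of $U$ where $\phi\ne0$ lies in $\sigma(W\cap\operatorname{int}\tilde f)$. Then $\operatorname{div}(\phi)=[\sigma(\{x\in W\mid\lambda\cdot x+c=0\})]$ whenever this zero set is $A\cap\sigma^{-1}(U)$ for a polyhedron $A\subset\tilde f$, the class being $0$ if $\dim A\neq n-1$. 5. (v) If $r$ is a ridge contained in no facet, $U$ is the interior of $r$, and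 $\phi$ is linear in the ordinary sense on $r$, then $\sum_{v\in\tilde r_0}\phi(v)\alpha(v,r)$ is an integer and $$\operatorname{div}(\phi)=-\Big(\sum_{v\in\tilde r_0}\phi(v)\,\alpha(v,r)\Big)[r],$$ where $\phi$ is extended to $\tilde r$ by continuity. -/

import Mathlib

open TopologicalSpace Topology

universe u

namespace Trop

/-- A `Δ`-complex, given by gluing data: sets of `k`-dimensional simplices for every `k ≥ 0`, and
for every order-preserving injection `θ : {0,…,j} → {0,…,k}` of vertex sets a face map from
`k`-simplices to `j`-simplices, compatible with identities and composition.  Distinct faces of one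
simplex may coincide (the complex need not be regular). -/
structure DeltaComplex where
  /-- the `k`-dimensional simplices -/
  cell : ℕ → Type u
  /-- the face of a `k`-simplex spanned by the vertices in the image of `θ` -/
  face : ∀ {j k : ℕ}, (Fin (j + 1) ↪o Fin (k + 1)) → cell k → cell j
  face_id : ∀ {k : ℕ} (s : cell k), face (RelEmbedding.refl _) s = s
  face_comp : ∀ {i j k : ℕ} (θ : Fin (i + 1) ↪o Fin (j + 1)) (η : Fin (j + 1) ↪o Fin (k + 1))
    (s : cell k), face (θ.trans η) s = face θ (face η s)

/-- The standard unit simplex with vertices `0, …, k`: points are barycentric coordinate vectors. -/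
abbrev Simp (k : ℕ) : Type := stdSimplex ℝ (Fin (k + 1))

namespace DeltaComplex

variable (X : DeltaComplex.{u})

/-- The disjoint union of the parametrizing simplices of all simplices. -/
abbrev Points : Type u := Σ c : (Σ k : ℕ, X.cell k), Simp c.1

/-- Each parametrizing simplex of a face is glued onto the simplex of which it is a face. -/
inductive Glue : X.Points → X.Points → Prop
  | mk {j k : ℕ} (θ : Fin (j + 1) ↪o Fin (k + 1)) (s : X.cell k) (x : Simp j) :
      Glue ⟨⟨j, X.face θ s⟩, x⟩ ⟨⟨k, s⟩, stdSimplex.map θ x⟩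

/-- The geometric realization of a `Δ`-complex, with the quotient topology. -/
def Realization : Type u := Quot X.Glue

instance : TopologicalSpace X.Realization :=
  inferInstanceAs (TopologicalSpace (Quot X.Glue))

variable {X}

/-- The parametrization of the simplex `s` by its parametrizing simplex. -/
def param {k : ℕ} (s : X.cell k) (x : Simp k) : X.Realization :=
  Quot.mk _ ⟨⟨k, s⟩, x⟩

/-- The vertices of the link of an `m`-simplex `r`: the ways of identifying `r` with a
codimension one face of an `(m+1)`-simplex `f`.  The index `p.2` is the vertex of (the
parametrizing simplex of) `f` opposite to the face. -/
def Link {m : ℕ} (r : X.cell m) : Type u :=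
  {p : X.cell (m + 1) × Fin (m + 2) // X.face (Fin.succAboveOrderEmb p.2) p.1 = r}

end DeltaComplex

/-- A weak tropical complex of dimension `n = m + 1 ≥ 1`.  Facets are the simplices of dimension
`m + 1` and ridges are the simplices of dimension `m`. -/
structure WeakTropicalComplex (m : ℕ) extends DeltaComplex.{u} where
  finite_cell : ∀ k, Finite (cell k)
  isEmpty_cell : ∀ k, m + 1 < k → IsEmpty (cell k)
  connected : ConnectedSpace toDeltaComplex.Realization
  /-- the structure constant of a vertex of the parametrizing simplex of a ridge -/
  α : cell m → Fin (m + 1) → ℤ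
  sum_α : ∀ r : cell m, ∑ v, α r v = (Nat.card (toDeltaComplex.Link r) : ℤ)

/-- A polyhedron in the standard unit simplex: a subset cut out by finitely many (weak) affine
linear inequalities. -/
def IsPolyhedron {k : ℕ} (A : Set (Simp k)) : Prop :=
  ∃ T : Finset ((Fin (k + 1) → ℝ) × ℝ), A = {x | ∀ a ∈ T, ∑ i, a.1 i * x i ≤ a.2}

/-- The dimension of the affine span of a subset of a standard simplex (for a non-empty set). -/
noncomputable def affDim {k : ℕ} (A : Set (Simp k)) : ℕ :=
  Module.finrank ℝ (vectorSpan ℝ ((fun x : Simp k => (x : Fin (k + 1) → ℝ)) '' A))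

/-- The set `A` is an `m`-dimensional polyhedron. -/
def IsPolyhedronOfDim (m : ℕ) {k : ℕ} (A : Set (Simp k)) : Prop :=
  IsPolyhedron A ∧ A.Nonempty ∧ affDim A = m

theorem IsPolyhedron.univ {k : ℕ} : IsPolyhedron (Set.univ : Set (Simp k)) :=
  ⟨∅, by simp⟩

theorem IsPolyhedron.inter {k : ℕ} {A B : Set (Simp k)} (hA : IsPolyhedron A)
    (hB : IsPolyhedron B) : IsPolyhedron (A ∩ B) := by
  classical
  obtain ⟨S, rfl⟩ := hA
  obtain ⟨T, rfl⟩ := hB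
  refine ⟨S ∪ T, ?_⟩
  ext x
  simp only [Set.mem_inter_iff, Set.mem_ofPred_eq, Finset.mem_union]
  constructor
  · rintro ⟨h1, h2⟩ a (ha | ha)
    exacts [h1 a ha, h2 a ha]
  · exact fun h => ⟨fun a ha => h a (Or.inl ha), fun a ha => h a (Or.inr ha)⟩

/-! ### PL functions -/

section PL

variable {X : DeltaComplex.{u}}

/-- The function `φ` on `U` is piecewise linear with integral slopes on the simplex `s`: the
parametrizing simplex is a finite union of polyhedra on each of which (where it is defined) `φ` is
an affine linear function `c + ∑ⱼ μⱼ xⱼ` with integers `μⱼ` and a real constant `c`. -/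
def IsPLOn (U : Opens X.Realization) (φ : U → ℝ) {k : ℕ} (s : X.cell k) : Prop :=
  ∃ (N : Type) (_ : Finite N) (A : N → Set (Simp k)) (c : N → ℝ) (μ : N → Fin (k + 1) → ℤ),
    (∀ i, IsPolyhedron (A i)) ∧ (∀ x, ∃ i, x ∈ A i) ∧
    ∀ i, ∀ x ∈ A i, ∀ h : DeltaComplex.param s x ∈ U,
      φ ⟨DeltaComplex.param s x, h⟩ = c i + ∑ j, (μ i j : ℝ) * x j

/-- The group of PL functions on an open subset `U`. -/
def PL (U : Opens X.Realization) : AddSubgroup (U → ℝ) where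
  carrier := {φ | Continuous φ ∧ ∀ (k : ℕ) (s : X.cell k), IsPLOn U φ s}
  zero_mem' := ⟨continuous_const, fun k _ => ⟨Unit, inferInstance, fun _ => Set.univ, fun _ => 0,
    fun _ _ => 0, fun _ => IsPolyhedron.univ, fun _ => ⟨(), trivial⟩, by simp⟩⟩
  add_mem' := by
    rintro φ ψ ⟨h1, h2⟩ ⟨h3, h4⟩
    refine ⟨h1.add h3, fun k s => ?_⟩
    obtain ⟨N, _, A, c, μ, hA, hc, hφ⟩ := h2 k s
    obtain ⟨N', _, A', c', μ', hA', hc', hψ⟩ := h4 k s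
    refine ⟨N × N', inferInstance, fun p => A p.1 ∩ A' p.2, fun p => c p.1 + c' p.2,
      fun p => μ p.1 + μ' p.2, fun p => (hA p.1).inter (hA' p.2), fun x => ?_, ?_⟩
    · obtain ⟨i, hi⟩ := hc x
      obtain ⟨j, hj⟩ := hc' x
      exact ⟨(i, j), hi, hj⟩
    · rintro ⟨i, j⟩ x ⟨hi, hj⟩ h
      simp only [Pi.add_apply, hφ i x hi h, hψ j x hj h, Int.cast_add, add_mul,
        Finset.sum_add_distrib]
      ring
  neg_mem' := by
    rintro φ ⟨h1, h2⟩
    refine ⟨h1.neg, fun k s => ?_⟩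
    obtain ⟨N, _, A, c, μ, hA, hc, hφ⟩ := h2 k s
    refine ⟨N, inferInstance, A, fun i => - c i, fun i => - μ i, hA, hc, fun i x hi h => ?_⟩
    simp only [Pi.neg_apply, hφ i x hi h, Int.cast_neg, neg_mul, Finset.sum_neg_distrib]
    ring

/-- Restriction of a PL function to a smaller open set. -/
def PL.res {U V : Opens X.Realization} (h : V ≤ U) (φ : PL U) : PL V :=
  ⟨fun y => φ.1 ⟨y.1, h y.2⟩, φ.2.1.comp (by fun_prop), fun k s => by
    obtain ⟨N, hN, A, c, μ, hA, hc, hφ⟩ := φ.2.2 k s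
    exact ⟨N, hN, A, c, μ, hA, hc, fun i x hi hx => hφ i x hi (h hx)⟩⟩

end PL

/-! ### Formal sums of polyhedra -/

section FormalSum

variable {X : DeltaComplex.{u}} {m : ℕ}

variable (X m) in
/-- An `m`-dimensional polyhedron contained in a single simplex of `X`. -/
structure Polyhedron where
  dim : ℕ
  cell : X.cell dim
  carrier : Set (Simp dim)
  isPolyhedron : IsPolyhedronOfDim m carrier

open Classical in
/-- The generator `[A]`, for a subset `A` of the parametrizing simplex of `s`.  It is zero by
convention unless `A` is an `m`-dimensional polyhedron. -/
noncomputable def gen (m : ℕ) {k : ℕ} (s : X.cell k) (A : Set (Simp k)) : Polyhedron X m →₀ ℤ :=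
  if h : IsPolyhedronOfDim m A then Finsupp.single ⟨k, s, A, h⟩ 1 else 0

/-- The relations between formal sums of `m`-dimensional polyhedra in the open set `U`.  A
polyhedron `P` of `X` stands for the polyhedron `P ∩ U` in `U`. -/
inductive Relator (m : ℕ) (U : Opens X.Realization) : (Polyhedron X m →₀ ℤ) → Prop
  /-- `[P] = [P₁] + ⋯ + [Pₙ]` if the polyhedron `P` is the union of the `Pᵢ` and the pairwise
  intersections of the `Pᵢ` have dimension less than `m` -/
  | subdivide {k : ℕ} (s : X.cell k) (N : ℕ) (P : Set (Simp k)) (Q : Fin N → Set (Simp k))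
      (hP : IsPolyhedronOfDim m P) (hQ : ∀ i, IsPolyhedronOfDim m (Q i))
      (hunion : P = ⋃ i, Q i)
      (hinter : ∀ i j, i ≠ j → Q i ∩ Q j = ∅ ∨ affDim (Q i ∩ Q j) < m) :
      Relator m U (gen m s P - ∑ i, gen m s (Q i))
  /-- a polyhedron in a face of `s` is identified with its image in `s` -/
  | face {j k : ℕ} (θ : Fin (j + 1) ↪o Fin (k + 1)) (s : X.cell k) (P : Set (Simp j))
      (hP : IsPolyhedronOfDim m P) :
      Relator m U (gen m (X.face θ s) P - gen m s (stdSimplex.map θ '' P))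
  /-- a polyhedron that does not meet `U` is zero -/
  | disjoint {k : ℕ} (s : X.cell k) (P : Set (Simp k)) (hP : IsPolyhedronOfDim m P)
      (hU : ∀ x ∈ P, DeltaComplex.param s x ∉ U) :
      Relator m U (gen m s P)

/-- The group of formal sums of `m`-dimensional polyhedra in `U`. -/
abbrev FormalSum (m : ℕ) (U : Opens X.Realization) : Type u :=
  (Polyhedron X m →₀ ℤ) ⧸ AddSubgroup.closure {x | Relator m U x}

/-- The class in `FormalSum m U` of the polyhedron `A ∩ U`, for a polyhedron `A` of the simplex `s`
(and zero if `A` does not have dimension `m`). -/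
noncomputable def cls (m : ℕ) (U : Opens X.Realization) {k : ℕ} (s : X.cell k)
    (A : Set (Simp k)) : FormalSum m U :=
  QuotientAddGroup.mk (gen m s A)

theorem Relator.mono {U V : Opens X.Realization} (h : V ≤ U) {x : Polyhedron X m →₀ ℤ}
    (hx : Relator m U x) : Relator m V x := by
  cases hx with
  | subdivide s N P Q hP hQ h1 h2 => exact .subdivide s N P Q hP hQ h1 h2
  | face θ s P hP => exact .face θ s P hP
  | disjoint s P hP hU => exact .disjoint s P hP fun x hx hV => hU x hx (h hV)

/-- Restriction of formal sums to a smaller open set: `[P ∩ U] ↦ [P ∩ V]`. -/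
noncomputable def FormalSum.res {U V : Opens X.Realization} (h : V ≤ U) : FormalSum m U →+ FormalSum m V :=
  QuotientAddGroup.map _ _ (AddMonoidHom.id _)
    ((AddSubgroup.closure_le _).2 fun _ hx => AddSubgroup.subset_closure (Relator.mono h hx))

end FormalSum

/-! ### Linear functions on a weak tropical complex -/

section Linear

variable {m : ℕ} (X : WeakTropicalComplex.{u} m) (r : X.cell m)

instance : Finite (X.Link r) := by
  have := X.finite_cell (m + 1)
  exact inferInstanceAs (Finite {p : X.cell (m + 1) × Fin (m + 2) //
    X.face (Fin.succAboveOrderEmb p.2) p.1 = r})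

noncomputable instance : Fintype (X.Link r) := Fintype.ofFinite _

/-- The vertices of `N_r`: the vertices of the link of `r` and those of the parametrizing simplex
of `r`. -/
abbrev NVertex : Type u := X.Link r ⊕ Fin (m + 1)

/-- The simplicial complex `N_r`, obtained by attaching one `(m+1)`-simplex for each vertex of the
link of `r` onto the parametrizing simplex of `r`, realized by barycentric coordinates. -/
def N : Set (stdSimplex ℝ (NVertex X r)) :=
  {y | ∀ t t' : X.Link r, t ≠ t' → y (Sum.inl t) = 0 ∨ y (Sum.inl t') = 0}

/-- The point of `N_r` lies in the parametrizing simplex of `r`. -/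
def InRidge (y : N X r) : Prop := ∀ t : X.Link r, y.1 (Sum.inl t) = 0

variable {X r}

theorem insertNth_mem (y : N X r) (t : X.Link r) (ht : y.1 (Sum.inl t) ≠ 0) :
    (Fin.insertNth (α := fun _ => ℝ) t.1.2 (y.1 (Sum.inl t)) fun v => y.1 (Sum.inr v)) ∈
      stdSimplex ℝ (Fin (m + 2)) := by
  classical
  refine ⟨fun i => ?_, ?_⟩
  · refine Fin.succAboveCases t.1.2 ?_ (fun j => ?_) i
    · simp
    · simp
  · rw [Fin.sum_univ_succAbove _ t.1.2]
    simp only [Fin.insertNth_apply_same, Fin.insertNth_apply_succAbove]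
    have h := stdSimplex.sum_eq_one y.1
    rw [Fintype.sum_sum_type, Finset.sum_eq_single t] at h
    · exact h
    · intro t' _ hne
      exact (y.2 t' t hne).resolve_right ht
    · simp

theorem inr_mem (y : N X r) (h : InRidge X r y) :
    (fun v => y.1 (Sum.inr v)) ∈ stdSimplex ℝ (Fin (m + 1)) := by
  refine ⟨fun i => stdSimplex.zero_le y.1 _, ?_⟩
  have h1 := stdSimplex.sum_eq_one y.1
  rw [Fintype.sum_sum_type, Finset.sum_eq_zero fun t _ => h t, zero_add] at h1
  exact h1

open Classical in
variable (X r) in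
/-- The natural map `π_r` from `N_r` to the weak tropical complex, extending the parametrization
of `r`, and given on the simplex attached for the vertex `t` of the link by the parametrization of
the corresponding facet. -/
noncomputable def proj (y : N X r) : X.Realization :=
  if h : ∃ t : X.Link r, y.1 (Sum.inl t) ≠ 0 then
    DeltaComplex.param h.choose.1.1 ⟨_, insertNth_mem y h.choose h.choose_spec⟩
  else DeltaComplex.param r ⟨_, inr_mem y (by simpa [InRidge] using h)⟩

variable (X r) in
/-- The quotient `L_r` of the vector space with basis the vertices of `N_r` by the line generated
by `(1, …, 1, -α(v₁, r), …, -α(vₙ, r))`. -/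
abbrev L : Type u :=
  (NVertex X r → ℝ) ⧸ Submodule.span ℝ
    {(Sum.elim (fun _ => 1) (fun v => -(X.α r v : ℝ)) : NVertex X r → ℝ)}

variable (X r) in
/-- The map `N_r → L_r` which is linear on simplices and sends each vertex to the image of the
corresponding coordinate vector. -/
noncomputable def toL (y : N X r) : L X r := Submodule.Quotient.mk (y.1 : NVertex X r → ℝ)

variable (X r) in
open Classical in
/-- A linear form on `L_r` has integral slopes if it takes integral values on the lattice generated
by the images of the coordinate vectors. -/
def IntegralForm (ℓ : L X r →ₗ[ℝ] ℝ) : Prop :=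
  ∀ w : NVertex X r, ∃ z : ℤ, ℓ (Submodule.Quotient.mk (Pi.single w 1)) = z

/-- A function on `U` is linear if it is linear in the ordinary sense on the facets and, at the
ridges, is the pullback of an affine linear function on `L_r` with integral slopes.  Both
conditions are local ones, on the parametrizing simplices of facets and on `N_r` respectively:
linear functions form a sheaf. -/
def IsLinear (U : Opens X.Realization) (φ : U → ℝ) : Prop :=
  (∀ (f : X.cell (m + 1)) (p : Simp (m + 1)), DeltaComplex.param f p ∈ U →
    ∃ (c : ℝ) (μ : Fin (m + 2) → ℤ), ∀ᶠ x in 𝓝 p, ∀ h : DeltaComplex.param f x ∈ U,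
      φ ⟨_, h⟩ = c + ∑ j, (μ j : ℝ) * x j) ∧
  (∀ (r : X.cell m) (p : N X r), InRidge X r p → proj X r p ∈ U →
    ∃ (c : ℝ) (ℓ : L X r →ₗ[ℝ] ℝ), IntegralForm X r ℓ ∧
      ∀ᶠ y in 𝓝 p, ∀ h : proj X r y ∈ U, φ ⟨_, h⟩ = c + ℓ (toL X r y))

variable (X) in
/-- The union of the ridges that are not contained in any facet. -/
def isolatedRidges : Set X.Realization :=
  {y | ∃ r : X.cell m, IsEmpty (X.Link r) ∧ ∃ x, DeltaComplex.param r x = y}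

end Linear

/-! ### The divisor of a PL function -/

/-- The defining properties of the assignment `φ ↦ div(φ)` from PL functions on open subsets of a
weak tropical complex of dimension `m + 1` to formal sums of `m`-dimensional polyhedra. -/
structure IsDivisorAssignment {m : ℕ} (X : WeakTropicalComplex.{u} m)
    (D : ∀ U : Opens X.Realization, PL U → FormalSum m U) : Prop where
  /-- (i) additivity -/
  add : ∀ (U : Opens X.Realization) (φ ψ : PL U), D U (φ + ψ) = D U φ + D U ψ
  /-- (ii) compatibility with restriction -/
  res : ∀ (U V : Opens X.Realization) (h : V ≤ U) (φ : PL U),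
    D V (PL.res h φ) = FormalSum.res h (D U φ)
  /-- (iii) the divisor is trivial if and only if the function is linear, up to a nowhere dense
  set inside the ridges that are not contained in any facet -/
  eq_zero_iff : ∀ (U : Opens X.Realization) (φ : PL U), D U φ = 0 ↔
    ∃ (V : Opens X.Realization) (h : V ≤ U),
      (U : Set X.Realization) \ V ⊆ isolatedRidges X ∧
      interior ((U : Set X.Realization) \ V) = ∅ ∧ IsLinear V (PL.res h φ).1
  /-- (iv) functions supported on one facet `f`, or on one part `W` of the preimage of `U` in the
  parametrizing simplex of `f`: there `φ` is `max {λ · x + c, 0}` with a primitive slope vector `λ`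
  (the linear form is given in barycentric coordinates, so that its slopes along the edges are the
  differences `λᵢ - λⱼ`), and `φ` vanishes outside of the interior of the facet -/
  supported : ∀ (U : Opens X.Realization) (φ : PL U) (f : X.cell (m + 1))
    (W : Set (Simp (m + 1))) (lam : Fin (m + 2) → ℤ) (c : ℝ),
    W ⊆ DeltaComplex.param f ⁻¹' U → IsOpen W → IsOpen (DeltaComplex.param f ⁻¹' U \ W) →
    (∀ d : ℤ, (∀ i j, d ∣ lam i - lam j) → IsUnit d) →
    (∃ x : Simp (m + 1), 0 < ∑ i, (lam i : ℝ) * x i + c) →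
    (∀ x ∈ W, ∀ h : DeltaComplex.param f x ∈ U,
      φ.1 ⟨_, h⟩ = max (∑ i, (lam i : ℝ) * x i + c) 0) →
    (∀ y : U, φ.1 y ≠ 0 → ∃ x ∈ W, (∀ i, 0 < x i) ∧ DeltaComplex.param f x = y) →
    ∀ A : Set (Simp (m + 1)), IsPolyhedron A →
      A ∩ DeltaComplex.param f ⁻¹' U = {x ∈ W | ∑ i, (lam i : ℝ) * x i + c = 0} →
      D U φ = cls m U f A
  /-- (v) functions on the interior `U` of a ridge `r` not contained in any facet that are linear
  in the ordinary sense, with values `a v` at the vertices after extension by continuity -/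
  ridge : ∀ (U : Opens X.Realization) (φ : PL U) (r : X.cell m), IsEmpty (X.Link r) →
    (U : Set X.Realization) = {y | ∃ x : Simp m, (∀ i, 0 < x i) ∧ DeltaComplex.param r x = y} →
    ∀ a : Fin (m + 1) → ℝ,
    (∀ x : Simp m, ∀ h : DeltaComplex.param r x ∈ U, (∀ i, 0 < x i) →
      φ.1 ⟨_, h⟩ = ∑ v, a v * x v) →
    ∃ z : ℤ, (z : ℝ) = -∑ v, a v * X.α r v ∧ D U φ = z • cls m U r Set.univ

end Trop

/-!
The divisor of a PL function `φ` is a formal sum of polyhedra of codimension one, and such a formal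
sum is determined by its multiplicities at generic points.  Accordingly, sets are called *thin* if
they meet every simplex in a set covered by finitely many affine subspaces of codimension two (of
dimension less than `m`), and statements are made off thin sets.

Formal sums are compared through the number `cnt y z` of polyhedra of `z` through the point `y`,
counted on the parametrizing simplices.  Relations have multiplicity zero off a thin set
(`thin_cnt_ne_zero`), and conversely a formal sum that has multiplicity zero off a thin set, even
only locally, is a relation (`mem_rel_of_thin`): every polyhedron is subdivided into the cells of a
common hyperplane arrangement, and the coefficient of a cell is the multiplicity at its generic
points.

A PL function has a multiplicity (`HasMult`) at generic points. In the interior of a facet it is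
locally `B + k * max (λ - λ(x)) 0` with `B` affine and `λ` primitive, and the multiplicity is `k`.
At an interior point of a ridge `r` it is affine on each simplex of `N_r`, and the multiplicity is
the value `∑ b - ∑ α A` on the vector that is divided out in `L_r`, where `b` and `A` are the
values of the affine functions at the vertices of `N_r` outside of and in `r`. On every cell of a
suitable hyperplane arrangement the multiplicity is constant (`exists_facetMult`,
`exists_ridgeMult`), so that there is a formal sum with these multiplicities
(`Adapted.exists_isDiv`), unique up to relations. This is the divisor.

Additivity and restriction are immediate.  If the multiplicity vanishes off a thin set, then `φ` is
affine on facets because a generic segment avoids subspaces of codimension two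
(`exists_ev_of_locally`), and linear at the ridges because the vanishing multiplicity lets the
affine functions on `N_r` factor through `L_r` (`exists_linear_of_sum_eq_zero`).  On an isolated
ridge there are no facets forcing `φ` to be affine, and points of codimension one in the ridge have
to be left out (`isDiv_zero_iff`).  The divisors of functions supported on one facet or living on an
isolated ridge are found by computing multiplicities (`IsWedge.isDiv`, `isDiv_isolated`).

For uniqueness, it suffices to determine the divisor near a generic point. There `φ` is the sum of
a linear function and `k` times a function supported on one facet: a function `max (λ - λ(x)) 0`
near a point of a facet, and the distance to the ridge on one simplex of `N_r` near a point of a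
ridge that lies in a facet. The properties of the divisor determine its value on both summands.
Near a point of an isolated ridge, `φ` is the restriction of an affine function on the interior of
the ridge.
-/

namespace Trop

/-! ### Points of the geometric realization -/

section Simplex

variable {j k l : ℕ}

theorem map_apply_self (θ : Fin (j + 1) ↪o Fin (k + 1)) (x : Simp j) (i : Fin (j + 1)) :
    stdSimplex.map θ x (θ i) = x i := by
  classical
  rw [stdSimplex.map_coe, FunOnFinite.linearMap_apply_apply]
  rw [Finset.sum_eq_single i]
  · intro b hb hne
    simp only [Finset.mem_filter, Finset.mem_univ, true_and] at hb
    exact absurd (θ.injective hb) hne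
  · simp

theorem map_apply_of_notMem (θ : Fin (j + 1) ↪o Fin (k + 1)) (x : Simp j) {i : Fin (k + 1)}
    (hi : i ∉ Set.range θ) : stdSimplex.map θ x i = 0 := by
  classical
  rw [stdSimplex.map_coe, FunOnFinite.linearMap_apply_apply]
  refine Finset.sum_eq_zero fun b hb => ?_
  simp only [Finset.mem_filter, Finset.mem_univ, true_and] at hb
  exact absurd ⟨b, hb⟩ hi

theorem map_injective (θ : Fin (j + 1) ↪o Fin (k + 1)) :
    Function.Injective (stdSimplex.map (S := ℝ) θ) := by
  intro x y h
  ext i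
  rw [← map_apply_self θ x i, h, map_apply_self]

theorem map_trans (η : Fin (j + 1) ↪o Fin (k + 1)) (θ : Fin (k + 1) ↪o Fin (l + 1)) (x : Simp j) :
    stdSimplex.map (η.trans θ) x = stdSimplex.map θ (stdSimplex.map η x) := by
  rw [stdSimplex.map_comp_apply]; rfl

theorem map_refl (x : Simp k) :
    stdSimplex.map (RelEmbedding.refl _ : Fin (k + 1) ↪o Fin (k + 1)) x = x :=
  stdSimplex.map_id_apply x

theorem eq_map_of_forall_notMem (θ : Fin (j + 1) ↪o Fin (k + 1)) (x : Simp k)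
    (h : ∀ i, i ∉ Set.range θ → x i = 0) : ∃ w : Simp j, stdSimplex.map θ w = x := by
  classical
  refine ⟨⟨fun i => x (θ i), fun i => stdSimplex.zero_le x _, ?_⟩, ?_⟩
  · rw [← stdSimplex.sum_eq_one x, ← Finset.sum_image (f := fun i => x i) (g := θ)
      (s := Finset.univ) (by intro a _ b _ h; exact θ.injective h)]
    refine Finset.sum_subset (Finset.subset_univ _) fun i _ hi => h i ?_
    simpa using hi
  · ext i
    by_cases hi : i ∈ Set.range θ
    · obtain ⟨i, rfl⟩ := hi
      rw [map_apply_self]; rfl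
    · rw [map_apply_of_notMem θ _ hi, h i hi]

/-- A point of a standard simplex is interior if all its barycentric coordinates are positive. -/
def IsInt (x : Simp k) : Prop := ∀ i, 0 < x i

/-- Every point of a simplex is an interior point of a face. -/
theorem exists_isInt_map (x : Simp k) :
    ∃ (l : ℕ) (η : Fin (l + 1) ↪o Fin (k + 1)) (w : Simp l), IsInt w ∧ stdSimplex.map η w = x := by
  classical
  set S : Finset (Fin (k + 1)) := Finset.univ.filter fun i => x i ≠ 0 with hS
  have hne : S.Nonempty := by
    rw [Finset.nonempty_iff_ne_empty]
    intro h
    have h1 := stdSimplex.sum_eq_one x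
    rw [Finset.sum_eq_zero] at h1
    · exact zero_ne_one h1
    · intro i _
      by_contra h2
      have : i ∈ S := by simp [hS, h2]
      simp [h] at this
  obtain ⟨l, hl⟩ : ∃ l, S.card = l + 1 := ⟨S.card - 1, by have := hne.card_pos; omega⟩
  have hr : Set.range (S.orderEmbOfFin hl) = S := by simp
  obtain ⟨w, hw⟩ := eq_map_of_forall_notMem (S.orderEmbOfFin hl) x (by
    intro i hi
    rw [hr] at hi
    by_contra h
    exact hi (by simp [hS, h]))
  refine ⟨l, _, w, fun i => ?_, hw⟩
  refine lt_of_le_of_ne (stdSimplex.zero_le w i) ?_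
  rw [← map_apply_self (S.orderEmbOfFin hl) w i, hw]
  have : S.orderEmbOfFin hl i ∈ S := S.orderEmbOfFin_mem hl i
  simp only [hS, Finset.mem_filter] at this
  exact this.2.symm

theorem mem_range_iff_map_ne_zero {η : Fin (l + 1) ↪o Fin (k + 1)} {w : Simp l} (hw : IsInt w)
    (i : Fin (k + 1)) : i ∈ Set.range η ↔ stdSimplex.map η w i ≠ 0 := by
  constructor
  · rintro ⟨i, rfl⟩
    rw [map_apply_self]
    exact (hw i).ne'
  · intro h
    by_contra h1
    exact h (map_apply_of_notMem η w h1)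

theorem range_eq_of_map_eq {j : ℕ} {η : Fin (l + 1) ↪o Fin (k + 1)} {w : Simp l} (hw : IsInt w)
    {η' : Fin (j + 1) ↪o Fin (k + 1)} {w' : Simp j} (hw' : IsInt w')
    (h : stdSimplex.map η w = stdSimplex.map η' w') : Set.range η = Set.range η' := by
  ext i
  rw [mem_range_iff_map_ne_zero hw, mem_range_iff_map_ne_zero hw', h]

theorem dim_eq_of_map_eq {j : ℕ} {η : Fin (l + 1) ↪o Fin (k + 1)} {w : Simp l} (hw : IsInt w)
    {η' : Fin (j + 1) ↪o Fin (k + 1)} {w' : Simp j} (hw' : IsInt w')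
    (h : stdSimplex.map η w = stdSimplex.map η' w') : l = j := by
  have h1 := congrArg Set.ncard (range_eq_of_map_eq hw hw' h)
  rw [← Set.image_univ, ← Set.image_univ, Set.ncard_image_of_injective _ η.injective,
    Set.ncard_image_of_injective _ η'.injective] at h1
  simpa using h1

theorem emb_eq_of_map_eq {η η' : Fin (l + 1) ↪o Fin (k + 1)} {w w' : Simp l} (hw : IsInt w)
    (hw' : IsInt w') (h : stdSimplex.map η w = stdSimplex.map η' w') : η = η' ∧ w = w' := by
  have h1 : η = η' := OrderEmbedding.range_inj.1 (range_eq_of_map_eq hw hw' h)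
  subst h1
  exact ⟨rfl, map_injective η h⟩

theorem orderEmb_eq_refl (θ : Fin (k + 1) ↪o Fin (k + 1)) : θ = RelEmbedding.refl _ := by
  refine OrderEmbedding.range_inj.1 ?_
  have h1 : Function.Surjective θ := Finite.surjective_of_injective θ.injective
  rw [h1.range_eq]
  exact (Set.range_id).symm

theorem le_of_orderEmb (θ : Fin (j + 1) ↪o Fin (k + 1)) : j ≤ k := by
  have := Fintype.card_le_of_injective θ θ.injective
  simpa using this

end Simplex

section Realization

variable {X : DeltaComplex.{u}}

open DeltaComplex

theorem param_map {j k : ℕ} (θ : Fin (j + 1) ↪o Fin (k + 1)) (s : X.cell k) (x : Simp j) :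
    param s (stdSimplex.map θ x) = param (X.face θ s) x :=
  (Quot.sound (Glue.mk θ s x)).symm

/-- Two points of parametrizing simplices have a common interior point of a common face. -/
def SameFace (p q : X.Points) : Prop :=
  ∃ (l : ℕ) (η : Fin (l + 1) ↪o Fin (p.1.1 + 1)) (η' : Fin (l + 1) ↪o Fin (q.1.1 + 1)) (w : Simp l),
    IsInt w ∧ X.face η p.1.2 = X.face η' q.1.2 ∧ stdSimplex.map η w = p.2 ∧
      stdSimplex.map η' w = q.2

theorem sameFace_equivalence : Equivalence (SameFace (X := X)) where
  refl p := by
    obtain ⟨l, η, w, hw, h⟩ := exists_isInt_map p.2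
    exact ⟨l, η, η, w, hw, rfl, h, h⟩
  symm := by
    rintro p q ⟨l, η, η', w, hw, h1, h2, h3⟩
    exact ⟨l, η', η, w, hw, h1.symm, h3, h2⟩
  trans := by
    rintro p q r ⟨l, η, η', w, hw, h1, h2, h3⟩ ⟨l', ζ, ζ', w', hw', h1', h2', h3'⟩
    obtain rfl := dim_eq_of_map_eq hw hw' (h3.trans h2'.symm)
    obtain ⟨rfl, rfl⟩ := emb_eq_of_map_eq hw hw' (h3.trans h2'.symm)
    exact ⟨l, η, ζ', w, hw, h1.trans h1', h2, h3'⟩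

/-- Points of parametrizing simplices have the same image in the realization if and only if they
come from one interior point of a common face. -/
theorem param_eq_iff {k k' : ℕ} (s : X.cell k) (s' : X.cell k') (x : Simp k) (x' : Simp k') :
    param s x = param s' x' ↔ ∃ (l : ℕ) (η : Fin (l + 1) ↪o Fin (k + 1))
      (η' : Fin (l + 1) ↪o Fin (k' + 1)) (w : Simp l), IsInt w ∧ X.face η s = X.face η' s' ∧
      stdSimplex.map η w = x ∧ stdSimplex.map η' w = x' := by
  constructor
  · intro h
    have h1 := Quot.eqvGen_exact h
    have h2 : SameFace (X := X) ⟨⟨k, s⟩, x⟩ ⟨⟨k', s'⟩, x'⟩ := by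
      have hle : ∀ p q : X.Points, X.Glue p q → SameFace p q := by
        rintro _ _ ⟨θ, s, x⟩
        obtain ⟨l, η, w, hw, h⟩ := exists_isInt_map x
        refine ⟨l, η, η.trans θ, w, hw, (X.face_comp η θ s).symm, h, ?_⟩
        rw [map_trans, h]
      have h3 := h1.mono hle
      rwa [sameFace_equivalence.eqvGen_iff] at h3
    exact h2
  · rintro ⟨l, η, η', w, hw, h, rfl, rfl⟩
    rw [param_map, param_map, h]

/-- If an interior point of `s` is also a point of the simplex `s'`, then `s` is a face of `s'`. -/
theorem exists_face_of_param_eq {k k' : ℕ} {s : X.cell k} {s' : X.cell k'} {x : Simp k}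
    {x' : Simp k'} (hx : IsInt x) (h : param s' x' = param s x) :
    ∃ θ : Fin (k + 1) ↪o Fin (k' + 1), X.face θ s' = s ∧ stdSimplex.map θ x = x' := by
  obtain ⟨l, η, η', w, hw, h1, h2, h3⟩ := (param_eq_iff s' s x' x).1 h
  have h4 : stdSimplex.map η' w =
      stdSimplex.map (RelEmbedding.refl _ : Fin (k + 1) ↪o Fin (k + 1)) x := by rw [h3, map_refl]
  obtain rfl := dim_eq_of_map_eq hw hx h4
  obtain ⟨rfl, rfl⟩ := emb_eq_of_map_eq hw hx h4
  exact ⟨η, by rw [h1, X.face_id], h2⟩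

theorem cell_eq_of_param_eq {k k' : ℕ} {s : X.cell k} {s' : X.cell k'} {x : Simp k}
    {x' : Simp k'} (hx : IsInt x) (hx' : IsInt x') (h : param s' x' = param s x) :
    (⟨⟨k, s⟩, x⟩ : X.Points) = ⟨⟨k', s'⟩, x'⟩ := by
  obtain ⟨θ, h1, h2⟩ := exists_face_of_param_eq hx h
  obtain ⟨η, h3, h4⟩ := exists_face_of_param_eq hx' h.symm
  obtain rfl : k = k' := le_antisymm (le_of_orderEmb θ) (le_of_orderEmb η)
  rw [orderEmb_eq_refl θ] at h1 h2
  rw [X.face_id] at h1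
  rw [map_refl] at h2
  subst h1 h2
  rfl

/-- The parametrization of a simplex is injective on its interior, and no other simplex of the same
dimension contains the image of an interior point. -/
theorem param_injOn_isInt {k : ℕ} {s s' : X.cell k} {x x' : Simp k}
    (hx : IsInt x) (h : param s' x' = param s x) : s' = s ∧ x' = x := by
  obtain ⟨θ, h1, h2⟩ := exists_face_of_param_eq hx h
  rw [orderEmb_eq_refl θ] at h1 h2
  rw [X.face_id] at h1
  rw [map_refl] at h2
  exact ⟨h1, h2.symm⟩

theorem exists_param_isInt (y : X.Realization) :
    ∃ (k : ℕ) (s : X.cell k) (x : Simp k), IsInt x ∧ param s x = y := by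
  obtain ⟨⟨⟨k, s⟩, x⟩, rfl⟩ := Quot.exists_rep y
  obtain ⟨l, η, w, hw, rfl⟩ := exists_isInt_map x
  exact ⟨l, X.face η s, w, hw, (param_map η s w).symm⟩

theorem continuous_param {k : ℕ} (s : X.cell k) : Continuous (param s) :=
  continuous_quot_mk.comp (continuous_sigmaMk (σ := fun c : (Σ k : ℕ, X.cell k) => Simp c.1)
    (i := ⟨k, s⟩))

theorem isOpen_iff_param {V : Set X.Realization} :
    IsOpen V ↔ ∀ (k : ℕ) (s : X.cell k), IsOpen (param s ⁻¹' V) := by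
  constructor
  · exact fun h k s => h.preimage (continuous_param s)
  · intro h
    refine (isQuotientMap_quot_mk (r := X.Glue)).isOpen_preimage.1 ?_
    rw [isOpen_sigma_iff]
    rintro ⟨k, s⟩
    exact h k s

/-- The preimage in `s'` of the image of a subset of `s`. -/
theorem preimage_image_param {k k' : ℕ} (s : X.cell k) (s' : X.cell k') (K : Set (Simp k)) :
    param s' ⁻¹' (param s '' K) =
      ⋃ (l : Fin (k + 1)) (η : Fin (l.1 + 1) ↪o Fin (k + 1)) (η' : Fin (l.1 + 1) ↪o Fin (k' + 1))
        (_ : X.face η s = X.face η' s'), stdSimplex.map η' '' (stdSimplex.map η ⁻¹' K) := by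
  ext x'
  simp only [Set.mem_preimage, Set.mem_image, Set.mem_iUnion]
  constructor
  · rintro ⟨x, hx, h⟩
    obtain ⟨l, η, η', w, hw, h1, rfl, rfl⟩ := (param_eq_iff s s' x x').1 h
    exact ⟨⟨l, Nat.lt_succ_of_le (le_of_orderEmb η)⟩, η, η', h1, w, hx, rfl⟩
  · rintro ⟨l, η, η', h, w, hw, rfl⟩
    exact ⟨_, hw, by rw [param_map, param_map, h]⟩

theorem isClosed_image_param {k : ℕ} (s : X.cell k) {K : Set (Simp k)} (hK : IsClosed K) :
    IsClosed (param s '' K) := by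
  rw [← isOpen_compl_iff, isOpen_iff_param]
  intro k' s'
  rw [Set.preimage_compl, isOpen_compl_iff, preimage_image_param]
  refine isClosed_iUnion_of_finite fun l => isClosed_iUnion_of_finite fun η =>
    isClosed_iUnion_of_finite fun η' => isClosed_iUnion_of_finite fun _ => ?_
  have h1 : IsCompact (stdSimplex.map (S := ℝ) η ⁻¹' K) :=
    (hK.preimage (stdSimplex.continuous_map η)).isCompact
  exact (h1.image (stdSimplex.continuous_map η')).isClosed

/-- The points of a simplex mapping to a given point of the realization are finite in number. -/
theorem finite_fiber {k : ℕ} (s : X.cell k) (y : X.Realization) : {x | param s x = y}.Finite := by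
  obtain ⟨l, t, w, hw, rfl⟩ := exists_param_isInt y
  refine (Set.finite_range fun θ : Fin (l + 1) ↪o Fin (k + 1) => stdSimplex.map θ w).subset ?_
  intro x hx
  obtain ⟨θ, _, h⟩ := exists_face_of_param_eq hw hx
  exact ⟨θ, h⟩

/-- The open star of the simplex `s`, restricted to a set `A` of values of the barycentric
coordinates at the vertices of `s`. -/
def star {k : ℕ} (s : X.cell k) (A : Set (Fin (k + 1) → ℝ)) : Set X.Realization :=
  {y | ∃ (k' : ℕ) (s' : X.cell k') (θ : Fin (k + 1) ↪o Fin (k' + 1)) (x' : Simp k'),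
    X.face θ s' = s ∧ (fun i => x' (θ i)) ∈ A ∧ param s' x' = y}

theorem param_mem_star {k : ℕ} {s : X.cell k} {A : Set (Fin (k + 1) → ℝ)}
    (hA : ∀ v ∈ A, ∀ i, 0 < v i) {k' : ℕ} {s' : X.cell k'} {x' : Simp k'} :
    param s' x' ∈ star s A ↔
      ∃ θ : Fin (k + 1) ↪o Fin (k' + 1), X.face θ s' = s ∧ (fun i => x' (θ i)) ∈ A := by
  constructor
  · rintro ⟨k₁, s₁, θ, x₁, h1, h2, h3⟩
    obtain ⟨l, η, η', w, hw, h4, rfl, rfl⟩ := (param_eq_iff s₁ s' x₁ x').1 h3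
    have hr : Set.range θ ⊆ Set.range η := by
      rintro _ ⟨i, rfl⟩
      rw [mem_range_iff_map_ne_zero hw]
      exact (hA _ h2 i).ne'
    choose κ hκ using fun i => hr ⟨i, rfl⟩
    have hmono : StrictMono κ := fun a b hab => by
      rw [← η.lt_iff_lt, hκ, hκ, θ.lt_iff_lt]; exact hab
    set κ' : Fin (k + 1) ↪o Fin (l + 1) := OrderEmbedding.ofStrictMono κ hmono
    have hθ : θ = κ'.trans η := by
      ext i
      simp [κ', hκ]
    refine ⟨κ'.trans η', ?_, ?_⟩
    · rw [X.face_comp, ← h4, ← X.face_comp, ← hθ, h1]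
    · convert h2 using 2 with i
      rw [hθ]
      exact (map_apply_self η' w _).trans (map_apply_self η w _).symm
  · rintro ⟨θ, h1, h2⟩
    exact ⟨k', s', θ, x', h1, h2, rfl⟩

theorem isOpen_star {k : ℕ} {s : X.cell k} {A : Set (Fin (k + 1) → ℝ)}
    (hA : ∀ v ∈ A, ∀ i, 0 < v i) (hA' : IsOpen A) : IsOpen (star s A) := by
  rw [isOpen_iff_param]
  intro k' s'
  have : param s' ⁻¹' (star s A) = ⋃ (θ : Fin (k + 1) ↪o Fin (k' + 1)) (_ : X.face θ s' = s),
      {x' : Simp k' | (fun i => x' (θ i)) ∈ A} := by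
    ext x'
    simp only [Set.mem_preimage, param_mem_star hA, Set.mem_iUnion, Set.mem_ofPred_eq, exists_prop]
  rw [this]
  refine isOpen_iUnion fun θ => isOpen_iUnion fun _ => hA'.preimage ?_
  exact continuous_pi fun i => (continuous_apply (θ i)).comp continuous_subtype_val

end Realization

/-! ### Thin subsets of a simplex -/

section Thin

variable {j k m : ℕ}

/-- The point `(1 - t) x + t y` of a standard simplex. -/
def mix (x y : Simp k) (t : unitInterval) : Simp k :=
  ⟨fun i => (1 - (t : ℝ)) * x i + t * y i, by
    have := convex_stdSimplex ℝ (Fin (k + 1)) x.2 y.2 (sub_nonneg.2 t.2.2) t.2.1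
      (sub_add_cancel _ _)
    exact this⟩

theorem mix_coe (x y : Simp k) (t : unitInterval) :
    (mix x y t : Fin (k + 1) → ℝ) = (1 - (t : ℝ)) • (x : Fin (k + 1) → ℝ) + (t : ℝ) • ⇑y := rfl

theorem mix_apply (x y : Simp k) (t : unitInterval) (i : Fin (k + 1)) :
    mix x y t i = (1 - (t : ℝ)) * x i + t * y i := rfl

theorem mix_zero (x y : Simp k) : mix x y 0 = x := by
  ext i
  simp [mix_apply]

theorem continuous_mix (x y : Simp k) : Continuous (mix x y) := by
  refine Continuous.subtype_mk (continuous_pi fun i => ?_) _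
  fun_prop

/-- The set of points of a standard simplex is closed under forming segments. -/
def Cvx (S : Set (Simp k)) : Prop := ∀ x ∈ S, ∀ y ∈ S, ∀ t, mix x y t ∈ S

/-- The value at `x` of the linear functional `h`.  As the barycentric coordinates have sum `1`,
every affine functional on the simplex has this form. -/
def ev (h : Fin (k + 1) → ℝ) (x : Simp k) : ℝ := ∑ i, h i * x i

theorem ev_mix (h : Fin (k + 1) → ℝ) (x y : Simp k) (t : unitInterval) :
    ev h (mix x y t) = (1 - (t : ℝ)) * ev h x + t * ev h y := by
  simp only [ev, mix_apply, Finset.mul_sum, ← Finset.sum_add_distrib]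
  exact Finset.sum_congr rfl fun i _ => by ring

theorem continuous_ev (h : Fin (k + 1) → ℝ) : Continuous (ev h) :=
  continuous_finsetSum _ fun i _ =>
    continuous_const.mul ((continuous_apply i).comp continuous_subtype_val)

theorem ev_single (i : Fin (k + 1)) (x : Simp k) : ev (Pi.single i 1) x = x i := by
  simp [ev, Pi.single_apply]

theorem ev_const (c : ℝ) (x : Simp k) : ev (fun _ => c) x = c := by
  simp [ev, ← Finset.mul_sum]

theorem ev_add (h h' : Fin (k + 1) → ℝ) (x : Simp k) : ev (h + h') x = ev h x + ev h' x := by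
  simp [ev, add_mul, Finset.sum_add_distrib]

theorem ev_sub (h h' : Fin (k + 1) → ℝ) (x : Simp k) : ev (h - h') x = ev h x - ev h' x := by
  simp [ev, sub_mul, Finset.sum_sub_distrib]

theorem ev_smul (c : ℝ) (h : Fin (k + 1) → ℝ) (x : Simp k) : ev (c • h) x = c * ev h x := by
  simp [ev, mul_assoc, Finset.mul_sum]

theorem ev_map (θ : Fin (j + 1) ↪o Fin (k + 1)) (h : Fin (k + 1) → ℝ) (x : Simp j) :
    ev h (stdSimplex.map θ x) = ev (fun i => h (θ i)) x := by
  classical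
  simp only [ev]
  rw [← Finset.sum_subset (Finset.subset_univ (Finset.univ.image θ)),
    Finset.sum_image (by intro a _ b _ h; exact θ.injective h)]
  · simp only [map_apply_self]
  · intro i _ hi
    rw [map_apply_of_notMem θ x (by simpa using hi), mul_zero]

/-- The linear span of a set of points of a standard simplex.  For a non-empty set its dimension
exceeds the dimension of the affine span by one. -/
def linSpan (A : Set (Simp k)) : Submodule ℝ (Fin (k + 1) → ℝ) :=
  Submodule.span ℝ ((fun x : Simp k => (x : Fin (k + 1) → ℝ)) '' A)

theorem mem_linSpan {A : Set (Simp k)} {x : Simp k} (hx : x ∈ A) :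
    (x : Fin (k + 1) → ℝ) ∈ linSpan A :=
  Submodule.subset_span ⟨x, hx, rfl⟩

theorem linSpan_le {A : Set (Simp k)} {W : Submodule ℝ (Fin (k + 1) → ℝ)} :
    linSpan A ≤ W ↔ ∀ x ∈ A, (x : Fin (k + 1) → ℝ) ∈ W := by
  rw [linSpan, Submodule.span_le, Set.image_subset_iff]
  rfl

theorem linSpan_mono {A B : Set (Simp k)} (h : A ⊆ B) : linSpan A ≤ linSpan B :=
  linSpan_le.2 fun _ hx => mem_linSpan (h hx)

/-- The linear form given by the scalar product with a vector. -/
def form (h : Fin (k + 1) → ℝ) : (Fin (k + 1) → ℝ) →ₗ[ℝ] ℝ := dotProductBilin ℝ ℝ h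

theorem form_apply (h : Fin (k + 1) → ℝ) (v : Fin (k + 1) → ℝ) : form h v = ∑ i, h i * v i := rfl

theorem form_coe (h : Fin (k + 1) → ℝ) (x : Simp k) : form h x = ev h x := rfl

theorem linSpan_empty : linSpan (∅ : Set (Simp k)) = ⊥ := by
  rw [linSpan, Set.image_empty, Submodule.span_empty]

theorem finrank_linSpan {A : Set (Simp k)} (hA : A.Nonempty) :
    Module.finrank ℝ (linSpan A) = affDim A + 1 := by
  obtain ⟨x₀, hx₀⟩ := hA
  set V := vectorSpan ℝ ((fun x : Simp k => (x : Fin (k + 1) → ℝ)) '' A) with hV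
  have hx1 : form (fun _ => 1) x₀ = 1 := ev_const 1 x₀
  have hne : (x₀ : Fin (k + 1) → ℝ) ≠ 0 := by
    intro h
    rw [h, map_zero] at hx1
    exact zero_ne_one hx1
  have hker : V ≤ LinearMap.ker (form (k := k) fun _ => 1) := by
    rw [hV, vectorSpan_def, Submodule.span_le]
    rintro _ ⟨_, ⟨x, _, rfl⟩, _, ⟨y, _, rfl⟩, rfl⟩
    have h1 := ev_const 1 x
    have h2 := ev_const 1 y
    simp only [← form_coe] at h1 h2
    simp [h1, h2]
  have hsup : linSpan A = V ⊔ Submodule.span ℝ {(x₀ : Fin (k + 1) → ℝ)} := by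
    refine le_antisymm (linSpan_le.2 fun x hx => ?_) (sup_le ?_ ?_)
    · rw [← sub_add_cancel (x : Fin (k + 1) → ℝ) x₀]
      refine Submodule.add_mem_sup ?_ (Submodule.mem_span_singleton_self _)
      exact vsub_mem_vectorSpan ℝ ⟨x, hx, rfl⟩ ⟨x₀, hx₀, rfl⟩
    · rw [hV, vectorSpan_def, Submodule.span_le]
      rintro _ ⟨_, ⟨x, hx, rfl⟩, _, ⟨y, hy, rfl⟩, rfl⟩
      exact Submodule.sub_mem _ (mem_linSpan hx) (mem_linSpan hy)
    · rw [Submodule.span_singleton_le_iff_mem]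
      exact mem_linSpan hx₀
  have hinf : V ⊓ Submodule.span ℝ {(x₀ : Fin (k + 1) → ℝ)} = ⊥ := by
    rw [eq_bot_iff]
    rintro v ⟨hv, hv'⟩
    obtain ⟨c, rfl⟩ := Submodule.mem_span_singleton.1 hv'
    have := hker hv
    rw [LinearMap.mem_ker, map_smul, hx1, smul_eq_mul, mul_one] at this
    simp [this]
  have := Submodule.finrank_sup_add_finrank_inf_eq V (Submodule.span ℝ {(x₀ : Fin (k + 1) → ℝ)})
  rw [hinf, finrank_bot, add_zero, finrank_span_singleton hne, ← hsup] at this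
  rw [this]; rfl

theorem isPolyhedronOfDim_iff {A : Set (Simp k)} :
    IsPolyhedronOfDim m A ↔ IsPolyhedron A ∧ Module.finrank ℝ (linSpan A) = m + 1 := by
  constructor
  · rintro ⟨h1, h2, h3⟩
    exact ⟨h1, by rw [finrank_linSpan h2, h3]⟩
  · rintro ⟨h1, h2⟩
    have hne : A.Nonempty := by
      rw [Set.nonempty_iff_ne_empty]
      rintro rfl
      rw [linSpan_empty, finrank_bot] at h2
      omega
    refine ⟨h1, hne, ?_⟩
    rw [finrank_linSpan hne] at h2
    omega

theorem eq_empty_or_affDim_lt {A : Set (Simp k)} :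
    (A = ∅ ∨ affDim A < m) ↔ Module.finrank ℝ (linSpan A) ≤ m := by
  rcases A.eq_empty_or_nonempty with rfl | h
  · rw [linSpan_empty, finrank_bot]
    simp
  · rw [finrank_linSpan h]
    simp [h.ne_empty]

/-- A set of points of a simplex is thin if it is contained in a finite union of affine subspaces
of dimension less than `m`. -/
def ThinIn (m : ℕ) (B : Set (Simp k)) : Prop :=
  ∃ 𝒲 : Set (Submodule ℝ (Fin (k + 1) → ℝ)), 𝒲.Finite ∧ (∀ W ∈ 𝒲, Module.finrank ℝ W ≤ m) ∧
    ∀ x ∈ B, ∃ W ∈ 𝒲, (x : Fin (k + 1) → ℝ) ∈ W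

theorem ThinIn.mono {A B : Set (Simp k)} (h : A ⊆ B) (hB : ThinIn m B) : ThinIn m A := by
  obtain ⟨𝒲, h1, h2, h3⟩ := hB
  exact ⟨𝒲, h1, h2, fun x hx => h3 x (h hx)⟩

theorem ThinIn.of_finrank_le {A : Set (Simp k)} (h : Module.finrank ℝ (linSpan A) ≤ m) :
    ThinIn m A :=
  ⟨{linSpan A}, Set.finite_singleton _, by simpa using h, fun _ hx => ⟨_, rfl, mem_linSpan hx⟩⟩

theorem ThinIn.empty : ThinIn m (∅ : Set (Simp k)) :=
  ⟨∅, Set.finite_empty, by simp, by simp⟩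

theorem ThinIn.iUnion {ι : Sort*} [Finite ι] {A : ι → Set (Simp k)} (h : ∀ i, ThinIn m (A i)) :
    ThinIn m (⋃ i, A i) := by
  choose 𝒲 h1 h2 h3 using h
  refine ⟨⋃ i, 𝒲 i, Set.finite_iUnion h1, ?_, ?_⟩
  · intro W hW
    obtain ⟨i, hi⟩ := Set.mem_iUnion.1 hW
    exact h2 i W hi
  · intro x hx
    obtain ⟨i, hi⟩ := Set.mem_iUnion.1 hx
    obtain ⟨W, hW, hx⟩ := h3 i x hi
    exact ⟨W, Set.mem_iUnion.2 ⟨i, hW⟩, hx⟩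

theorem ThinIn.union {A B : Set (Simp k)} (hA : ThinIn m A) (hB : ThinIn m B) :
    ThinIn m (A ∪ B) := by
  rw [Set.union_eq_iUnion]
  exact ThinIn.iUnion fun b => by cases b <;> assumption

/-- The linear map extending the affine map of simplices given by an injection of the vertices. -/
noncomputable def mapL (θ : Fin (j + 1) ↪o Fin (k + 1)) :
    (Fin (j + 1) → ℝ) →ₗ[ℝ] (Fin (k + 1) → ℝ) := FunOnFinite.linearMap ℝ ℝ θ

theorem mapL_injective (θ : Fin (j + 1) ↪o Fin (k + 1)) : Function.Injective (mapL θ) := by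
  classical
  have key : ∀ v i, mapL θ v (θ i) = v i := by
    intro v i
    rw [mapL, FunOnFinite.linearMap_apply_apply, Finset.sum_eq_single i]
    · intro b hb hne
      simp only [Finset.mem_filter, Finset.mem_univ, true_and] at hb
      exact absurd (θ.injective hb) hne
    · simp
  intro v w h
  ext i
  rw [← key v, h, key]

theorem finrank_linSpan_image (θ : Fin (j + 1) ↪o Fin (k + 1)) (A : Set (Simp j)) :
    Module.finrank ℝ (linSpan (stdSimplex.map θ '' A)) = Module.finrank ℝ (linSpan A) := by
  have : linSpan (stdSimplex.map θ '' A) = (linSpan A).map (mapL θ) := by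
    rw [linSpan, linSpan, Submodule.map_span, Set.image_image, Set.image_image]
    rfl
  rw [this]
  exact (Submodule.equivMapOfInjective _ (mapL_injective θ) _).symm.finrank_eq

theorem ThinIn.image (θ : Fin (j + 1) ↪o Fin (k + 1)) {A : Set (Simp j)} (h : ThinIn m A) :
    ThinIn m (stdSimplex.map θ '' A) := by
  obtain ⟨𝒲, h1, h2, h3⟩ := h
  refine ⟨Submodule.map (mapL θ) '' 𝒲, h1.image _, ?_, ?_⟩
  · rintro _ ⟨W, hW, rfl⟩
    exact (Submodule.finrank_map_le _ _).trans (h2 W hW)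
  · rintro _ ⟨x, hx, rfl⟩
    obtain ⟨W, hW, hxW⟩ := h3 x hx
    exact ⟨_, ⟨W, hW, rfl⟩, _, hxW, rfl⟩

theorem ThinIn.preimage (θ : Fin (j + 1) ↪o Fin (k + 1)) {A : Set (Simp k)} (h : ThinIn m A) :
    ThinIn m (stdSimplex.map θ ⁻¹' A) := by
  obtain ⟨𝒲, h1, h2, h3⟩ := h
  refine ⟨Submodule.comap (mapL θ) '' 𝒲, h1.image _, ?_, ?_⟩
  · rintro _ ⟨W, hW, rfl⟩
    rw [(Submodule.equivMapOfInjective _ (mapL_injective θ) _).finrank_eq]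
    exact (Submodule.finrank_mono (Submodule.map_comap_le _ _)).trans (h2 W hW)
  · intro x hx
    obtain ⟨W, hW, hxW⟩ := h3 _ hx
    exact ⟨_, ⟨W, hW, rfl⟩, hxW⟩

theorem isClosed_mem_submodule (W : Submodule ℝ (Fin (k + 1) → ℝ)) :
    IsClosed {x : Simp k | (x : Fin (k + 1) → ℝ) ∈ W} :=
  W.closed_of_finiteDimensional.preimage continuous_subtype_val

/-- A convex set is not contained in a finite union of subspaces, not even locally, unless it is
contained in one of them. -/
theorem Cvx.exists_notMem {S : Set (Simp k)} (hS : Cvx S) {x₀ : Simp k} (hx₀ : x₀ ∈ S)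
    {V : Set (Simp k)} (hV : V ∈ 𝓝 x₀) {𝒲 : Set (Submodule ℝ (Fin (k + 1) → ℝ))} (hf : 𝒲.Finite)
    (h : ∀ W ∈ 𝒲, ∃ s ∈ S, (s : Fin (k + 1) → ℝ) ∉ W) :
    ∃ x ∈ S, x ∈ interior V ∧ ∀ W ∈ 𝒲, (x : Fin (k + 1) → ℝ) ∉ W := by
  induction 𝒲, hf using Set.Finite.induction_on with
  | empty => exact ⟨x₀, hx₀, mem_interior_iff_mem_nhds.2 hV, by simp⟩
  | @insert W 𝒲 hW hf ih =>
    obtain ⟨x, hx, hxV, hx𝒲⟩ := ih fun W hW => h W (Set.mem_insert_of_mem _ hW)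
    by_cases hxW : (x : Fin (k + 1) → ℝ) ∈ W
    · obtain ⟨s, hs, hsW⟩ := h W (Set.mem_insert _ _)
      have hO : IsOpen (interior V ∩ ⋂ W ∈ 𝒲, {x : Simp k | (x : Fin (k + 1) → ℝ) ∉ W}) :=
        isOpen_interior.inter (hf.isOpen_biInter fun W _ => (isClosed_mem_submodule W).isOpen_compl)
      have hmem : mix x s 0 ∈ interior V ∩ ⋂ W ∈ 𝒲, {x : Simp k | (x : Fin (k + 1) → ℝ) ∉ W} := by
        rw [mix_zero]
        exact ⟨hxV, by simpa using hx𝒲⟩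
      have h1 := (continuous_mix x s).continuousAt.preimage_mem_nhds (hO.mem_nhds hmem)
      have : (𝓝[>] (0 : unitInterval)).NeBot := nhdsGT_neBot_of_exists_gt ⟨1, one_pos⟩
      obtain ⟨t, ht, ht0⟩ := (Filter.Eventually.and
        (Filter.eventually_iff.2 (mem_nhdsWithin_of_mem_nhds h1))
        (self_mem_nhdsWithin : ∀ᶠ t in 𝓝[>] (0 : unitInterval), t ∈ Set.Ioi 0)).exists
      refine ⟨mix x s t, hS x hx s hs t, ht.1, ?_⟩
      intro W' hW'
      rcases hW' with rfl | hW'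
      · intro hmem'
        rw [mix_coe, Submodule.add_mem_iff_right _ (W'.smul_mem _ hxW),
          Submodule.smul_mem_iff] at hmem'
        · exact hsW hmem'
        · exact (show (0 : ℝ) < t from ht0).ne'
      · exact Set.mem_iInter₂.1 ht.2 W' hW'
    · refine ⟨x, hx, hxV, ?_⟩
      intro W' hW'
      rcases hW' with rfl | hW'
      exacts [hxW, hx𝒲 W' hW']

/-- A convex set of dimension at least `m` is nowhere contained in a thin set. -/
theorem Cvx.exists_notMem_thinIn {S : Set (Simp k)} (hS : Cvx S)
    (hm : m < Module.finrank ℝ (linSpan S)) {x₀ : Simp k} (hx₀ : x₀ ∈ S)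
    {V : Set (Simp k)} (hV : V ∈ 𝓝 x₀) {T : Set (Simp k)} (hT : ThinIn m T) :
    ∃ x ∈ S, x ∈ V ∧ x ∉ T := by
  obtain ⟨𝒲, h1, h2, h3⟩ := hT
  obtain ⟨x, hx, hxV, hx𝒲⟩ := hS.exists_notMem hx₀ hV h1 fun W hW => by
    by_contra! hc
    exact absurd (Submodule.finrank_mono (linSpan_le.2 hc)) (by have := h2 W hW; omega)
  refine ⟨x, hx, interior_subset hxV, fun hxT => ?_⟩
  obtain ⟨W, hW, hxW⟩ := h3 x hxT
  exact hx𝒲 W hW hxW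

end Thin

section ThinRealization

open DeltaComplex

variable {X : DeltaComplex.{u}} {m : ℕ}

/-- A subset of the realization is thin if its preimage in every simplex is. -/
def Thin (m : ℕ) (S : Set X.Realization) : Prop :=
  ∀ (k : ℕ) (s : X.cell k), ThinIn m (param s ⁻¹' S)

theorem Thin.mono {A B : Set X.Realization} (h : A ⊆ B) (hB : Thin m B) : Thin m A :=
  fun k s => (hB k s).mono (Set.preimage_mono h)

theorem Thin.empty : Thin m (∅ : Set X.Realization) := fun _ _ => ThinIn.empty

theorem Thin.iUnion {ι : Sort*} [Finite ι] {A : ι → Set X.Realization} (h : ∀ i, Thin m (A i)) :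
    Thin m (⋃ i, A i) := fun k s => by
  rw [Set.preimage_iUnion]
  exact ThinIn.iUnion fun i => h i k s

theorem Thin.union {A B : Set X.Realization} (hA : Thin m A) (hB : Thin m B) : Thin m (A ∪ B) :=
  fun k s => (hA k s).union (hB k s)

theorem ThinIn.image_param {k : ℕ} (s : X.cell k) {A : Set (Simp k)} (h : ThinIn m A) :
    Thin m (param s '' A) := fun k' s' => by
  rw [preimage_image_param]
  exact ThinIn.iUnion fun l => ThinIn.iUnion fun η => ThinIn.iUnion fun η' => ThinIn.iUnion fun _ =>
    (h.preimage η).image η'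

end ThinRealization

/-! ### Cells of an arrangement of hyperplanes in a simplex -/

section Cells

variable {j k m : ℕ}

open Classical in
/-- The signs at `x` of the linear functionals in `H`, and zero for all other functionals. -/
noncomputable def sgn (H : Finset (Fin (k + 1) → ℝ)) (x : Simp k) : (Fin (k + 1) → ℝ) → SignType :=
  fun h => if h ∈ H then SignType.sign (ev h x) else 0

/-- The points of the simplex at which the functionals in `H` have the same signs as at `x`. -/
def openCell (H : Finset (Fin (k + 1) → ℝ)) (x : Simp k) : Set (Simp k) :=
  {y | ∀ h ∈ H, SignType.sign (ev h y) = SignType.sign (ev h x)}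

/-- The points of the simplex at which the functionals in `H` vanish or have the same signs as at
`x`. -/
def closedCell (H : Finset (Fin (k + 1) → ℝ)) (x : Simp k) : Set (Simp k) :=
  {y | ∀ h ∈ H, ev h y = 0 ∨ SignType.sign (ev h y) = SignType.sign (ev h x)}

variable {H : Finset (Fin (k + 1) → ℝ)} {x y z : Simp k}

theorem sgn_eq_iff : sgn H y = sgn H x ↔ y ∈ openCell H x := by
  constructor
  · intro h h' hh'
    have := congrFun h h'
    simpa [sgn, hh'] using this
  · intro h
    funext h'
    by_cases hh' : h' ∈ H
    · simpa [sgn, hh'] using h h' hh'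
    · simp [sgn, hh']

theorem mem_openCell_self : x ∈ openCell H x := fun _ _ => rfl

theorem openCell_subset_closedCell : openCell H x ⊆ closedCell H x :=
  fun _ hy h hh => Or.inr (hy h hh)

theorem mem_closedCell_self : x ∈ closedCell H x := openCell_subset_closedCell mem_openCell_self

theorem closedCell_eq_of_mem (h : y ∈ openCell H x) : closedCell H y = closedCell H x := by
  ext z
  constructor
  · intro hz h' hh'
    rw [← h h' hh']
    exact hz h' hh'
  · intro hz h' hh'
    rw [h h' hh']
    exact hz h' hh'

theorem mem_openCell_of_closedCell_eq (h : closedCell H y = closedCell H x) : y ∈ openCell H x := by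
  intro h' hh'
  have h1 : y ∈ closedCell H x := h ▸ mem_closedCell_self
  have h2 : x ∈ closedCell H y := h ▸ mem_closedCell_self
  rcases h1 h' hh' with h1 | h1
  · rcases h2 h' hh' with h2 | h2
    · rw [h1, h2]
    · exact h2.symm
  · exact h1

theorem closedCell_eq_iff : closedCell H y = closedCell H x ↔ y ∈ openCell H x :=
  ⟨mem_openCell_of_closedCell_eq, closedCell_eq_of_mem⟩

theorem finite_range_closedCell (H : Finset (Fin (k + 1) → ℝ)) :
    (Set.range (closedCell H)).Finite := by
  have h1 : Set.Finite (Set.range fun (x : Simp k) (h : H) => SignType.sign (ev h.1 x)) :=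
    Set.toFinite _
  refine (h1.image fun σ => {y | ∀ h : H, ev h.1 y = 0 ∨ SignType.sign (ev h.1 y) = σ h}).subset ?_
  rintro _ ⟨x, rfl⟩
  refine ⟨_, ⟨x, rfl⟩, ?_⟩
  ext y
  simp [closedCell]

theorem IsPolyhedron.le (h : Fin (k + 1) → ℝ) (c : ℝ) : IsPolyhedron {x : Simp k | ev h x ≤ c} :=
  ⟨{(h, c)}, by simp [ev]⟩

theorem IsPolyhedron.ge (h : Fin (k + 1) → ℝ) (c : ℝ) : IsPolyhedron {x : Simp k | c ≤ ev h x} := by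
  have := IsPolyhedron.le (-h) (-c)
  simpa [ev] using this

theorem IsPolyhedron.eq (h : Fin (k + 1) → ℝ) (c : ℝ) : IsPolyhedron {x : Simp k | ev h x = c} := by
  have := (IsPolyhedron.le h c).inter (IsPolyhedron.ge h c)
  convert this using 1
  ext x
  simp [le_antisymm_iff]

theorem IsPolyhedron.biInter {ι : Type*} (S : Finset ι) {A : ι → Set (Simp k)}
    (h : ∀ i ∈ S, IsPolyhedron (A i)) : IsPolyhedron (⋂ i ∈ S, A i) := by
  classical
  induction S using Finset.induction_on with
  | empty => simpa using IsPolyhedron.univ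
  | insert a S ha ih =>
    rw [Finset.set_biInter_insert]
    exact (h a (Finset.mem_insert_self _ _)).inter
      (ih fun i hi => h i (Finset.mem_insert_of_mem hi))

theorem isPolyhedron_closedCell : IsPolyhedron (closedCell H x) := by
  have : closedCell H x =
      ⋂ h ∈ H, {y | ev h y = 0 ∨ SignType.sign (ev h y) = SignType.sign (ev h x)} := by
    ext; simp [closedCell]
  rw [this]
  refine IsPolyhedron.biInter _ fun h _ => ?_
  rcases lt_trichotomy (ev h x) 0 with hx | hx | hx
  · convert IsPolyhedron.le h 0 using 1
    ext y
    simp only [Set.mem_ofPred_eq, sign_neg hx, sign_eq_neg_one_iff, le_iff_eq_or_lt]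
  · convert IsPolyhedron.eq h 0 using 1
    ext y
    simp only [Set.mem_ofPred_eq, hx, sign_zero, sign_eq_zero_iff, or_self]
  · convert IsPolyhedron.ge h 0 using 1
    ext y
    simp only [Set.mem_ofPred_eq, sign_pos hx, sign_eq_one_iff, le_iff_eq_or_lt]
    rw [eq_comm]

theorem IsPolyhedron.isClosed {A : Set (Simp k)} (h : IsPolyhedron A) : IsClosed A := by
  obtain ⟨T, rfl⟩ := h
  have : {x : Simp k | ∀ a ∈ T, ∑ i, a.1 i * x i ≤ a.2} = ⋂ a ∈ T, {x | ev a.1 x ≤ a.2} := by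
    ext; simp [ev]
  rw [this]
  exact isClosed_biInter fun a _ => isClosed_le (continuous_ev a.1) continuous_const

theorem IsPolyhedron.cvx {A : Set (Simp k)} (h : IsPolyhedron A) : Cvx A := by
  obtain ⟨T, rfl⟩ := h
  intro x hx y hy t a ha
  have h1 := hx a ha
  have h2 := hy a ha
  change ev a.1 _ ≤ _
  change ev a.1 _ ≤ _ at h1 h2
  rw [ev_mix]
  nlinarith [mul_le_mul_of_nonneg_left h1 (sub_nonneg.2 t.2.2), mul_le_mul_of_nonneg_left h2 t.2.1]

/-- If the functional `h` vanishes on the part `B` of `A` but not on all of `A`, the dimension of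
`B` is smaller. -/
theorem finrank_linSpan_lt {h : Fin (k + 1) → ℝ} (hx : ev h x ≠ 0) {A B : Set (Simp k)}
    (hxA : x ∈ A) (hB : B ⊆ A) (hh : ∀ y ∈ B, ev h y = 0) :
    Module.finrank ℝ (linSpan B) < Module.finrank ℝ (linSpan A) := by
  refine Submodule.finrank_lt_finrank_of_lt (lt_of_le_of_ne (linSpan_mono hB) fun heq => hx ?_)
  have h1 : linSpan B ≤ LinearMap.ker (form h) := linSpan_le.2 hh
  exact h1 (heq ▸ mem_linSpan hxA)

/-- The relative boundary of an `m`-dimensional cell is thin. -/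
theorem thinIn_closedCell_diff (h : Module.finrank ℝ (linSpan (closedCell H x)) ≤ m + 1) :
    ThinIn m (closedCell H x \ openCell H x) := by
  have : closedCell H x \ openCell H x ⊆
      ⋃ h : {h : H // ev h.1 x ≠ 0}, {y ∈ closedCell H x | ev h.1.1 y = 0} := by
    rintro y ⟨hy, hy'⟩
    simp only [openCell, Set.mem_ofPred_eq, not_forall] at hy'
    obtain ⟨h, hh, hne⟩ := hy'
    have h0 : ev h y = 0 := (hy h hh).resolve_right hne
    have h1 : ev h x ≠ 0 := by
      intro h1
      exact hne (by rw [h0, h1])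
    exact Set.mem_iUnion.2 ⟨⟨⟨h, hh⟩, h1⟩, hy, h0⟩
  refine ThinIn.mono this (ThinIn.iUnion fun h' => ThinIn.of_finrank_le ?_)
  have := finrank_linSpan_lt (B := {y ∈ closedCell H x | ev h'.1.1 y = 0}) h'.2
    (mem_closedCell_self (H := H)) (fun y hy => hy.1) (fun y hy => hy.2)
  omega

/-- A set of points is a union of closed cells of the arrangement `H`. -/
def CutBy (H : Finset (Fin (k + 1) → ℝ)) (A : Set (Simp k)) : Prop :=
  ∀ x ∈ A, closedCell H x ⊆ A

theorem closedCell_anti {H' : Finset (Fin (k + 1) → ℝ)} (h : H ⊆ H') :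
    closedCell H' x ⊆ closedCell H x := fun _ hy h' hh' => hy h' (h hh')

theorem CutBy.mono {H' : Finset (Fin (k + 1) → ℝ)} (h : H ⊆ H') {A : Set (Simp k)}
    (hA : CutBy H A) : CutBy H' A := fun x hx => (closedCell_anti h).trans (hA x hx)

theorem IsPolyhedron.exists_cutBy {A : Set (Simp k)} (hA : IsPolyhedron A) :
    ∃ H : Finset (Fin (k + 1) → ℝ), CutBy H A := by
  classical
  obtain ⟨T, rfl⟩ := hA
  refine ⟨T.image fun a => a.1 - fun _ => a.2, fun x hx y hy a ha => ?_⟩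
  have h1 := hx a ha
  change ev a.1 _ ≤ _ at h1 ⊢
  have h2 := hy _ (Finset.mem_image_of_mem _ ha)
  rw [ev_sub, ev_sub, ev_const, ev_const] at h2
  rcases h2 with h2 | h2
  · linarith
  · rcases h1.eq_or_lt with h3 | h3
    · rw [h3, sub_self, sign_zero, sign_eq_zero_iff] at h2
      linarith
    · rw [sign_neg (sub_neg.2 h3), sign_eq_neg_one_iff] at h2
      linarith

end Cells

/-! ### Multiplicities of formal sums -/

section Count

open DeltaComplex

variable {X : DeltaComplex.{u}} {m : ℕ}

/-- The number of points of `A` that map to the point `y` of the realization. -/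
noncomputable def pcount {k : ℕ} (s : X.cell k) (A : Set (Simp k)) (y : X.Realization) : ℤ :=
  ∑ x ∈ (finite_fiber s y).toFinset, A.indicator 1 x

/-- The multiplicity at the point `y` of a formal sum of polyhedra. -/
noncomputable def cnt (y : X.Realization) : (Polyhedron X m →₀ ℤ) →+ ℤ :=
  Finsupp.liftAddHom fun P => AddMonoidHom.mulRight (pcount P.cell P.carrier y)

theorem cnt_single (y : X.Realization) (P : Polyhedron X m) (n : ℤ) :
    cnt y (Finsupp.single P n) = n * pcount P.cell P.carrier y := by
  simp [cnt]

theorem gen_of_dim {k : ℕ} (s : X.cell k) {A : Set (Simp k)} (h : IsPolyhedronOfDim m A) :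
    gen m s A = Finsupp.single ⟨k, s, A, h⟩ 1 := dif_pos h

theorem cnt_gen (y : X.Realization) {k : ℕ} (s : X.cell k) {A : Set (Simp k)}
    (h : IsPolyhedronOfDim m A) : cnt y (gen m s A) = pcount s A y := by
  rw [gen_of_dim s h, cnt_single, one_mul]

theorem pcount_eq_zero {k : ℕ} {s : X.cell k} {A : Set (Simp k)} {y : X.Realization}
    (h : ∀ x ∈ A, param s x ≠ y) : pcount s A y = 0 := by
  refine Finset.sum_eq_zero fun x hx => Set.indicator_of_notMem (fun hA => h x hA ?_) _
  simpa using hx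

theorem pcount_eq_one {k : ℕ} {s : X.cell k} {A : Set (Simp k)} {x : Simp k} (hx : IsInt x)
    (hA : x ∈ A) : pcount s A (param s x) = 1 := by
  have : (finite_fiber s (param s x)).toFinset = {x} := by
    ext x'
    simp only [Set.Finite.mem_toFinset, Set.mem_ofPred_eq, Finset.mem_singleton]
    exact ⟨fun h => (param_injOn_isInt hx h).2, fun h => h ▸ rfl⟩
  rw [pcount, this, Finset.sum_singleton, Set.indicator_of_mem hA, Pi.one_apply]

theorem pcount_iUnion {k : ℕ} (s : X.cell k) {n : ℕ} (Q : Fin n → Set (Simp k))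
    {y : X.Realization} (h : ∀ i j, i ≠ j → y ∉ param s '' (Q i ∩ Q j)) :
    pcount s (⋃ i, Q i) y = ∑ i, pcount s (Q i) y := by
  simp only [pcount]
  rw [Finset.sum_comm]
  refine Finset.sum_congr rfl fun x hx => ?_
  have hx : param s x = y := by simpa using hx
  by_cases hxQ : ∃ i, x ∈ Q i
  · obtain ⟨i, hi⟩ := hxQ
    rw [Set.indicator_of_mem (Set.mem_iUnion.2 ⟨i, hi⟩), Finset.sum_eq_single i,
      Set.indicator_of_mem hi]
    · intro j _ hne
      exact Set.indicator_of_notMem (fun hj => h j i hne ⟨x, ⟨hj, hi⟩, hx⟩) _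
    · simp
  · rw [Set.indicator_of_notMem (by simpa using hxQ), Finset.sum_eq_zero]
    intro i _
    exact Set.indicator_of_notMem (fun hi => hxQ ⟨i, hi⟩) _

theorem pcount_face {j k : ℕ} (θ : Fin (j + 1) ↪o Fin (k + 1)) (s : X.cell k) (A : Set (Simp j))
    (y : X.Realization) :
    pcount (X.face θ s) A y = pcount s (stdSimplex.map θ '' A) y := by
  refine Finset.sum_of_injOn (stdSimplex.map θ) ((map_injective θ).injOn) ?_ ?_ ?_
  · intro x hx
    simp only [Set.Finite.coe_toFinset, Set.mem_ofPred_eq] at hx ⊢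
    rw [param_map, hx]
  · intro x hx hx'
    refine Set.indicator_of_notMem ?_ _
    rintro ⟨w, hw, rfl⟩
    refine hx' ⟨w, ?_, rfl⟩
    simp only [Set.Finite.coe_toFinset, Set.mem_ofPred_eq, Set.Finite.mem_toFinset] at hx ⊢
    rw [← param_map, hx]
  · intro x _
    by_cases hx : x ∈ A
    · rw [Set.indicator_of_mem hx, Set.indicator_of_mem (Set.mem_image_of_mem _ hx)]
      rfl
    · rw [Set.indicator_of_notMem hx, Set.indicator_of_notMem]
      rwa [(map_injective θ).mem_set_image]

variable (m) in
/-- The subgroup of relations between formal sums of polyhedra in `U`. -/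
noncomputable abbrev Rel (U : Opens X.Realization) : AddSubgroup (Polyhedron X m →₀ ℤ) :=
  AddSubgroup.closure {x | Relator m U x}

theorem Rel.mono {U V : Opens X.Realization} (h : V ≤ U) : Rel m U ≤ Rel m V :=
  (AddSubgroup.closure_le _).2 fun _ hx => AddSubgroup.subset_closure (Relator.mono h hx)

theorem IsPolyhedronOfDim.image {j k : ℕ} (θ : Fin (j + 1) ↪o Fin (k + 1)) {A : Set (Simp j)}
    (h : IsPolyhedronOfDim m A) : IsPolyhedronOfDim m (stdSimplex.map θ '' A) := by
  classical
  rw [isPolyhedronOfDim_iff] at h ⊢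
  refine ⟨?_, by rw [finrank_linSpan_image, h.2]⟩
  obtain ⟨⟨T, rfl⟩, -⟩ := h
  have h1 : IsPolyhedron (⋂ i ∈ Finset.univ.filter (· ∉ Set.range θ),
      {x : Simp k | ev (Pi.single i 1) x = 0}) :=
    IsPolyhedron.biInter _ fun i _ => IsPolyhedron.eq _ _
  have h2 : IsPolyhedron (⋂ a ∈ T, {x : Simp k | ev (Function.extend θ a.1 0) x ≤ a.2}) :=
    IsPolyhedron.biInter _ fun i _ => IsPolyhedron.le _ _
  convert h1.inter h2 using 1
  have key : ∀ (a : Fin (j + 1) → ℝ) (w : Simp j),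
      ev (Function.extend θ a 0) (stdSimplex.map θ w) = ev a w := by
    intro a w
    rw [ev_map]
    congr 1
    ext i
    exact θ.injective.extend_apply _ _ _
  ext x
  simp only [Set.mem_image, Set.mem_ofPred_eq, Set.mem_inter_iff, Set.mem_iInter, Finset.mem_filter,
    Finset.mem_univ, true_and, ev_single]
  constructor
  · rintro ⟨w, hw, rfl⟩
    exact ⟨fun i hi => map_apply_of_notMem θ w hi, fun a ha => (key a.1 w).trans_le (hw a ha)⟩
  · rintro ⟨hx1, hx2⟩
    obtain ⟨w, rfl⟩ := eq_map_of_forall_notMem θ x hx1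
    exact ⟨w, fun a ha => (key a.1 w).symm.trans_le (hx2 a ha), rfl⟩

/-- Outside of a thin set the multiplicities of a relation are zero. -/
theorem thin_cnt_ne_zero {U : Opens X.Realization} {z : Polyhedron X m →₀ ℤ} (hz : z ∈ Rel m U) :
    Thin m {y | y ∈ U ∧ cnt y z ≠ 0} := by
  induction hz using AddSubgroup.closure_induction with
  | mem z hz =>
    cases hz with
    | subdivide s N P Q hP hQ hunion hinter =>
      have hT : Thin m (⋃ (i) (j) (_ : i ≠ j), param s '' (Q i ∩ Q j)) :=
        Thin.iUnion fun i => Thin.iUnion fun j => Thin.iUnion fun hij =>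
          ThinIn.image_param s (ThinIn.of_finrank_le (eq_empty_or_affDim_lt.1 (hinter i j hij)))
      refine hT.mono ?_
      rintro y ⟨-, hy⟩
      by_contra hyT
      refine hy ?_
      rw [map_sub, map_sum, cnt_gen y s hP, Finset.sum_congr rfl fun i _ => cnt_gen y s (hQ i),
        hunion, pcount_iUnion s Q, sub_self]
      intro i j hij hmem
      exact hyT (Set.mem_iUnion.2 ⟨i, Set.mem_iUnion.2 ⟨j, Set.mem_iUnion.2 ⟨hij, hmem⟩⟩⟩)
    | face θ s P hP =>
      refine Thin.empty.mono ?_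
      rintro y ⟨-, hy⟩
      rw [map_sub, cnt_gen y _ hP, cnt_gen y s (hP.image θ), pcount_face, sub_self] at hy
      exact hy rfl
    | disjoint s P hP hU =>
      refine Thin.empty.mono ?_
      rintro y ⟨hyU, hy⟩
      rw [cnt_gen y s hP] at hy
      exact hy (pcount_eq_zero fun x hx h => hU x hx (h ▸ hyU))
  | zero => exact Thin.empty.mono (by simp)
  | add z w _ _ hz hw =>
    refine (hz.union hw).mono ?_
    rintro y ⟨hyU, hy⟩
    by_contra hc
    simp only [Set.mem_union, Set.mem_ofPred_eq, hyU, true_and, not_or, not_not] at hc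
    exact hy (by rw [map_add, hc.1, hc.2, add_zero])
  | neg z _ hz =>
    refine hz.mono ?_
    rintro y ⟨hyU, hy⟩
    exact ⟨hyU, by simpa using hy⟩

end Count

/-! ### Formal sums are determined by their multiplicities -/

section Injectivity

open DeltaComplex

variable {X : DeltaComplex.{u}} {m : ℕ}

/-- A polyhedron is the image of a polyhedron of a face that meets the interior of that face. -/
theorem exists_isInt_polyhedron {k : ℕ} {A : Set (Simp k)} (hA : IsPolyhedronOfDim m A) :
    ∃ (j : ℕ) (θ : Fin (j + 1) ↪o Fin (k + 1)) (B : Set (Simp j)), IsPolyhedronOfDim m B ∧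
      (∃ x ∈ B, IsInt x) ∧ stdSimplex.map θ '' B = A := by
  classical
  set S : Set (Fin (k + 1)) := {i | ∃ x ∈ A, x i ≠ 0} with hS
  obtain ⟨x₀, hx₀⟩ := hA.2.1
  obtain ⟨x, hx, -, hxS⟩ := hA.1.cvx.exists_notMem hx₀ Filter.univ_mem
    (𝒲 := (fun i => LinearMap.ker (form (Pi.single i 1))) '' S) (S.toFinite.image _) (by
      rintro _ ⟨i, ⟨y, hy, hi⟩, rfl⟩
      exact ⟨y, hy, by rwa [LinearMap.mem_ker, form_coe, ev_single]⟩)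
  obtain ⟨j, θ, w, hw, rfl⟩ := exists_isInt_map x
  have hsub : stdSimplex.map θ '' (stdSimplex.map θ ⁻¹' A) = A := by
    refine Set.image_preimage_eq_of_subset fun y hy => ?_
    refine eq_map_of_forall_notMem θ y fun i hi => ?_
    by_contra hyi
    have := hxS _ ⟨i, ⟨y, hy, hyi⟩, rfl⟩
    rw [LinearMap.mem_ker, form_coe, ev_single] at this
    exact hi ((mem_range_iff_map_ne_zero hw i).2 this)
  refine ⟨j, θ, stdSimplex.map θ ⁻¹' A, ?_, ⟨w, hx, hw⟩, hsub⟩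
  rw [isPolyhedronOfDim_iff] at hA ⊢
  rw [← finrank_linSpan_image θ, hsub]
  refine ⟨?_, hA.2⟩
  obtain ⟨⟨T, rfl⟩, -⟩ := hA
  have h2 : IsPolyhedron (⋂ a ∈ T, {x : Simp j | ev (fun i => a.1 (θ i)) x ≤ a.2}) :=
    IsPolyhedron.biInter _ fun i _ => IsPolyhedron.le _ _
  convert h2 using 1
  ext x
  simp only [Set.mem_preimage, Set.mem_ofPred_eq, Set.mem_iInter, ← ev_map]
  rfl

/-- A choice of a finite set of hyperplanes in each simplex, given by linear functionals that
include the barycentric coordinates. -/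
structure Arrangement (X : DeltaComplex.{u}) where
  /-- the functionals defining the hyperplanes -/
  planes : ∀ {k : ℕ}, X.cell k → Finset (Fin (k + 1) → ℝ)
  coord_mem : ∀ {k : ℕ} (s : X.cell k) (i : Fin (k + 1)), Pi.single i 1 ∈ planes s

variable (𝓗 : Arrangement X)

/-- The polyhedron `Q` is a closed cell of the arrangement, and `y` is a point of the corresponding
open cell, which lies in the interior of a simplex. -/
def OnCell (Q : Polyhedron X m) (y : X.Realization) : Prop :=
  ∃ x : Simp Q.dim, IsInt x ∧ param Q.cell x = y ∧ Q.carrier = closedCell (𝓗.planes Q.cell) x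

variable {𝓗}

theorem isInt_of_mem_openCell {k : ℕ} {s : X.cell k} {x y : Simp k} (hx : IsInt x)
    (hy : y ∈ openCell (𝓗.planes s) x) : IsInt y := by
  intro i
  have := hy _ (𝓗.coord_mem s i)
  rw [ev_single, ev_single, sign_pos (hx i), sign_eq_one_iff] at this
  exact this

theorem OnCell.unique {Q Q' : Polyhedron X m} {y : X.Realization} (h : OnCell 𝓗 Q y)
    (h' : OnCell 𝓗 Q' y) : Q = Q' := by
  obtain ⟨k, s, A, hA⟩ := Q
  obtain ⟨k', s', A', hA'⟩ := Q'
  obtain ⟨x, hx, hxy, hQ⟩ := h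
  obtain ⟨x', hx', hxy', hQ'⟩ := h'
  dsimp only at x x' hxy hxy' hQ hQ'
  have := cell_eq_of_param_eq hx hx' (hxy'.trans hxy.symm)
  cases this
  subst hQ hQ'
  rfl

theorem finite_onCell [Finite (Σ k, X.cell k)] :
    {Q : Polyhedron X m | ∃ y, OnCell 𝓗 Q y}.Finite := by
  have h1 : ∀ c : Σ k, X.cell k, Finite (Set.range (closedCell (𝓗.planes c.2))) :=
    fun c => finite_range_closedCell _
  refine @Set.toFinite _ _ (Finite.of_injective
    (β := Σ c : (Σ k, X.cell k), Set.range (closedCell (𝓗.planes c.2)))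
    (fun Q => ⟨⟨Q.1.dim, Q.1.cell⟩, Q.1.carrier, by
      obtain ⟨y, x, _, _, h⟩ := Q.2
      exact ⟨x, h.symm⟩⟩) (by
      rintro ⟨⟨k, s, A, hA⟩, h⟩ ⟨⟨k', s', A', hA'⟩, h'⟩ heq
      simp only [Sigma.mk.injEq] at heq
      obtain ⟨⟨rfl, h2⟩, h3⟩ := heq
      obtain rfl := eq_of_heq h2
      have := eq_of_heq h3
      simp only [Subtype.mk.injEq] at this
      subst this
      rfl))

end Injectivity

section Injectivity

open DeltaComplex

variable {X : DeltaComplex.{u}} {m : ℕ} {𝓗 : Arrangement X}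

/-- Outside of a thin set, the multiplicity of a combination of cells of an arrangement is the
coefficient of the cell containing the given point. -/
theorem exists_thin_cnt_eq [Finite (Σ k, X.cell k)] : ∃ T : Set X.Realization, Thin m T ∧
    ∀ z : Polyhedron X m →₀ ℤ, (∀ Q ∈ z.support, ∃ y, OnCell 𝓗 Q y) → ∀ y ∉ T,
      (∀ Q, OnCell 𝓗 Q y → cnt y z = z Q) ∧
        ((∀ Q : Polyhedron X m, ¬ OnCell 𝓗 Q y) → cnt y z = 0) := by
  classical
  have hfin := finite_onCell (m := m) (𝓗 := 𝓗)
  have : Finite {Q : Polyhedron X m | ∃ y, OnCell 𝓗 Q y} := hfin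
  choose p hp using fun Q : {Q : Polyhedron X m | ∃ y, OnCell 𝓗 Q y} => Q.2
  choose x hxi hxp hxQ using hp
  refine ⟨⋃ Q, param Q.1.cell '' (closedCell (𝓗.planes Q.1.cell) (x Q) \
    openCell (𝓗.planes Q.1.cell) (x Q)), Thin.iUnion fun Q => ThinIn.image_param _
      (thinIn_closedCell_diff ?_), ?_⟩
  · rw [← hxQ]
    exact (isPolyhedronOfDim_iff.1 Q.1.isPolyhedron).2.le
  intro z hz y hy
  have hon : ∀ Q : Polyhedron X m, (∃ y, OnCell 𝓗 Q y) → ∀ x' ∈ Q.carrier, param Q.cell x' = y →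
      OnCell 𝓗 Q y := by
    intro Q hQ x' hx' hxy
    have h2 := hxQ ⟨Q, hQ⟩
    rw [h2] at hx'
    have h1 : x' ∈ openCell (𝓗.planes Q.cell) (x ⟨Q, hQ⟩) := by
      by_contra hc
      exact hy (Set.mem_iUnion.2 ⟨⟨Q, hQ⟩, x', ⟨hx', hc⟩, hxy⟩)
    exact ⟨x', isInt_of_mem_openCell (hxi _) h1, hxy, by rw [h2, closedCell_eq_of_mem h1]⟩
  have hone : ∀ Q : Polyhedron X m, OnCell 𝓗 Q y → pcount Q.cell Q.carrier y = 1 := by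
    rintro Q ⟨x', hx', rfl, hQ⟩
    exact pcount_eq_one hx' (by rw [hQ]; exact mem_closedCell_self)
  have hsum : cnt y z = ∑ Q ∈ z.support, z Q * pcount Q.cell Q.carrier y := by
    conv_lhs => rw [← z.sum_single, Finsupp.sum, map_sum]
    simp only [cnt_single]
  have hzero : ∀ Q ∈ z.support, ¬ OnCell 𝓗 Q y → z Q * pcount Q.cell Q.carrier y = 0 := by
    intro Q hQ hn
    rw [pcount_eq_zero, mul_zero]
    exact fun x' hx' hxy => hn (hon Q (hz Q hQ) x' hx' hxy)
  constructor
  · intro Q hQ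
    rw [hsum, Finset.sum_eq_single Q, hone Q hQ, mul_one]
    · exact fun Q' hQ' hne => hzero Q' hQ' fun h => hne (h.unique hQ)
    · intro hQ'
      simp [Finsupp.notMem_support_iff.1 hQ']
  · exact fun h => hsum.trans (Finset.sum_eq_zero fun Q hQ => hzero Q hQ (h Q))

/-- A polyhedron meeting the interior of a simplex is the sum of cells of an arrangement. -/
theorem exists_subdivision (U : Opens X.Realization) (P : Polyhedron X m)
    (hP : ∃ x ∈ P.carrier, IsInt x) (hcut : CutBy (𝓗.planes P.cell) P.carrier) :
    ∃ z : Polyhedron X m →₀ ℤ, (∀ Q ∈ z.support, ∃ y, OnCell 𝓗 Q y) ∧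
      Finsupp.single P 1 - z ∈ Rel m U := by
  classical
  obtain ⟨k, s, A, hA⟩ := P
  dsimp only at hP hcut
  obtain ⟨x₀, hx₀, hx₀i⟩ := hP
  set H := 𝓗.planes s with hH
  have hdim := (isPolyhedronOfDim_iff.1 hA).2
  set S : Set (Set (Simp k)) :=
    {C | C ∈ Set.range (closedCell H) ∧ C ⊆ A ∧ Module.finrank ℝ (linSpan C) = m + 1} with hS
  have hSf : S.Finite := (finite_range_closedCell H).subset fun C hC => hC.1
  have : Finite S := hSf
  obtain ⟨n, ⟨e⟩⟩ := Finite.exists_equiv_fin S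
  set Q : Fin n → Set (Simp k) := fun i => (e.symm i).1 with hQ
  have hQd : ∀ i, IsPolyhedronOfDim m (Q i) := by
    intro i
    obtain ⟨⟨x, hx⟩, _, h⟩ := (e.symm i).2
    rw [isPolyhedronOfDim_iff]
    refine ⟨?_, h⟩
    change IsPolyhedron (e.symm i).1
    rw [← hx]
    exact isPolyhedron_closedCell
  have hunion : A = ⋃ i, Q i := by
    refine Set.Subset.antisymm ?_ (Set.iUnion_subset fun i => (e.symm i).2.2.1)
    intro x hx
    by_contra hc
    have hcl : IsClosed (⋃ i, Q i) := isClosed_iUnion_of_finite fun i => (hQd i).1.isClosed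
    have hT : ThinIn m (⋃ C : {C : Set.range (closedCell H) // Module.finrank ℝ (linSpan C.1) ≤ m},
        C.1.1) := by
      have : Finite (Set.range (closedCell H)) := finite_range_closedCell H
      exact ThinIn.iUnion fun C => ThinIn.of_finrank_le C.2
    obtain ⟨y, hyA, hyV, hyT⟩ := hA.1.cvx.exists_notMem_thinIn (by omega : m < _) hx
      (hcl.isOpen_compl.mem_nhds hc) hT
    have h1 := Submodule.finrank_mono (linSpan_mono (hcut y hyA))
    have h2 : m < Module.finrank ℝ (linSpan (closedCell H y)) := by
      by_contra h2
      exact hyT (Set.mem_iUnion.2 ⟨⟨⟨_, y, rfl⟩, not_lt.1 h2⟩, mem_closedCell_self⟩)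
    refine hyV (Set.mem_iUnion.2 ⟨e ⟨closedCell H y, ⟨y, rfl⟩, hcut y hyA, by omega⟩, ?_⟩)
    simp only [hQ, Equiv.symm_apply_apply]
    exact mem_closedCell_self
  have hinter : ∀ i j, i ≠ j → Q i ∩ Q j = ∅ ∨ affDim (Q i ∩ Q j) < m := by
    intro i j hij
    rw [eq_empty_or_affDim_lt]
    obtain ⟨⟨x, hx⟩, _, hi⟩ := (e.symm i).2
    obtain ⟨⟨x', hx'⟩, _, hj⟩ := (e.symm j).2
    change closedCell H x = Q i at hx
    change closedCell H x' = Q j at hx'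
    change Module.finrank ℝ (linSpan (Q i)) = m + 1 at hi
    change Module.finrank ℝ (linSpan (Q j)) = m + 1 at hj
    have hne : ¬ x ∈ openCell H x' := by
      rw [← closedCell_eq_iff, hx, hx']
      exact fun h => hij (e.symm.injective (Subtype.ext h))
    simp only [openCell, Set.mem_ofPred_eq, not_forall] at hne
    obtain ⟨h, hh, hne⟩ := hne
    have h0 : ∀ y ∈ Q i ∩ Q j, ev h y = 0 := by
      rintro y ⟨h1, h2⟩
      rw [← hx] at h1
      rw [← hx'] at h2
      rcases h1 h hh with h1 | h1
      · exact h1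
      · rcases h2 h hh with h2 | h2
        · exact h2
        · exact absurd (h1.symm.trans h2) hne
    by_cases hx0 : ev h x = 0
    · have hx0' : ev h x' ≠ 0 := fun hx0' => hne (by rw [hx0, hx0'])
      have := finrank_linSpan_lt hx0' (A := Q j) (by rw [← hx']; exact mem_closedCell_self)
        Set.inter_subset_right h0
      omega
    · have := finrank_linSpan_lt hx0 (A := Q i) (by rw [← hx]; exact mem_closedCell_self)
        Set.inter_subset_left h0
      omega
  have hrel := AddSubgroup.subset_closure (Relator.subdivide (U := U) s n A Q hA hQd hunion hinter)
  rw [gen_of_dim s hA] at hrel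
  refine ⟨∑ i, gen m s (Q i), ?_, hrel⟩
  intro P hP
  obtain ⟨i, -, hi⟩ := Finset.mem_biUnion.1 (Finsupp.support_finsetSum hP)
  rw [gen_of_dim s (hQd i)] at hi
  have := Finsupp.support_single_subset hi
  rw [Finset.mem_singleton] at this
  subst this
  obtain ⟨⟨x, hx⟩, hsub, hd⟩ := (e.symm i).2
  refine ⟨param s x, x, fun l => ?_, rfl, hx.symm⟩
  refine lt_of_le_of_ne (stdSimplex.zero_le x l) fun h0 => (hx₀i l).ne' ?_
  have h1 : linSpan A ≤ LinearMap.ker (form (Pi.single l 1)) := by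
    rw [← Submodule.eq_of_le_of_finrank_eq (linSpan_mono hsub) (hd.trans hdim.symm)]
    refine linSpan_le.2 fun y hy => ?_
    rw [← hx] at hy
    rw [LinearMap.mem_ker, form_coe]
    rcases hy _ (𝓗.coord_mem s l) with h | h
    · exact h
    · rwa [ev_single, ev_single, ← h0, sign_zero, sign_eq_zero_iff, ← ev_single] at h
  have h2 := h1 (mem_linSpan hx₀)
  rwa [LinearMap.mem_ker, form_coe, ev_single] at h2

/-- Every formal sum is equivalent to a sum of polyhedra that meet the interiors of their
simplices. -/
theorem exists_isInt_support (U : Opens X.Realization) (z : Polyhedron X m →₀ ℤ) :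
    ∃ z' : Polyhedron X m →₀ ℤ, (∀ P ∈ z'.support, ∃ x ∈ P.carrier, IsInt x) ∧
      z - z' ∈ Rel m U := by
  classical
  induction z using Finsupp.induction_linear with
  | zero => exact ⟨0, by simp, by simp⟩
  | add z w hz hw =>
    obtain ⟨z', h1, h2⟩ := hz
    obtain ⟨w', h3, h4⟩ := hw
    refine ⟨z' + w', fun P hP => ?_, ?_⟩
    · rcases Finset.mem_union.1 (Finsupp.support_add hP) with h | h
      exacts [h1 P h, h3 P h]
    · rw [add_sub_add_comm]
      exact add_mem h2 h4
  | single P n =>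
    obtain ⟨k, s, A, hA⟩ := P
    obtain ⟨j, θ, B, hB, hBi, rfl⟩ := exists_isInt_polyhedron hA
    refine ⟨Finsupp.single ⟨j, X.face θ s, B, hB⟩ n, fun P hP => ?_, ?_⟩
    · have := Finsupp.support_single_subset hP
      rw [Finset.mem_singleton] at this
      subst this
      exact hBi
    · have h1 := AddSubgroup.subset_closure (Relator.face (U := U) θ s B hB)
      rw [gen_of_dim _ hB, gen_of_dim s hA] at h1
      have h2 : (Finsupp.single (⟨k, s, _, hA⟩ : Polyhedron X m) n -
          Finsupp.single ⟨j, X.face θ s, B, hB⟩ n) = -n • (Finsupp.single ⟨j, X.face θ s, B, hB⟩ 1 -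
            Finsupp.single ⟨k, s, _, hA⟩ 1) := by
        simp [sub_eq_add_neg, add_comm]
      rw [h2]
      exact zsmul_mem h1 _

theorem exists_arrangement_cutBy (z : Polyhedron X m →₀ ℤ) :
    ∃ 𝓗 : Arrangement X, ∀ P ∈ z.support, CutBy (𝓗.planes P.cell) P.carrier := by
  classical
  have key : ∀ c : Σ k, X.cell k, ∃ H : Finset (Fin (c.1 + 1) → ℝ),
      (∀ i, Pi.single i 1 ∈ H) ∧ ∀ A hA, (⟨c.1, c.2, A, hA⟩ : Polyhedron X m) ∈ z.support →
        CutBy H A := by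
    intro c
    set S : Set (Set (Simp c.1)) := {A | ∃ hA, (⟨c.1, c.2, A, hA⟩ : Polyhedron X m) ∈ z.support}
    have hS : Finite S := by
      refine Finite.of_injective (β := z.support) (fun A => ⟨_, A.2.choose_spec⟩) ?_
      rintro ⟨A, hA⟩ ⟨B, hB⟩ h
      simp only [Subtype.mk.injEq, Polyhedron.mk.injEq, heq_eq_eq, true_and] at h
      exact Subtype.ext h
    have : Fintype S := Fintype.ofFinite _
    choose H hH using fun A : S => A.2.choose.1.exists_cutBy
    refine ⟨Finset.univ.image (fun i => Pi.single i 1) ∪ Finset.univ.biUnion H, fun i => ?_, ?_⟩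
    · exact Finset.mem_union_left _ (Finset.mem_image_of_mem _ (Finset.mem_univ i))
    · intro A hA hz
      refine (hH ⟨A, hA, hz⟩).mono fun h hh => Finset.mem_union_right _ ?_
      exact Finset.mem_biUnion.2 ⟨_, Finset.mem_univ _, hh⟩
  choose H h1 h2 using key
  exact ⟨⟨fun {k} s => H ⟨k, s⟩, fun {k} s i => h1 ⟨k, s⟩ i⟩,
    fun P hP => h2 ⟨P.dim, P.cell⟩ P.carrier P.isPolyhedron hP⟩

/-- A formal sum is zero if, locally at the points outside of a thin set, its multiplicities are
zero outside of a thin set. -/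
theorem mem_rel_of_thin [Finite (Σ k, X.cell k)] {U : Opens X.Realization}
    {z : Polyhedron X m →₀ ℤ} {T : Set X.Realization} (hT : Thin m T)
    (h : ∀ y ∈ U, y ∉ T → ∃ V : Opens X.Realization, V ≤ U ∧ y ∈ V ∧
      Thin m {y | y ∈ V ∧ cnt y z ≠ 0}) : z ∈ Rel m U := by
  classical
  -- modulo relations, all polyhedra are cells of one arrangement
  obtain ⟨z₁, hz₁, hzz₁⟩ := exists_isInt_support U z
  obtain ⟨𝓗, h𝓗⟩ := exists_arrangement_cutBy z₁
  obtain ⟨z₂, hz₂, hzz₂⟩ : ∃ z₂ : Polyhedron X m →₀ ℤ,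
      (∀ Q ∈ z₂.support, ∃ y, OnCell 𝓗 Q y) ∧ z₁ - z₂ ∈ Rel m U := by
    choose! w hw hw' using fun P hP => exists_subdivision U P (hz₁ P hP) (h𝓗 P hP)
    refine ⟨∑ P ∈ z₁.support, z₁ P • w P, ?_, ?_⟩
    · intro Q hQ
      obtain ⟨P, hP, hQP⟩ := Finset.mem_biUnion.1 (Finsupp.support_finsetSum hQ)
      exact hw P hP Q (Finsupp.support_smul hQP)
    · have : z₁ = ∑ P ∈ z₁.support, z₁ P • Finsupp.single P 1 := by
        conv_lhs => rw [← z₁.sum_single, Finsupp.sum]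
        simp
      have h1 : z₁ - ∑ P ∈ z₁.support, z₁ P • w P =
          ∑ P ∈ z₁.support, z₁ P • (Finsupp.single P 1 - w P) := by
        simp only [smul_sub, Finset.sum_sub_distrib]
        rw [← this]
      rw [h1]
      exact sum_mem fun P hP => zsmul_mem (hw' P hP) _
  have hdiff : z - z₂ ∈ Rel m U := by
    have := add_mem hzz₁ hzz₂
    rwa [sub_add_sub_cancel] at this
  have h' : ∀ y ∈ U, y ∉ T → ∃ V : Opens X.Realization, V ≤ U ∧ y ∈ V ∧
      Thin m {y | y ∈ V ∧ cnt y z₂ ≠ 0} := by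
    intro y hyU hyT
    obtain ⟨V, hVU, hyV, hV⟩ := h y hyU hyT
    refine ⟨V, hVU, hyV, (hV.union (thin_cnt_ne_zero (Rel.mono hVU hdiff))).mono ?_⟩
    rintro y' ⟨hy'V, hy'⟩
    by_contra hc
    simp only [Set.mem_union, Set.mem_ofPred_eq, hy'V, true_and, not_or, not_not, map_sub] at hc
    omega
  suffices z₂ ∈ Rel m U by
    have := add_mem hdiff this
    rwa [sub_add_cancel] at this
  -- the coefficient of a cell is the multiplicity at its generic points
  obtain ⟨T', hT', hcnt⟩ := exists_thin_cnt_eq (m := m) (𝓗 := 𝓗)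
  rw [← z₂.sum_single, Finsupp.sum]
  refine sum_mem fun Q hQ => ?_
  have hQ1 : Finsupp.single Q (z₂ Q) = z₂ Q • gen m Q.cell Q.carrier := by
    rw [gen_of_dim _ Q.isPolyhedron]
    simp
  rw [hQ1]
  refine zsmul_mem (AddSubgroup.subset_closure
    (Relator.disjoint Q.cell Q.carrier Q.isPolyhedron ?_)) _
  intro x₁ hx₁ hx₁U
  obtain ⟨y₀, x, hx, rfl, hQx⟩ := hz₂ Q hQ
  have hd := (isPolyhedronOfDim_iff.1 Q.isPolyhedron).2
  have hcv := Q.isPolyhedron.1.cvx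
  have hnhds : ∀ (V : Opens X.Realization) (x : Simp Q.dim), param Q.cell x ∈ V →
      param Q.cell ⁻¹' V ∈ 𝓝 x :=
    fun V x hx => (V.2.preimage (continuous_param Q.cell)).mem_nhds hx
  obtain ⟨x₂, hx₂, hx₂U, hx₂T⟩ := hcv.exists_notMem_thinIn (by omega : m < _) hx₁
    (hnhds U x₁ hx₁U) (hT _ Q.cell)
  obtain ⟨V, hVU, hyV, hV⟩ := h' _ hx₂U hx₂T
  have hbd : ThinIn m (Q.carrier \ openCell (𝓗.planes Q.cell) x) := by
    rw [hQx]
    exact thinIn_closedCell_diff (by rw [← hQx, hd])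
  obtain ⟨x₃, hx₃, hx₃V, hx₃T⟩ := hcv.exists_notMem_thinIn (by omega : m < _) hx₂
    (hnhds V x₂ hyV) (((hT' _ Q.cell).union (hV _ Q.cell)).union hbd)
  simp only [Set.mem_union, Set.mem_preimage, Set.mem_sdiff, Set.mem_ofPred_eq, not_or, not_and,
    not_not] at hx₃T
  obtain ⟨⟨h1, h2⟩, h3⟩ := hx₃T
  have h4 := h3 hx₃
  have h5 := (hcnt z₂ hz₂ _ h1).1 Q ⟨x₃, isInt_of_mem_openCell hx h4, rfl, by
    rw [hQx, closedCell_eq_of_mem h4]⟩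
  rw [h2 hx₃V] at h5
  exact (Finsupp.mem_support_iff.1 hQ) h5.symm

end Injectivity

/-! ### Local form of piecewise linear functions -/

section Local

open DeltaComplex

variable {k : ℕ}

/-- The differences of the coefficients are integers: the slopes of the corresponding affine
function on the standard simplex are integral. -/
def IntDiff (B : Fin (k + 1) → ℝ) : Prop := ∀ i j, ∃ z : ℤ, B i - B j = z

theorem IntDiff.const_add_int (c : ℝ) (μ : Fin (k + 1) → ℤ) :
    IntDiff fun i => c + (μ i : ℝ) := fun i j => ⟨μ i - μ j, by push_cast; ring⟩

theorem ev_const_add (c : ℝ) (μ : Fin (k + 1) → ℝ) (x : Simp k) :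
    ev (fun i => c + μ i) x = c + ∑ i, μ i * x i := by
  have := ev_add (fun _ => c) μ x
  rw [ev_const] at this
  exact this

theorem ev_zero (x : Simp k) : ev 0 x = 0 := ev_const 0 x

theorem IntDiff.zero : IntDiff (0 : Fin (k + 1) → ℝ) := fun _ _ => ⟨0, by simp⟩

theorem IntDiff.add {B C : Fin (k + 1) → ℝ} (hB : IntDiff B) (hC : IntDiff C) :
    IntDiff (B + C) := fun i j => by
  obtain ⟨z, hz⟩ := hB i j
  obtain ⟨w, hw⟩ := hC i j
  exact ⟨z + w, by push_cast; rw [← hz, ← hw]; simp only [Pi.add_apply]; ring⟩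

theorem IntDiff.sub {B C : Fin (k + 1) → ℝ} (hB : IntDiff B) (hC : IntDiff C) :
    IntDiff (B - C) := fun i j => by
  obtain ⟨z, hz⟩ := hB i j
  obtain ⟨w, hw⟩ := hC i j
  exact ⟨z - w, by push_cast; rw [← hz, ← hw]; simp only [Pi.sub_apply]; ring⟩

/-- An affine function with integral slopes is the sum of a constant and an integral linear
form. -/
theorem IntDiff.exists_eq {B : Fin (k + 1) → ℝ} (hB : IntDiff B) :
    ∃ μ : Fin (k + 1) → ℤ, B = fun i => B 0 + (μ i : ℝ) := by
  choose z hz using hB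
  exact ⟨fun i => z i 0, funext fun i => by rw [← hz]; ring⟩

theorem ev_vertex (h : Fin (k + 1) → ℝ) (i : Fin (k + 1)) :
    ev h (stdSimplex.vertex i) = h i := by
  simp [ev, stdSimplex.vertex_coe, Pi.single_apply]

theorem tendsto_mix (x y : Simp k) : Filter.Tendsto (mix x y) (𝓝[>] 0) (𝓝 x) := by
  have := (continuous_mix x y).tendsto 0
  rw [mix_zero] at this
  exact this.mono_left nhdsWithin_le_nhds

instance neBot_nhdsGT_unitInterval : (𝓝[>] (0 : unitInterval)).NeBot :=
  nhdsGT_neBot_of_exists_gt ⟨1, one_pos⟩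

theorem eq_zero_of_eventually_ev {h : Fin (k + 1) → ℝ} {x₀ : Simp k}
    (hx : ∀ᶠ x in 𝓝 x₀, ev h x = 0) : h = 0 := by
  ext i
  obtain ⟨t, ht, ht0⟩ := (((tendsto_mix x₀ (stdSimplex.vertex i)).eventually hx).and
    (self_mem_nhdsWithin : ∀ᶠ t in 𝓝[>] (0 : unitInterval), t ∈ Set.Ioi 0)).exists
  rw [ev_mix, hx.self_of_nhds, ev_vertex, mul_zero, zero_add, mul_eq_zero] at ht
  exact ht.resolve_left (show (0 : ℝ) < t from ht0).ne'

theorem eq_of_eventually_ev {h h' : Fin (k + 1) → ℝ} {x₀ : Simp k}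
    (hx : ∀ᶠ x in 𝓝 x₀, ev h x = ev h' x) : h = h' := by
  refine sub_eq_zero.1 (eq_zero_of_eventually_ev (x₀ := x₀) ?_)
  filter_upwards [hx] with x hx
  rw [ev_sub, hx, sub_self]

/-- Near an interior point of a simplex, one can move in every direction. -/
theorem IsInt.exists_curve {x : Simp k} (hx : IsInt x) {v : Fin (k + 1) → ℝ} (hv : ∑ i, v i = 0) :
    ∃ γ : ℝ → Simp k, Filter.Tendsto γ (𝓝 0) (𝓝 x) ∧
      ∀ᶠ t in 𝓝 (0 : ℝ), ∀ i, γ t i = x i + t * v i := by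
  classical
  have h1 : ∀ᶠ t in 𝓝 (0 : ℝ), (fun i => x i + t * v i) ∈ stdSimplex ℝ (Fin (k + 1)) := by
    have h2 : ∀ᶠ t in 𝓝 (0 : ℝ), ∀ i, 0 < x i + t * v i := by
      rw [Filter.eventually_all]
      intro i
      have : Continuous fun t : ℝ => x i + t * v i := by fun_prop
      refine this.continuousAt.eventually (lt_mem_nhds ?_)
      simpa using hx i
    filter_upwards [h2] with t ht
    refine ⟨fun i => (ht i).le, ?_⟩
    rw [Finset.sum_add_distrib, ← Finset.mul_sum, hv, mul_zero, add_zero]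
    exact stdSimplex.sum_eq_one x
  refine ⟨fun t => if h : (fun i => x i + t * v i) ∈ stdSimplex ℝ (Fin (k + 1)) then ⟨_, h⟩ else x,
    ?_, ?_⟩
  · rw [tendsto_subtype_rng]
    have h3 : Filter.Tendsto (fun t : ℝ => fun i => x i + t * v i) (𝓝 0) (𝓝 x.1) := by
      have : Continuous fun t : ℝ => fun i => x i + t * v i := by fun_prop
      convert this.tendsto 0 using 2
      ext i
      simp only [zero_mul, add_zero]
      rfl
    refine h3.congr' ?_
    filter_upwards [h1] with t ht
    rw [dif_pos ht]
  · filter_upwards [h1] with t ht i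
    rw [dif_pos ht]
    rfl

theorem ev_curve {x y : Simp k} {v : Fin (k + 1) → ℝ} {t : ℝ} (h : ∀ i, y i = x i + t * v i)
    (B : Fin (k + 1) → ℝ) : ev B y = ev B x + t * form B v := by
  simp only [ev, form_apply, h, Finset.mul_sum, ← Finset.sum_add_distrib]
  exact Finset.sum_congr rfl fun i _ => by ring

theorem IsInt.exists_pos {x : Simp k} (hx : IsInt x) {h : Fin (k + 1) → ℝ} (h0 : h ≠ 0)
    (hxh : ev h x = 0) : ∃ u : Simp k, 0 < ev h u := by
  by_contra! hc
  refine h0 (funext fun i => ?_)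
  have h1 : ∀ i, h i ≤ 0 := fun i => by
    have := hc (stdSimplex.vertex i)
    rwa [ev_vertex] at this
  have h2 := (Finset.sum_eq_zero_iff_of_nonpos fun i _ =>
    mul_nonpos_of_nonpos_of_nonneg (h1 i) (hx i).le).1 hxh i (Finset.mem_univ i)
  exact (mul_eq_zero.1 h2).resolve_right (hx i).ne'

theorem exists_eq_smul_of_ker_le {η δ : Fin (k + 1) → ℝ}
    (hker : LinearMap.ker (form η) ≤ LinearMap.ker (form δ)) : ∃ ρ : ℝ, δ = ρ • η := by
  have : form δ ∈ Submodule.span ℝ (Set.range fun _ : Unit => form η) :=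
    mem_span_of_iInf_ker_le_ker (by simpa using hker)
  rw [Set.range_const, Submodule.mem_span_singleton] at this
  obtain ⟨ρ, hρ⟩ := this
  refine ⟨ρ, funext fun i => ?_⟩
  have h4 := LinearMap.congr_fun hρ (Pi.single i 1)
  simpa [form_apply, Pi.single_apply] using h4.symm

/-- If one affine function vanishes where another one does, near a common zero in the interior of a
simplex, the two are proportional. -/
theorem IsInt.exists_eq_smul {x : Simp k} (hx : IsInt x) {η δ : Fin (k + 1) → ℝ}
    (hη : ev η x = 0) (h : ∀ᶠ y in 𝓝 x, ev η y = 0 → ev δ y = 0) : ∃ ρ : ℝ, δ = ρ • η := by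
  have hδ : ev δ x = 0 := h.self_of_nhds hη
  have hker : LinearMap.ker (form η) ≤ LinearMap.ker (form δ) := by
    intro w hw
    rw [LinearMap.mem_ker] at hw ⊢
    set v : Fin (k + 1) → ℝ := w - (∑ i, w i) • (x : Fin (k + 1) → ℝ) with hv
    have hv0 : ∑ i, v i = 0 := by
      simp only [hv, Pi.sub_apply, Pi.smul_apply, smul_eq_mul, Finset.sum_sub_distrib,
        ← Finset.mul_sum]
      rw [stdSimplex.sum_eq_one x]
      ring
    have hvη : form η v = 0 := by
      rw [hv, map_sub, map_smul, form_coe, hη, hw]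
      simp
    obtain ⟨γ, hγ, hγ'⟩ := hx.exists_curve hv0
    have h1 : ∀ᶠ t in 𝓝[≠] (0 : ℝ), form δ v = 0 := by
      filter_upwards [nhdsWithin_le_nhds hγ', nhdsWithin_le_nhds (hγ.eventually h),
        self_mem_nhdsWithin] with t ht ht' ht0
      have h2 := ht' (by rw [ev_curve ht, hη, hvη, mul_zero, add_zero])
      rw [ev_curve ht, hδ, zero_add] at h2
      exact (mul_eq_zero.1 h2).resolve_left ht0
    have h3 := h1.exists.choose_spec
    rw [hv, map_sub, map_smul, form_coe, hδ] at h3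
    simpa using h3
  exact exists_eq_smul_of_ker_le hker

/-- A hyperplane is the set of zeros of a linear functional, which is unique up to a factor. -/
theorem exists_normal {S : Submodule ℝ (Fin (k + 1) → ℝ)} (hS : Module.finrank ℝ S = k) :
    ∃ η : Fin (k + 1) → ℝ, η ≠ 0 ∧ (∀ v ∈ S, form η v = 0) ∧
      ∀ h, (∀ v ∈ S, form h v = 0) → ∃ c : ℝ, h = c • η := by
  have hlt : S < ⊤ := by
    rw [lt_top_iff_ne_top]
    rintro rfl
    rw [finrank_top] at hS
    simp at hS
  obtain ⟨f, hf, hSf⟩ := Submodule.exists_le_ker_of_lt_top S hlt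
  have hff : form (fun i => f (Pi.single i 1)) = f := by
    refine LinearMap.pi_ext' fun i => LinearMap.ext_ring ?_
    simp [form_apply, Pi.single_apply]
  have hker := Module.Dual.finrank_ker_add_one_of_ne_zero hf
  rw [Module.finrank_fin_fun] at hker
  have heq : S = LinearMap.ker f := Submodule.eq_of_le_of_finrank_eq hSf (by omega)
  refine ⟨fun i => f (Pi.single i 1), ?_, ?_, ?_⟩
  · intro h0
    refine hf ?_
    rw [← hff, h0, form, map_zero]
  · intro w hw
    rw [hff]
    exact hSf hw
  · intro h hh
    refine exists_eq_smul_of_ker_le ?_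
    rw [hff, ← heq]
    exact hh

/-! ### Primitive vectors -/

/-- The differences of the entries have no common divisor: the slope vector of the corresponding
affine function on the standard simplex is primitive. -/
def Primitive (lam : Fin (k + 1) → ℤ) : Prop := ∀ d : ℤ, (∀ i j, d ∣ lam i - lam j) → IsUnit d

/-- The real functional with the given integral coefficients. -/
def toR (lam : Fin (k + 1) → ℤ) : Fin (k + 1) → ℝ := fun i => (lam i : ℝ)

theorem Primitive.exists_ne {lam : Fin (k + 1) → ℤ} (h : Primitive lam) :
    ∃ i j, lam i ≠ lam j := by
  by_contra! hc
  have := h 0 fun i j => by simp [hc i j]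
  simp at this

/-- A real multiple of a primitive slope vector is integral only if the factor is: the integers `n`
with `ρ * n` integral form an ideal, which contains the coprime differences of the slopes. -/
theorem Primitive.exists_int {lam : Fin (k + 1) → ℤ} (h : Primitive lam) {ρ : ℝ}
    (hρ : ∀ i j, ∃ z : ℤ, ρ * (lam i - lam j) = z) : ∃ z : ℤ, ρ = z := by
  set I : Ideal ℤ :=
    { carrier := {n | ∃ z : ℤ, ρ * n = z}
      add_mem' := by
        rintro a b ⟨z, hz⟩ ⟨w, hw⟩
        exact ⟨z + w, by push_cast; rw [← hz, ← hw]; ring⟩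
      zero_mem' := ⟨0, by simp⟩
      smul_mem' := by
        rintro c a ⟨z, hz⟩
        exact ⟨c * z, by push_cast [smul_eq_mul]; rw [← hz]; ring⟩ } with hI
  obtain ⟨d, hd⟩ := (inferInstance : I.IsPrincipal)
  have hu : IsUnit d := h d fun i j => by
    have : lam i - lam j ∈ I := by
      obtain ⟨z, hz⟩ := hρ i j
      exact ⟨z, by push_cast; exact hz⟩
    rw [hd] at this
    exact Ideal.mem_span_singleton.1 this
  have h1 : (1 : ℤ) ∈ I := by
    have : I = Ideal.span {d} := hd
    rw [this, Ideal.span_singleton_eq_top.2 hu]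
    trivial
  obtain ⟨z, hz⟩ := h1
  exact ⟨z, by simpa using hz⟩

/-- Up to a constant, an integral vector that is not constant is a multiple of a primitive one. -/
theorem exists_primitive {n : Fin (k + 1) → ℤ} (hn : ∃ i j, n i ≠ n j) :
    ∃ (g : ℤ) (lam : Fin (k + 1) → ℤ), g ≠ 0 ∧ Primitive lam ∧ ∀ i, n i = n 0 + g * lam i := by
  set I : Ideal ℤ := Ideal.span (Set.range fun p : Fin (k + 1) × Fin (k + 1) => n p.1 - n p.2)
  obtain ⟨d, hd⟩ := (inferInstance : I.IsPrincipal)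
  have hd : I = Ideal.span {d} := hd
  have hdvd : ∀ i j, d ∣ n i - n j := fun i j => by
    have : n i - n j ∈ I := Ideal.subset_span ⟨(i, j), rfl⟩
    rw [hd] at this
    exact Ideal.mem_span_singleton.1 this
  have hd0 : d ≠ 0 := by
    rintro rfl
    obtain ⟨i, j, hij⟩ := hn
    exact hij (sub_eq_zero.1 (zero_dvd_iff.1 (hdvd i j)))
  choose lam hlam using fun i => hdvd i 0
  refine ⟨d, lam, hd0, fun e he => ?_, fun i => by rw [← hlam]; ring⟩
  have h1 : I ≤ Ideal.span {d * e} := by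
    refine Ideal.span_le.2 ?_
    rintro _ ⟨⟨i, j⟩, rfl⟩
    refine Ideal.mem_span_singleton.2 ?_
    have : n i - n j = d * (lam i - lam j) := by rw [mul_sub, ← hlam, ← hlam]; ring
    dsimp only
    rw [this]
    exact mul_dvd_mul_left d (he i j)
  rw [hd, Ideal.span_singleton_le_span_singleton] at h1
  obtain ⟨c, hc⟩ := h1
  refine IsUnit.of_mul_eq_one c ?_
  have : d * (e * c) = d * 1 := by rw [mul_one, ← mul_assoc, ← hc]
  exact mul_left_cancel₀ hd0 this

theorem primitive_single (i : Fin (k + 2)) : Primitive (Pi.single i 1 : Fin (k + 2) → ℤ) := by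
  intro d hd
  obtain ⟨j, hj⟩ := exists_ne i
  have := hd i j
  simp only [Pi.single_eq_same, Pi.single_eq_of_ne hj, sub_zero] at this
  exact isUnit_of_dvd_one this

end Local

/-! ### The local multiplicity of the divisor -/

section Multiplicity

open DeltaComplex

variable {m : ℕ} {X : WeakTropicalComplex.{u} m}

/-- Near the point `x` of the facet `f`, the function `Φ` is the sum of an affine function with
integral slopes and `k` times the maximum of `0` and the affine function with slopes `lam` that
vanishes at `x`. -/
def HasFacetMult (Φ : X.Realization → ℝ) (f : X.cell (m + 1)) (x : Simp (m + 1))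
    (lam : Fin (m + 2) → ℤ) (k : ℤ) : Prop :=
  ∃ B : Fin (m + 2) → ℝ, IntDiff B ∧ ∀ᶠ y in 𝓝 x,
    Φ (param f y) = ev B y + k * max (ev (toR lam) y - ev (toR lam) x) 0

/-- The identification of the parametrizing simplex of a ridge with a face of a facet. -/
abbrev emb {r : X.cell m} (t : X.Link r) : Fin (m + 1) ↪o Fin (m + 2) :=
  Fin.succAboveOrderEmb t.1.2

/-- The functional on a facet with values `b` at the vertex opposite to a ridge and `A v` at the
vertices of the ridge. -/
def ins {r : X.cell m} (t : X.Link r) (A : Fin (m + 1) → ℝ) (b : ℝ) : Fin (m + 2) → ℝ :=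
  Fin.insertNth (α := fun _ => ℝ) t.1.2 b A

/-- Near the point `x` of the ridge `r`, the function `Φ` is affine with integral slopes on the
ridge and on each simplex of `N_r`, with values `A v` and `b t` at the vertices of `N_r` after
extension, and `k` is the resulting multiplicity of the divisor. -/
def HasRidgeMult (Φ : X.Realization → ℝ) (r : X.cell m) (x : Simp m) (k : ℤ) : Prop :=
  ∃ (A : Fin (m + 1) → ℝ) (b : X.Link r → ℝ), IntDiff A ∧ (∀ t v, ∃ z : ℤ, b t - A v = z) ∧
    (∀ᶠ y in 𝓝 x, Φ (param r y) = ev A y) ∧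
    (∀ t : X.Link r, ∀ᶠ y in 𝓝 (stdSimplex.map (emb t) x),
      Φ (param t.1.1 y) = ev (ins t A (b t)) y) ∧
    (k : ℝ) = ∑ t, b t - ∑ v, (X.α r v : ℝ) * A v

/-- The function `Φ` has multiplicity `k` at the interior point `y` of a ridge or facet; in the case
of a facet the slopes of `Φ` change by multiples of `lam`. -/
def HasMultDir (Φ : X.Realization → ℝ) (y : X.Realization) (lam : Fin (m + 2) → ℤ) (k : ℤ) : Prop :=
  (∃ (f : X.cell (m + 1)) (x : Simp (m + 1)), IsInt x ∧ param f x = y ∧ HasFacetMult Φ f x lam k) ∨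
  (∃ (r : X.cell m) (x : Simp m), IsInt x ∧ param r x = y ∧ HasRidgeMult Φ r x k)

/-- The divisor of the function `Φ` has multiplicity `k` at the interior point `y` of a ridge or
facet. -/
def HasMult (Φ : X.Realization → ℝ) (y : X.Realization) (k : ℤ) : Prop :=
  ∃ lam, Primitive lam ∧ HasMultDir Φ y lam k

theorem ev_ins {r : X.cell m} (t : X.Link r) (A : Fin (m + 1) → ℝ) (b : ℝ) (x : Simp (m + 1)) :
    ev (ins t A b) x = b * x t.1.2 + ∑ v, A v * x (emb t v) := by
  rw [ev, Fin.sum_univ_succAbove _ t.1.2]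
  simp [ins]

theorem ins_add {r : X.cell m} (t : X.Link r) (A A' : Fin (m + 1) → ℝ) (b b' : ℝ) :
    ins t (A + A') (b + b') = ins t A b + ins t A' b' :=
  Fin.insertNth_add (α := fun _ => ℝ) t.1.2 b b' A A'

theorem ins_self {r : X.cell m} (t : X.Link r) (F : Fin (m + 2) → ℝ) :
    ins t (fun v => F (emb t v)) (F t.1.2) = F :=
  Fin.insertNth_self_removeNth t.1.2 F

theorem HasFacetMult.add {Φ Ψ : X.Realization → ℝ} {f : X.cell (m + 1)} {x : Simp (m + 1)}
    {lam : Fin (m + 2) → ℤ} {k l : ℤ} (h : HasFacetMult Φ f x lam k)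
    (h' : HasFacetMult Ψ f x lam l) : HasFacetMult (Φ + Ψ) f x lam (k + l) := by
  obtain ⟨B, hB, h⟩ := h
  obtain ⟨B', hB', h'⟩ := h'
  refine ⟨B + B', hB.add hB', ?_⟩
  filter_upwards [h, h'] with y hy hy'
  rw [Pi.add_apply, hy, hy', ev_add]
  push_cast
  ring

theorem HasRidgeMult.add {Φ Ψ : X.Realization → ℝ} {r : X.cell m} {x : Simp m} {k l : ℤ}
    (h : HasRidgeMult Φ r x k) (h' : HasRidgeMult Ψ r x l) :
    HasRidgeMult (Φ + Ψ) r x (k + l) := by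
  obtain ⟨A, b, hA, hb, h1, h2, h3⟩ := h
  obtain ⟨A', b', hA', hb', h1', h2', h3'⟩ := h'
  refine ⟨A + A', b + b', hA.add hA', fun t v => ?_, ?_, fun t => ?_, ?_⟩
  · obtain ⟨z, hz⟩ := hb t v
    obtain ⟨z', hz'⟩ := hb' t v
    exact ⟨z + z', by push_cast; rw [← hz, ← hz']; simp only [Pi.add_apply]; ring⟩
  · filter_upwards [h1, h1'] with y hy hy'
    rw [Pi.add_apply, hy, hy', ev_add]
  · filter_upwards [h2 t, h2' t] with y hy hy'
    rw [Pi.add_apply, hy, hy', Pi.add_apply, ins_add, ev_add]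
  · push_cast
    rw [h3, h3']
    simp only [Pi.add_apply, mul_add, Finset.sum_add_distrib]
    ring

theorem HasMultDir.add {Φ Ψ : X.Realization → ℝ} {y : X.Realization}
    {lam : Fin (m + 2) → ℤ} {k l : ℤ} (h : HasMultDir Φ y lam k)
    (h' : HasMultDir Ψ y lam l) : HasMultDir (Φ + Ψ) y lam (k + l) := by
  rcases h with ⟨f, x, hx, rfl, h⟩ | ⟨r, x, hx, rfl, h⟩
  · rcases h' with ⟨f', x', hx', hy, h'⟩ | ⟨r', x', hx', hy, h'⟩
    · obtain ⟨rfl, rfl⟩ := param_injOn_isInt hx hy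
      exact Or.inl ⟨f', x', hx, rfl, h.add h'⟩
    · cases cell_eq_of_param_eq hx hx' hy
  · rcases h' with ⟨f', x', hx', hy, h'⟩ | ⟨r', x', hx', hy, h'⟩
    · cases cell_eq_of_param_eq hx hx' hy
    · obtain ⟨rfl, rfl⟩ := param_injOn_isInt hx hy
      exact Or.inr ⟨r', x', hx, rfl, h.add h'⟩

/-- The second difference of `max (L, 0)` along a direction on which `L` has slope `d`. -/
theorem max_add_max_neg (t d : ℝ) : max (t * d) 0 + max (-t * d) 0 = |t| * |d| := by
  rw [← abs_mul]
  rcases le_total 0 (t * d) with h | h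
  · rw [max_eq_left h, max_eq_right (by linarith), abs_of_nonneg h, add_zero]
  · rw [max_eq_right h, max_eq_left (by linarith), abs_of_nonpos h]
    ring

/-- The multiplicity in a facet does not depend on the primitive slope vector of the wall. -/
theorem HasFacetMult.unique {Φ : X.Realization → ℝ} {f : X.cell (m + 1)} {x : Simp (m + 1)}
    (hx : IsInt x) {lam lam' : Fin (m + 2) → ℤ} (hlam : Primitive lam) (hlam' : Primitive lam')
    {k l : ℤ} (h : HasFacetMult Φ f x lam k) (h' : HasFacetMult Φ f x lam' l) : k = l := by
  classical
  -- the second differences of `Φ` along the edges determine the products `k * |lam i - lam j|`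
  have key : ∀ i j, (k : ℝ) * |(lam i : ℝ) - lam j| = l * |(lam' i : ℝ) - lam' j| := by
    intro i j
    obtain ⟨B, -, h⟩ := h
    obtain ⟨B', -, h'⟩ := h'
    set v : Fin (m + 2) → ℝ := Pi.single i 1 - Pi.single j 1 with hv
    have hv0 : ∑ i, v i = 0 := by simp [hv]
    have hform : ∀ n : Fin (m + 2) → ℤ, form (toR n) v = (n i : ℝ) - n j := by
      intro n
      rw [hv, map_sub]
      simp [form_apply, Pi.single_apply, toR]
    obtain ⟨γ, hγ, hγ'⟩ := hx.exists_curve hv0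
    have hneg : Filter.Tendsto (fun t : ℝ => -t) (𝓝 0) (𝓝 0) := by
      simpa using (continuous_neg (G := ℝ)).tendsto 0
    have h1 : ∀ᶠ t in 𝓝[≠] (0 : ℝ), (k : ℝ) * |(lam i : ℝ) - lam j| =
        l * |(lam' i : ℝ) - lam' j| := by
      filter_upwards [nhdsWithin_le_nhds hγ', nhdsWithin_le_nhds (hneg.eventually hγ'),
        nhdsWithin_le_nhds (hγ.eventually h), nhdsWithin_le_nhds (hγ.eventually h'),
        nhdsWithin_le_nhds ((hγ.comp hneg).eventually h),
        nhdsWithin_le_nhds ((hγ.comp hneg).eventually h'), self_mem_nhdsWithin] with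
        t c1 c2 d1 d1' d2 d2' ht0
      have h0 := h.self_of_nhds
      have h0' := h'.self_of_nhds
      simp only [Function.comp_apply] at d2 d2'
      rw [ev_curve c1, ev_curve c1, hform, add_sub_cancel_left] at d1 d1'
      rw [ev_curve c2, ev_curve c2, hform, add_sub_cancel_left] at d2 d2'
      rw [sub_self, max_self, mul_zero, add_zero] at h0 h0'
      have m1 := max_add_max_neg t ((lam i : ℝ) - lam j)
      have m2 := max_add_max_neg t ((lam' i : ℝ) - lam' j)
      have m3 : |t| * ((k : ℝ) * |(lam i : ℝ) - lam j|) =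
          |t| * (l * |(lam' i : ℝ) - lam' j|) := by
        linear_combination -k * m1 + l * m2 - d1 - d2 + d1' + d2' + 2 * h0 - 2 * h0'
      exact mul_left_cancel₀ (abs_ne_zero.2 ht0) m3
    exact h1.exists.choose_spec
  clear h h'
  obtain ⟨i, j, hij⟩ := hlam.exists_ne
  obtain ⟨i', j', hij'⟩ := hlam'.exists_ne
  have hpos : 0 < |(lam i : ℝ) - lam j| := abs_pos.2 (sub_ne_zero.2 (by exact_mod_cast hij))
  have hpos' : 0 < |(lam' i' : ℝ) - lam' j'| := abs_pos.2 (sub_ne_zero.2 (by exact_mod_cast hij'))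
  have hk0 : k = 0 ↔ l = 0 := by
    constructor
    · rintro rfl
      have := key i' j'
      rw [Int.cast_zero, zero_mul, eq_comm, mul_eq_zero] at this
      exact_mod_cast this.resolve_right hpos'.ne'
    · rintro rfl
      have := key i j
      rw [Int.cast_zero, zero_mul, mul_eq_zero] at this
      exact_mod_cast this.resolve_right hpos.ne'
  by_cases hk : k = 0
  · rw [hk, hk0.1 hk]
  have hl : l ≠ 0 := fun hl => hk (hk0.2 hl)
  have hkR : (k : ℝ) ≠ 0 := by exact_mod_cast hk
  have hlR : (l : ℝ) ≠ 0 := by exact_mod_cast hl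
  -- both quotients of the multiplicities are integers, by primitivity
  have hint : ∀ {k l : ℤ} {a b : Fin (m + 2) → ℤ}, Primitive b → (k : ℝ) ≠ 0 →
      (∀ i j, (k : ℝ) * |(a i : ℝ) - a j| = l * |(b i : ℝ) - b j|) →
      ∃ z : ℤ, (l : ℝ) / k = z := by
    intro k l a b hb hk h
    refine hb.exists_int fun i j => ?_
    have h1 : |(a i : ℝ) - a j| = l / k * |(b i : ℝ) - b j| := by
      field_simp
      linear_combination h i j
    rcases abs_choice ((b i : ℝ) - b j) with h2 | h2
    · refine ⟨|a i - a j|, ?_⟩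
      push_cast
      rw [h1, h2]
    · refine ⟨-|a i - a j|, ?_⟩
      push_cast
      rw [h1, h2]
      ring
  obtain ⟨z, hz⟩ := hint hlam' hkR key
  obtain ⟨w, hw⟩ := hint hlam hlR fun i j => (key i j).symm
  have hzw : z * w = 1 := by
    have : (z : ℝ) * w = 1 := by
      rw [← hz, ← hw]
      field_simp
    exact_mod_cast this
  have hz0 : 0 < z := by
    have h1 : (0 : ℝ) < z * |(lam' i' : ℝ) - lam' j'| ∨ (z : ℝ) < 0 := by
      rcases lt_trichotomy (z : ℝ) 0 with h | h | h
      · exact Or.inr h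
      · have : z = 0 := by exact_mod_cast h
        rw [this] at hzw
        simp at hzw
      · exact Or.inl (mul_pos h hpos')
    rcases h1 with h1 | h1
    · exact_mod_cast (pos_iff_pos_of_mul_pos h1).2 hpos'
    · exfalso
      have h2 := key i' j'
      have h3 : (l : ℝ) = z * k := by
        rw [← hz]
        field_simp
      rw [h3, mul_comm (z : ℝ) k, mul_assoc] at h2
      have h4 := mul_left_cancel₀ hkR h2
      nlinarith [abs_nonneg ((lam i' : ℝ) - lam j')]
  have hz1 : z = 1 := by
    rcases Int.eq_one_or_neg_one_of_mul_eq_one hzw with h | h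
    · exact h
    · omega
  rw [hz1, Int.cast_one, div_eq_one_iff_eq hkR] at hz
  exact_mod_cast hz.symm

theorem HasRidgeMult.unique {Φ : X.Realization → ℝ} {r : X.cell m} {x : Simp m} {k l : ℤ}
    (h : HasRidgeMult Φ r x k) (h' : HasRidgeMult Φ r x l) : k = l := by
  obtain ⟨A, b, hA, hb, h1, h2, h3⟩ := h
  obtain ⟨A', b', hA', hb', h1', h2', h3'⟩ := h'
  have hAA : A = A' := eq_of_eventually_ev (x₀ := x) (by
    filter_upwards [h1, h1'] with y hy hy'
    rw [← hy, hy'])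
  subst hAA
  have hbb : b = b' := funext fun t => by
    have : ins t A (b t) = ins t A (b' t) := eq_of_eventually_ev
      (x₀ := stdSimplex.map (emb t) x) (by
      filter_upwards [h2 t, h2' t] with y hy hy'
      rw [← hy, hy'])
    have := congrFun this t.1.2
    simpa [ins] using this
  subst hbb
  exact_mod_cast h3.trans h3'.symm

theorem HasMult.unique {Φ : X.Realization → ℝ} {y : X.Realization} {k l : ℤ}
    (h : HasMult Φ y k) (h' : HasMult Φ y l) : k = l := by
  obtain ⟨lam, hlam, h⟩ := h
  obtain ⟨lam', hlam', h'⟩ := h'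
  rcases h with ⟨f, x, hx, rfl, h⟩ | ⟨r, x, hx, rfl, h⟩
  · rcases h' with ⟨f', x', hx', hy, h'⟩ | ⟨r', x', hx', hy, h'⟩
    · obtain ⟨rfl, rfl⟩ := param_injOn_isInt hx hy
      exact h.unique hx hlam hlam' h'
    · cases cell_eq_of_param_eq hx hx' hy
  · rcases h' with ⟨f', x', hx', hy, h'⟩ | ⟨r', x', hx', hy, h'⟩
    · cases cell_eq_of_param_eq hx hx' hy
    · obtain ⟨rfl, rfl⟩ := param_injOn_isInt hx hy
      exact h.unique h'

theorem HasMultDir.congr {Φ Ψ : X.Realization → ℝ} {y : X.Realization}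
    {lam : Fin (m + 2) → ℤ} {k : ℤ} (h : HasMultDir Φ y lam k) (heq : Φ =ᶠ[𝓝 y] Ψ) :
    HasMultDir Ψ y lam k := by
  rcases h with ⟨f, x, hx, rfl, B, hB, h⟩ | ⟨r, x, hx, rfl, A, b, hA, hb, h1, h2, h3⟩
  · refine Or.inl ⟨f, x, hx, rfl, B, hB, ?_⟩
    filter_upwards [h, (continuous_param f).continuousAt.eventually heq] with y hy hy'
    rw [← hy', hy]
  · refine Or.inr ⟨r, x, hx, rfl, A, b, hA, hb, ?_, fun t => ?_, h3⟩
    · filter_upwards [h1, (continuous_param r).continuousAt.eventually heq] with y hy hy'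
      rw [← hy', hy]
    · have ht : param t.1.1 (stdSimplex.map (emb t) x) = param r x := by
        rw [param_map, t.2]
      have := (continuous_param t.1.1).tendsto (stdSimplex.map (emb t) x)
      rw [ht] at this
      filter_upwards [h2 t, this.eventually heq] with y hy hy'
      rw [← hy', hy]

theorem HasMult.congr {Φ Ψ : X.Realization → ℝ} {y : X.Realization} {k : ℤ} (h : HasMult Φ y k)
    (heq : Φ =ᶠ[𝓝 y] Ψ) : HasMult Ψ y k := by
  obtain ⟨lam, hlam, h⟩ := h
  exact ⟨lam, hlam, h.congr heq⟩

end Multiplicity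

/-! ### Piecewise linear functions and arrangements -/

section Form

open DeltaComplex

variable {X : DeltaComplex.{u}} {k : ℕ}

/-- On the part of the simplex `s` that lies over `U`, the function `Φ` is given by an affine
function with integral slopes that only depends on the signs of the functionals in `H`. -/
def IsForm (U : Opens X.Realization) (Φ : X.Realization → ℝ) (s : X.cell k)
    (H : Finset (Fin (k + 1) → ℝ)) (F : ((Fin (k + 1) → ℝ) → SignType) → (Fin (k + 1) → ℝ)) :
    Prop :=
  (∀ σ, IntDiff (F σ)) ∧ ∀ x, param s x ∈ U → Φ (param s x) = ev (F (sgn H x)) x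

open Classical in
/-- The extension by zero of a function on an open subset of the realization. -/
noncomputable def ext0 (U : Opens X.Realization) (φ : U → ℝ) (y : X.Realization) : ℝ :=
  if h : y ∈ U then φ ⟨y, h⟩ else 0

theorem ext0_of_mem {U : Opens X.Realization} (φ : U → ℝ) {y : X.Realization} (h : y ∈ U) :
    ext0 U φ y = φ ⟨y, h⟩ := dif_pos h

theorem ext0_add {U : Opens X.Realization} (φ ψ : U → ℝ) :
    ext0 U (φ + ψ) = ext0 U φ + ext0 U ψ := by
  ext y
  by_cases h : y ∈ U <;> simp [ext0, h]

theorem continuousOn_ext0 {U : Opens X.Realization} {φ : U → ℝ} (h : Continuous φ) :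
    ContinuousOn (ext0 U φ) U := by
  rw [continuousOn_iff_continuous_domRestrict]
  exact h.congr fun y => (ext0_of_mem φ y.2).symm

theorem IsPLOn.exists_isForm {U : Opens X.Realization} {φ : U → ℝ} {s : X.cell k}
    (h : IsPLOn U φ s) : ∃ H F, IsForm U (ext0 U φ) s H F := by
  classical
  obtain ⟨N, _, A, c, μ, hA, hcov, hφ⟩ := h
  have : Fintype N := Fintype.ofFinite N
  choose H hH using fun i => (hA i).exists_cutBy
  refine ⟨Finset.univ.biUnion H, fun σ =>
    if hσ : ∃ (i : N) (x : Simp k), x ∈ A i ∧ sgn (Finset.univ.biUnion H) x = σ then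
      fun j => c hσ.choose + (μ hσ.choose j : ℝ) else 0, ?_, ?_⟩
  · intro σ
    dsimp only
    split_ifs with hσ
    · exact IntDiff.const_add_int _ _
    · exact IntDiff.zero
  · intro x hx
    obtain ⟨i, hi⟩ := hcov x
    have hσ : ∃ (i : N) (y : Simp k), y ∈ A i ∧
        sgn (Finset.univ.biUnion H) y = sgn (Finset.univ.biUnion H) x := ⟨i, x, hi, rfl⟩
    dsimp only
    rw [dif_pos hσ, ext0_of_mem φ hx, ev_const_add]
    obtain ⟨y, hy, hyx⟩ := hσ.choose_spec
    refine hφ _ x ?_ hx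
    have hcut := (hH hσ.choose).mono (Finset.subset_biUnion_of_mem H (Finset.mem_univ _))
    refine hcut y hy (openCell_subset_closedCell ?_)
    rw [← sgn_eq_iff, hyx]

theorem IsForm.mono {U : Opens X.Realization} {Φ : X.Realization → ℝ} {s : X.cell k}
    {H H' : Finset (Fin (k + 1) → ℝ)} {F} (h : IsForm U Φ s H F) (hH : H ⊆ H') :
    ∃ F', IsForm U Φ s H' F' := by
  classical
  refine ⟨fun σ => F fun h => if h ∈ H then σ h else 0, fun σ => h.1 _, fun x hx => ?_⟩
  rw [h.2 x hx]
  dsimp only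
  congr 2
  ext h
  by_cases hh : h ∈ H
  · simp [sgn, hh, hH hh]
  · simp [sgn, hh]

theorem eventually_sign_eq {h : Fin (k + 1) → ℝ} {x : Simp k} (hx : ev h x ≠ 0) :
    ∀ᶠ y in 𝓝 x, SignType.sign (ev h y) = SignType.sign (ev h x) := by
  have hc := (continuous_ev h).continuousAt (x := x)
  rcases lt_or_gt_of_ne hx with hx | hx
  · filter_upwards [hc.eventually (gt_mem_nhds hx)] with y hy
    rw [sign_neg hy, sign_neg hx]
  · filter_upwards [hc.eventually (lt_mem_nhds hx)] with y hy
    rw [sign_pos hy, sign_pos hx]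

theorem eventually_forall_sign_eq (H : Finset (Fin (k + 1) → ℝ)) (x : Simp k) :
    ∀ᶠ y in 𝓝 x, ∀ h ∈ H, ev h x ≠ 0 → SignType.sign (ev h y) = SignType.sign (ev h x) := by
  rw [Filter.eventually_all_finset]
  intro h _
  by_cases hx : ev h x = 0
  · exact Filter.Eventually.of_forall fun y hy => absurd hx hy
  · filter_upwards [eventually_sign_eq hx] with y hy _ using hy

theorem eventually_param_mem {U : Opens X.Realization} {s : X.cell k} {x : Simp k}
    (hx : param s x ∈ U) : ∀ᶠ y in 𝓝 x, param s y ∈ U :=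
  (continuous_param s).continuousAt.eventually (U.2.mem_nhds hx)

theorem ev_ne_zero_of_mem_openCell {H : Finset (Fin (k + 1) → ℝ)} {p q : Simp k}
    (hq : q ∈ openCell H p) {h : Fin (k + 1) → ℝ} (hh : h ∈ H) : ev h q ≠ 0 ↔ ev h p ≠ 0 := by
  rw [← sign_ne_zero, hq h hh, sign_ne_zero]

/-- A piecewise linear function is affine near the points that lie on none of the hyperplanes. -/
theorem IsForm.eventually_eq {U : Opens X.Realization} {Φ : X.Realization → ℝ} {s : X.cell k}
    {H : Finset (Fin (k + 1) → ℝ)} {F} (hF : IsForm U Φ s H F) {p : Simp k}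
    (hp : ∀ h ∈ H, ev h p = 0 → h = 0) {q : Simp k} (hq : q ∈ openCell H p)
    (hqU : param s q ∈ U) : ∀ᶠ y in 𝓝 q, Φ (param s y) = ev (F (sgn H p)) y := by
  filter_upwards [eventually_forall_sign_eq H q, eventually_param_mem hqU] with y hy hyU
  rw [hF.2 y hyU]
  congr 2
  rw [sgn_eq_iff]
  intro h hh
  by_cases h0 : ev h p = 0
  · rw [hp h hh h0, ev_zero, ev_zero]
  · rw [hy h hh ((ev_ne_zero_of_mem_openCell hq hh).2 h0), hq h hh]

/-- If all hyperplanes through `p` coincide with the zero set of `η`, a piecewise linear function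
is affine near `p` on the side where `η ≥ 0`, and the same is true with the same affine function at
all points of the cell of `p`. -/
theorem IsForm.exists_oneSided {U : Opens X.Realization} {Φ : X.Realization → ℝ} {s : X.cell k}
    {H : Finset (Fin (k + 1) → ℝ)} {F} (hF : IsForm U Φ s H F) (hc : ContinuousOn Φ U)
    {p u : Simp k} {η : Fin (k + 1) → ℝ} (hu : 0 < ev η u)
    (hZ : ∀ h ∈ H, ev h p = 0 → ∃ c : ℝ, h = c • η) :
    ∃ B, IntDiff B ∧ ∀ q ∈ openCell H p, param s q ∈ U →
      ∀ᶠ y in 𝓝 q, 0 ≤ ev η y → Φ (param s y) = ev B y := by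
  classical
  choose! c hc' using hZ
  -- `τ` gives the signs near `p` at the points where `η` is positive
  set τ : (Fin (k + 1) → ℝ) → SignType := fun h => if h ∈ H then
    if ev h p = 0 then SignType.sign (c h) else SignType.sign (ev h p) else 0 with hτ
  refine ⟨F τ, hF.1 _, fun q hq hqU => ?_⟩
  have h1 : ∀ᶠ y in 𝓝 q, 0 < ev η y → Φ (param s y) = ev (F τ) y := by
    filter_upwards [eventually_forall_sign_eq H q, eventually_param_mem hqU] with y hy hyU hηy
    rw [hF.2 y hyU]
    congr 2
    ext h
    by_cases hh : h ∈ H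
    · by_cases h0 : ev h p = 0
      · simp only [sgn, hτ, hh, h0, if_true]
        rw [hc' h hh h0, ev_smul, sign_mul, sign_pos hηy, mul_one, ← hc' h hh h0]
      · simp only [sgn, hτ, hh, h0, if_true, if_false]
        rw [hy h hh ((ev_ne_zero_of_mem_openCell hq hh).2 h0), hq h hh]
    · simp only [sgn, hτ, hh, if_false]
  filter_upwards [h1, eventually_eventually_nhds.2 h1, eventually_param_mem hqU]
    with y hy hy' hyU hηy
  rcases hηy.lt_or_eq with hlt | heq
  · exact hy hlt
  · -- points of the boundary are limits of points with `η > 0`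
    have ht := tendsto_mix y u
    have h2 : Filter.Tendsto (fun t => Φ (param s (mix y u t))) (𝓝[>] 0) (𝓝 (Φ (param s y))) :=
      (hc.continuousAt (U.2.mem_nhds hyU)).tendsto.comp
        (((continuous_param s).tendsto y).comp ht)
    have h3 : Filter.Tendsto (fun t => ev (F τ) (mix y u t)) (𝓝[>] 0) (𝓝 (ev (F τ) y)) :=
      ((continuous_ev (F τ)).tendsto y).comp ht
    refine tendsto_nhds_unique_of_eventuallyEq h2 h3 ?_
    filter_upwards [ht.eventually hy', self_mem_nhdsWithin] with t ht' ht0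
    refine ht' ?_
    rw [ev_mix, ← heq, mul_zero, zero_add]
    exact mul_pos ht0 hu

end Form

section Struct

open DeltaComplex

variable {m : ℕ} {X : WeakTropicalComplex.{u} m}

theorem form_eq_zero_of_mem_linSpan {k : ℕ} {H : Finset (Fin (k + 1) → ℝ)} {p : Simp k}
    {h : Fin (k + 1) → ℝ} (hh : h ∈ H) (hp : ev h p = 0) :
    ∀ v ∈ linSpan (closedCell H p), form h v = 0 := by
  have : linSpan (closedCell H p) ≤ LinearMap.ker (form h) := by
    refine linSpan_le.2 fun y hy => ?_
    rw [LinearMap.mem_ker, form_coe]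
    rcases hy h hh with h1 | h1
    · exact h1
    · rwa [hp, sign_zero, sign_eq_zero_iff] at h1
  exact this

/-- Along a cell of codimension one of an arrangement in a facet, all piecewise linear functions
that are affine on the cells of the arrangement have constant multiplicities, with respect to a
primitive slope vector that only depends on the cell. -/
theorem exists_facetMult (f : X.cell (m + 1)) (H : Finset (Fin (m + 2) → ℝ)) {p : Simp (m + 1)}
    (hp : IsInt p) (hd : Module.finrank ℝ (linSpan (closedCell H p)) = m + 1) :
    ∃ lam, Primitive lam ∧ ∀ (U : Opens X.Realization) (Φ : X.Realization → ℝ) (F),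
      ContinuousOn Φ U → IsForm U Φ f H F → ∃ k : ℤ, ∀ q ∈ openCell H p, IsInt q →
        param f q ∈ U → HasFacetMult Φ f q lam k := by
  set S := linSpan (closedCell H p) with hS
  have hpS : (p : Fin (m + 2) → ℝ) ∈ S := mem_linSpan mem_closedCell_self
  have hqS : ∀ q ∈ openCell H p, (q : Fin (m + 2) → ℝ) ∈ S := fun q hq =>
    mem_linSpan (openCell_subset_closedCell hq)
  -- the two affine functions on the sides of the cell differ by a multiple of its equation
  have core : ∀ η : Fin (m + 2) → ℝ, η ≠ 0 → (∀ v ∈ S, form η v = 0) →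
      (∀ h, (∀ v ∈ S, form h v = 0) → ∃ c : ℝ, h = c • η) →
      ∀ (U : Opens X.Realization) (Φ : X.Realization → ℝ) (F),
      ContinuousOn Φ U → IsForm U Φ f H F → ∃ (B C : Fin (m + 2) → ℝ) (ρ : ℝ), IntDiff B ∧
        IntDiff C ∧ (∀ q ∈ openCell H p, IsInt q → param f q ∈ U → C = B + ρ • η ∧
          ∀ᶠ y in 𝓝 q, (0 ≤ ev η y → Φ (param f y) = ev C y) ∧
            (ev η y ≤ 0 → Φ (param f y) = ev B y)) := by
    intro η hη0 hηS hη U Φ F hc hF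
    obtain ⟨u, hu⟩ := hp.exists_pos hη0 (hηS p hpS)
    obtain ⟨u', hu'⟩ := hp.exists_pos (neg_ne_zero.2 hη0) (by
      have := hηS p hpS
      rw [← form_coe, form, map_neg, ← form, LinearMap.neg_apply, this, neg_zero])
    have hZ : ∀ h ∈ H, ev h p = 0 → ∃ c : ℝ, h = c • η := fun h hh h0 =>
      hη h (form_eq_zero_of_mem_linSpan hh h0)
    obtain ⟨C, hC, hC'⟩ := hF.exists_oneSided hc hu hZ
    obtain ⟨B, hB, hB'⟩ := hF.exists_oneSided (η := -η) hc hu' fun h hh h0 => by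
      obtain ⟨c, hc⟩ := hZ h hh h0
      exact ⟨-c, by rw [hc, smul_neg, neg_smul, neg_neg]⟩
    have hneg : ∀ y, ev (-η) y = - ev η y := fun y => by
      rw [← neg_one_smul ℝ, ev_smul, neg_one_mul]
    have hev : ∀ q ∈ openCell H p, param f q ∈ U →
        ∀ᶠ y in 𝓝 q, (0 ≤ ev η y → Φ (param f y) = ev C y) ∧
            (ev η y ≤ 0 → Φ (param f y) = ev B y) := by
      intro q hq hqU
      filter_upwards [hC' q hq hqU, hB' q hq hqU] with y h1 h2
      rw [hneg, neg_nonneg] at h2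
      exact ⟨h1, h2⟩
    by_cases hex : ∃ q ∈ openCell H p, IsInt q ∧ param f q ∈ U
    · obtain ⟨q₀, hq₀, hq₀i, hq₀U⟩ := hex
      obtain ⟨ρ, hρ⟩ := hq₀i.exists_eq_smul (η := η) (δ := C - B) (hηS q₀ (hqS q₀ hq₀)) (by
        filter_upwards [hev q₀ hq₀ hq₀U] with y hy h0
        rw [ev_sub, ← hy.1 h0.ge, ← hy.2 h0.le, sub_self])
      refine ⟨B, C, ρ, hB, hC, fun q hq hqi hqU => ⟨?_, hev q hq hqU⟩⟩
      rw [← hρ, add_sub_cancel]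
    · exact ⟨B, C, 0, hB, hC, fun q hq hqi hqU => absurd ⟨q, hq, hqi, hqU⟩ hex⟩
  obtain ⟨η₀, hη₀, hη₀S, hη₀'⟩ := exists_normal hd
  by_cases hA : ∃ lam : Fin (m + 2) → ℤ, Primitive lam ∧
      ∀ v ∈ S, form (toR lam - fun _ => ev (toR lam) p) v = 0
  · obtain ⟨lam, hlam, hlamS⟩ := hA
    set η : Fin (m + 2) → ℝ := toR lam - fun _ => ev (toR lam) p with hη
    have hηij : ∀ i j, η i - η j = (lam i : ℝ) - lam j := fun i j => by
      simp [hη, toR]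
    have hη0 : η ≠ 0 := by
      intro h0
      obtain ⟨i, j, hij⟩ := hlam.exists_ne
      have := hηij i j
      rw [h0] at this
      simp only [Pi.zero_apply, sub_self] at this
      exact hij (by exact_mod_cast (sub_eq_zero.1 this.symm))
    obtain ⟨c₀, hc₀⟩ := hη₀' η hlamS
    have hc₀0 : c₀ ≠ 0 := by
      rintro rfl
      exact hη0 (by rw [hc₀, zero_smul])
    have hη' : ∀ h, (∀ v ∈ S, form h v = 0) → ∃ c : ℝ, h = c • η := by
      intro h hh
      obtain ⟨c, hc⟩ := hη₀' h hh
      refine ⟨c / c₀, ?_⟩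
      rw [hc, hc₀, smul_smul, div_mul_cancel₀ _ hc₀0]
    refine ⟨lam, hlam, fun U Φ F hc hF => ?_⟩
    obtain ⟨B, C, ρ, hB, hC, hBC⟩ := core η hη0 hlamS hη' U Φ F hc hF
    by_cases hex : ∃ q ∈ openCell H p, IsInt q ∧ param f q ∈ U
    · obtain ⟨q₀, hq₀, hq₀i, hq₀U⟩ := hex
      have hCB := (hBC q₀ hq₀ hq₀i hq₀U).1
      obtain ⟨k, hk⟩ := hlam.exists_int (ρ := ρ) fun i j => by
        obtain ⟨z, hz⟩ := hC.sub hB i j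
        refine ⟨z, ?_⟩
        rw [← hz, hCB, ← hηij]
        simp only [Pi.sub_apply, Pi.add_apply, Pi.smul_apply, smul_eq_mul]
        ring
      refine ⟨k, fun q hq hqi hqU => ⟨B, hB, ?_⟩⟩
      have hηq : ev η q = 0 := hlamS q (hqS q hq)
      have hηy : ∀ y, ev η y = ev (toR lam) y - ev (toR lam) p := fun y => by
        rw [hη, ev_sub, ev_const]
      filter_upwards [(hBC q hq hqi hqU).2] with y hy
      have h1 : ev (toR lam) y - ev (toR lam) q = ev η y := by
        rw [hηy] at hηq ⊢
        linarith
      rw [h1]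
      rcases le_total 0 (ev η y) with h | h
      · rw [hy.1 h, max_eq_left h, hCB, ev_add, ev_smul, hk]
      · rw [hy.2 h, max_eq_right h, mul_zero, add_zero]
    · exact ⟨0, fun q hq hqi hqU => absurd ⟨q, hq, hqi, hqU⟩ hex⟩
  · -- if the cell has no integral equation, the functions are affine near its points
    refine ⟨Pi.single 0 1, primitive_single 0, fun U Φ F hc hF => ?_⟩
    obtain ⟨B, C, ρ, hB, hC, hBC⟩ := core η₀ hη₀ hη₀S hη₀' U Φ F hc hF
    refine ⟨0, fun q hq hqi hqU => ⟨B, hB, ?_⟩⟩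
    obtain ⟨hCB, hev⟩ := hBC q hq hqi hqU
    have hδ : C - B = ρ • η₀ := by rw [hCB, add_sub_cancel_left]
    have hδS : ∀ v ∈ S, form (C - B) v = 0 := by
      intro v hv
      rw [hδ, form, map_smul, ← form, LinearMap.smul_apply, hη₀S v hv, smul_zero]
    have hBC0 : C - B = 0 := by
      by_contra hne
      obtain ⟨μ, hμ⟩ := (hC.sub hB).exists_eq
      have hδp : ev (C - B) p = 0 := hδS p hpS
      by_cases hconst : ∃ i j, μ i ≠ μ j
      · obtain ⟨g, lam, hg, hlam, hμg⟩ := exists_primitive hconst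
        refine hA ⟨lam, hlam, ?_⟩
        have hgR : (g : ℝ) ≠ 0 := by exact_mod_cast hg
        set d : ℝ := (C - B) 0 + μ 0 with hd'
        have h1 : C - B = (fun _ => d) + (g : ℝ) • toR lam := by
          ext i
          rw [hμ]
          simp only [Pi.add_apply, Pi.smul_apply, smul_eq_mul, toR, hμg i, hd']
          push_cast
          ring
        have h2 : d + g * ev (toR lam) p = 0 := by
          rw [← hδp, h1, ev_add, ev_const, ev_smul]
        have h3 : (g : ℝ) • (toR lam - fun _ => ev (toR lam) p) = C - B := by
          rw [h1]
          ext i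
          simp only [Pi.add_apply, Pi.smul_apply, Pi.sub_apply, smul_eq_mul]
          linear_combination -h2
        intro v hv
        have h4 := hδS v hv
        rw [← h3, form, map_smul, ← form, LinearMap.smul_apply, smul_eq_mul] at h4
        exact (mul_eq_zero.1 h4).resolve_left hgR
      · push Not at hconst
        refine hne ?_
        have h1 : C - B = fun _ => (C - B) 0 + (μ 0 : ℝ) := by
          conv_lhs => rw [hμ]
          ext i
          rw [hconst i 0]
        rw [h1, ev_const] at hδp
        rw [h1, hδp]
        rfl
    filter_upwards [hev] with y hy
    rw [Int.cast_zero, zero_mul, add_zero]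
    rcases le_total 0 (ev η₀ y) with h | h
    · rw [hy.1 h, sub_eq_zero.1 hBC0]
    · rw [hy.2 h]

/-- The arrangement `𝓗` is fine enough to describe the continuous function `Φ` on `U`, on all
simplices and on the simplices of `N_r` near the ridges `r`. -/
structure Adapted (𝓗 : Arrangement X.toDeltaComplex) (U : Opens X.Realization)
    (Φ : X.Realization → ℝ) : Prop where
  cont : ContinuousOn Φ U
  form : ∀ {k : ℕ} (s : X.cell k), ∃ F, IsForm U Φ s (𝓗.planes s) F
  link : ∀ (r : X.cell m) (t : X.Link r), ∃ H F, IsForm U Φ t.1.1 H F ∧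
    ∀ h ∈ H, (fun v => h (emb t v)) ∈ 𝓗.planes r

theorem Adapted.mono {𝓗 𝓗' : Arrangement X.toDeltaComplex} {U : Opens X.Realization}
    {Φ : X.Realization → ℝ} (h : Adapted 𝓗 U Φ)
    (hle : ∀ {k : ℕ} (s : X.cell k), 𝓗.planes s ⊆ 𝓗'.planes s) : Adapted 𝓗' U Φ where
  cont := h.cont
  form s := by
    obtain ⟨F, hF⟩ := h.form s
    exact hF.mono (hle s)
  link r t := by
    obtain ⟨H, F, hF, hH⟩ := h.link r t
    exact ⟨H, F, hF, fun h hh => hle r (hH h hh)⟩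

/-- The hyperplanes that occur in the pieces of a piecewise linear function on the simplices,
together with the traces on each ridge of the hyperplanes on the facets around it, form an adapted
arrangement. -/
theorem exists_adapted {U : Opens X.Realization} (φ : PL U) :
    ∃ 𝓗 : Arrangement X.toDeltaComplex, Adapted 𝓗 U (ext0 U φ.1) := by
  classical
  choose H F hF using fun (k : ℕ) (s : X.cell k) => (φ.2.2 k s).exists_isForm
  have hfin : ∀ (k : ℕ) (s : X.cell k), Finite (X.Link s) := fun k s => by
    have := X.finite_cell (k + 1)
    exact inferInstanceAs (Finite {p : X.cell (k + 1) × Fin (k + 2) //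
      X.face (Fin.succAboveOrderEmb p.2) p.1 = s})
  have hS : ∀ (k : ℕ) (s : X.cell k), (Set.range (fun i : Fin (k + 1) => (Pi.single i 1 : _ → ℝ)) ∪
      (H k s : Set (Fin (k + 1) → ℝ)) ∪ ⋃ t : X.Link s, (fun h v => h (t.1.2.succAbove v)) ''
        (H (k + 1) t.1.1 : Set (Fin (k + 2) → ℝ))).Finite := fun k s => by
    have := hfin k s
    exact ((Set.finite_range _).union (H k s).finite_toSet).union
      (Set.finite_iUnion fun t => (Finset.finite_toSet _).image _)
  refine ⟨⟨fun {k} s => (hS k s).toFinset, fun {k} s i => ?_⟩, continuousOn_ext0 φ.2.1,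
    fun {k} s => (hF k s).mono ?_, fun r t => ⟨H _ t.1.1, F _ t.1.1, hF _ _, fun h hh => ?_⟩⟩
  · simp
  · intro h hh
    simp [hh]
  · simp only [Set.Finite.mem_toFinset]
    exact Or.inr (Set.mem_iUnion.2 ⟨t, h, hh, rfl⟩)

/-- Two arrangements have a common refinement. -/
theorem Arrangement.exists_le (𝓗 𝓗' : Arrangement X.toDeltaComplex) :
    ∃ 𝓚 : Arrangement X.toDeltaComplex, (∀ {k : ℕ} (s : X.cell k), 𝓗.planes s ⊆ 𝓚.planes s) ∧
      ∀ {k : ℕ} (s : X.cell k), 𝓗'.planes s ⊆ 𝓚.planes s := by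
  classical
  exact ⟨⟨fun s => 𝓗.planes s ∪ 𝓗'.planes s, fun s i => Finset.mem_union_left _ (𝓗.coord_mem s i)⟩,
    fun s => Finset.subset_union_left, fun s => Finset.subset_union_right⟩

theorem map_emb_apply_opposite {r : X.cell m} (t : X.Link r) (x : Simp m) :
    stdSimplex.map (emb t) x t.1.2 = 0 :=
  map_apply_of_notMem _ _ (by simp [Fin.succAboveOrderEmb])

theorem param_emb {r : X.cell m} (t : X.Link r) (x : Simp m) :
    param t.1.1 (stdSimplex.map (emb t) x) = param r x := by
  rw [param_map, t.2]

/-- The value of the divisor on a ridge is an integer, because the structure constants have sum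
equal to the degree. -/
theorem exists_int_ridgeMult (r : X.cell m) {A : Fin (m + 1) → ℝ} {b : X.Link r → ℝ}
    (hA : IntDiff A) (hb : ∀ t v, ∃ z : ℤ, b t - A v = z) :
    ∃ k : ℤ, (k : ℝ) = ∑ t, b t - ∑ v, (X.α r v : ℝ) * A v := by
  choose z hz using fun t => hb t 0
  choose w hw using fun v => hA v 0
  have hα : ∑ v, (X.α r v : ℝ) = Fintype.card (X.Link r) := by
    have := X.sum_α r
    rw [Nat.card_eq_fintype_card] at this
    exact_mod_cast this
  refine ⟨∑ t, z t - ∑ v, X.α r v * w v, ?_⟩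
  push_cast
  simp only [← hz, ← hw, Finset.sum_sub_distrib, mul_sub, ← Finset.sum_mul, hα, Finset.sum_const,
    Finset.card_univ, nsmul_eq_mul]
  ring

/-- The multiplicities along a cell of maximal dimension of an arrangement in a ridge are
constant. -/
theorem exists_ridgeMult {𝓗 : Arrangement X.toDeltaComplex} {U : Opens X.Realization}
    {Φ : X.Realization → ℝ} (hΦ : Adapted 𝓗 U Φ) (r : X.cell m) {p : Simp m}
    (hd : Module.finrank ℝ (linSpan (closedCell (𝓗.planes r) p)) = m + 1) :
    ∃ k : ℤ, ∀ q ∈ openCell (𝓗.planes r) p, param r q ∈ U → HasRidgeMult Φ r q k := by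
  classical
  have hnowall : ∀ h ∈ 𝓗.planes r, ev h p = 0 → h = 0 := by
    intro h hh h0
    have h1 := form_eq_zero_of_mem_linSpan hh h0
    rw [Submodule.eq_top_of_finrank_eq (hd.trans (Module.finrank_fin_fun ℝ).symm)] at h1
    ext i
    simpa [form_apply, Pi.single_apply] using h1 (Pi.single i 1) trivial
  obtain ⟨F₀, hF₀⟩ := hΦ.form r
  choose H F hF hH using hΦ.link r
  have hside : ∀ t : X.Link r, ∃ B, IntDiff B ∧ ∀ q ∈ openCell (H t) (stdSimplex.map (emb t) p),
      param t.1.1 q ∈ U → ∀ᶠ y in 𝓝 q, Φ (param t.1.1 y) = ev B y := by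
    intro t
    obtain ⟨B, hB, hB'⟩ := (hF t).exists_oneSided hΦ.cont (p := stdSimplex.map (emb t) p)
      (u := stdSimplex.vertex t.1.2) (η := Pi.single t.1.2 1) (by rw [ev_vertex]; simp) (by
        intro h hh h0
        rw [ev_map] at h0
        have h1 := hnowall _ (hH t h hh) h0
        refine ⟨h t.1.2, funext fun i => ?_⟩
        rcases Fin.eq_self_or_eq_succAbove t.1.2 i with rfl | ⟨v, rfl⟩
        · simp
        · have := congrFun h1 v
          simp only [Pi.zero_apply] at this
          simpa using this)
    refine ⟨B, hB, fun q hq hqU => ?_⟩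
    filter_upwards [hB' q hq hqU] with y hy
    exact hy (by rw [ev_single]; exact stdSimplex.zero_le y _)
  choose B hB hB' using hside
  set A := F₀ (sgn (𝓗.planes r) p) with hA
  by_cases hex : ∃ q ∈ openCell (𝓗.planes r) p, param r q ∈ U
  swap
  · exact ⟨0, fun q hq hqU => absurd ⟨q, hq, hqU⟩ hex⟩
  have hcell : ∀ t, ∀ q ∈ openCell (𝓗.planes r) p,
      stdSimplex.map (emb t) q ∈ openCell (H t) (stdSimplex.map (emb t) p) := by
    intro t q hq h hh
    rw [ev_map, ev_map]
    exact hq _ (hH t h hh)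
  have hBA : ∀ t v, B t (emb t v) = A v := by
    intro t
    obtain ⟨q, hq, hqU⟩ := hex
    refine congrFun (eq_of_eventually_ev (h := fun v => B t (emb t v)) (h' := A) (x₀ := q) ?_)
    have h1 := hB' t _ (hcell t q hq) (by rwa [param_emb])
    filter_upwards [hF₀.eventually_eq hnowall hq hqU,
      (stdSimplex.continuous_map (S := ℝ) (emb t)).continuousAt.eventually h1] with y hy hy'
    rw [param_emb, ev_map] at hy'
    rw [← hy, ← hy']
  have hb : ∀ t v, ∃ z : ℤ, B t t.1.2 - A v = z := fun t v => by
    rw [← hBA t v]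
    exact hB t _ _
  obtain ⟨k, hk⟩ := exists_int_ridgeMult r (hF₀.1 _ : IntDiff A) hb
  refine ⟨k, fun q hq hqU => ⟨A, fun t => B t t.1.2, hF₀.1 _, hb,
    hF₀.eventually_eq hnowall hq hqU, fun t => ?_, hk⟩⟩
  have h1 : ins t A (B t t.1.2) = B t := by
    rw [← funext (hBA t)]
    exact ins_self t (B t)
  rw [h1]
  exact hB' t _ (hcell t q hq) (by rwa [param_emb])

end Struct

/-! ### Formal sums with given multiplicities -/

section Existence

open DeltaComplex

variable {m : ℕ} {X : WeakTropicalComplex.{u} m}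

instance finite_sigma_cell : Finite (Σ k, X.cell k) := by
  have := X.finite_cell
  refine Finite.of_injective (β := Σ k : Fin (m + 2), X.cell k)
    (fun c => ⟨⟨c.1, ?_⟩, c.2⟩) ?_
  · by_contra h
    exact (X.isEmpty_cell c.1 (by omega)).false c.2
  · rintro ⟨k, s⟩ ⟨k', s'⟩ h
    simp only [Sigma.mk.injEq, Fin.mk.injEq] at h
    obtain ⟨rfl, h⟩ := h
    rw [eq_of_heq h]

theorem dim_le (k : ℕ) (s : X.cell k) : k ≤ m + 1 := by
  by_contra h
  exact (X.isEmpty_cell k (by omega)).false s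

theorem finrank_linSpan_le {k : ℕ} (A : Set (Simp k)) : Module.finrank ℝ (linSpan A) ≤ k + 1 :=
  (Submodule.finrank_le _).trans_eq (Module.finrank_fin_fun ℝ)

/-- On a cell of dimension `m` of an arrangement, the functions adapted to the arrangement have
constant multiplicity, with respect to a slope vector that only depends on the cell. -/
theorem exists_hasMultDir {𝓗 : Arrangement X.toDeltaComplex} (Q : Polyhedron X.toDeltaComplex m)
    (hQ : ∃ y, OnCell 𝓗 Q y) : ∃ lam, Primitive lam ∧ ∀ (U : Opens X.Realization)
      (Φ : X.Realization → ℝ), Adapted 𝓗 U Φ → ∃ k : ℤ, ∀ y ∈ U, OnCell 𝓗 Q y →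
        HasMultDir Φ y lam k := by
  obtain ⟨k, s, A, hA⟩ := Q
  obtain ⟨_, p, hp, rfl, hAp⟩ := hQ
  dsimp only at p hp hAp
  subst hAp
  have hd := (isPolyhedronOfDim_iff.1 hA).2
  have h1 := finrank_linSpan_le (closedCell (𝓗.planes s) p)
  have h2 := dim_le k s
  obtain rfl | rfl : k = m ∨ k = m + 1 := by omega
  · refine ⟨Pi.single 0 1, primitive_single 0, fun U Φ hΦ => ?_⟩
    obtain ⟨n, hn⟩ := exists_ridgeMult hΦ s hd
    refine ⟨n, fun y hy hyQ => ?_⟩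
    obtain ⟨q, hq, rfl, hqp⟩ := hyQ
    exact Or.inr ⟨s, q, hq, rfl, hn q (closedCell_eq_iff.1 hqp.symm) hy⟩
  · obtain ⟨lam, hlam, hn⟩ := exists_facetMult s (𝓗.planes s) hp hd
    refine ⟨lam, hlam, fun U Φ hΦ => ?_⟩
    obtain ⟨F, hF⟩ := hΦ.form s
    obtain ⟨n, hn⟩ := hn U Φ F hΦ.cont hF
    refine ⟨n, fun y hy hyQ => ?_⟩
    obtain ⟨q, hq, rfl, hqp⟩ := hyQ
    exact Or.inl ⟨s, q, hq, rfl, hn q (closedCell_eq_iff.1 hqp.symm) hq hy⟩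

/-- A function that is affine near an interior point of a facet has multiplicity zero there. -/
theorem hasMultDir_zero {Φ : X.Realization → ℝ} {f : X.cell (m + 1)} {x : Simp (m + 1)}
    (hx : IsInt x) {B : Fin (m + 2) → ℝ} (hB : IntDiff B)
    (h : ∀ᶠ y in 𝓝 x, Φ (param f y) = ev B y) (lam : Fin (m + 2) → ℤ) :
    HasMultDir Φ (param f x) lam 0 := by
  refine Or.inl ⟨f, x, hx, rfl, B, hB, ?_⟩
  filter_upwards [h] with y hy
  rw [hy, Int.cast_zero, zero_mul, add_zero]

/-- Outside of a thin set, every point lies on a cell of dimension `m` or the functions adapted to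
the arrangement have multiplicity zero. -/
theorem exists_thin_onCell (𝓗 : Arrangement X.toDeltaComplex) : ∃ T : Set X.Realization,
    Thin m T ∧ ∀ y ∉ T, (∃ Q : Polyhedron X.toDeltaComplex m, OnCell 𝓗 Q y) ∨
      ∀ (U : Opens X.Realization) (Φ : X.Realization → ℝ), Adapted 𝓗 U Φ → y ∈ U →
        ∀ lam, HasMultDir Φ y lam 0 := by
  refine ⟨⋃ c : Σ k, X.cell k, param c.2 '' ⋃ C : {C : Set.range (closedCell (𝓗.planes c.2)) //
      Module.finrank ℝ (linSpan C.1) ≤ m}, C.1.1, ?_, ?_⟩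
  · refine Thin.iUnion fun c => ThinIn.image_param _ ?_
    have : Finite (Set.range (closedCell (𝓗.planes c.2))) := finite_range_closedCell _
    exact ThinIn.iUnion fun C => ThinIn.of_finrank_le C.2
  intro y hy
  obtain ⟨k, s, x, hx, rfl⟩ := exists_param_isInt y
  have hd : m < Module.finrank ℝ (linSpan (closedCell (𝓗.planes s) x)) := by
    by_contra hc
    exact hy (Set.mem_iUnion.2 ⟨⟨k, s⟩, x, Set.mem_iUnion.2 ⟨⟨⟨_, x, rfl⟩, not_lt.1 hc⟩,
      mem_closedCell_self⟩, rfl⟩)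
  have h1 := finrank_linSpan_le (closedCell (𝓗.planes s) x)
  have h2 := dim_le k s
  by_cases hd' : Module.finrank ℝ (linSpan (closedCell (𝓗.planes s) x)) = m + 1
  · exact Or.inl ⟨⟨k, s, _, isPolyhedronOfDim_iff.2 ⟨isPolyhedron_closedCell, hd'⟩⟩,
      x, hx, rfl, rfl⟩
  · obtain rfl : k = m + 1 := by omega
    refine Or.inr fun U Φ hΦ hU lam => ?_
    obtain ⟨F, hF⟩ := hΦ.form s
    refine hasMultDir_zero hx (hF.1 _)
      (hF.eventually_eq (fun h hh h0 => ?_) mem_openCell_self hU) lam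
    have h3 := form_eq_zero_of_mem_linSpan hh h0
    have htop : linSpan (closedCell (𝓗.planes s) x) = ⊤ :=
      Submodule.eq_top_of_finrank_eq (by rw [Module.finrank_fin_fun]; omega)
    rw [htop] at h3
    ext i
    simpa [form_apply, Pi.single_apply] using h3 (Pi.single i 1) trivial

/-- The formal sum `z` of polyhedra describes the multiplicities of the function `Φ` on `U`, outside
of a thin set. -/
def IsDiv (U : Opens X.Realization) (Φ : X.Realization → ℝ)
    (z : Polyhedron X.toDeltaComplex m →₀ ℤ) : Prop :=
  ∃ T : Set X.Realization, Thin m T ∧ ∀ y ∈ U, y ∉ T → HasMult Φ y (cnt y z)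

/-- The divisor is the sum of the cells of an adapted arrangement with their multiplicities. -/
theorem Adapted.exists_isDiv {𝓗 : Arrangement X.toDeltaComplex} {U : Opens X.Realization}
    {Φ : X.Realization → ℝ} (hΦ : Adapted 𝓗 U Φ) : ∃ z, IsDiv U Φ z := by
  classical
  obtain ⟨T, hT, hon⟩ := exists_thin_onCell 𝓗
  obtain ⟨T', hT', hcnt⟩ := exists_thin_cnt_eq (m := m) (𝓗 := 𝓗)
  have hex : ∀ Q : Polyhedron X.toDeltaComplex m, (∃ y, OnCell 𝓗 Q y) →
      ∃ k : ℤ, ∀ y ∈ U, OnCell 𝓗 Q y → HasMult Φ y k := fun Q hQ => by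
    obtain ⟨lam, hlam, h⟩ := exists_hasMultDir Q hQ
    obtain ⟨k, hk⟩ := h U Φ hΦ
    exact ⟨k, fun y hy hyQ => ⟨lam, hlam, hk y hy hyQ⟩⟩
  choose! κ hκ using hex
  set z : Polyhedron X.toDeltaComplex m →₀ ℤ :=
    Finsupp.onFinset (finite_onCell (m := m) (𝓗 := 𝓗)).toFinset
      (fun Q => if ∃ y, OnCell 𝓗 Q y then κ Q else 0) (fun Q hQ => by
        by_contra hc
        simp only [Set.Finite.mem_toFinset, Set.mem_ofPred_eq] at hc
        exact hQ (if_neg hc)) with hz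
  have hsupp : ∀ Q ∈ z.support, ∃ y, OnCell 𝓗 Q y := fun Q hQ => by
    have := Finsupp.support_onFinset_subset hQ
    simpa using this
  refine ⟨z, T ∪ T', hT.union hT', fun y hyU hy => ?_⟩
  simp only [Set.mem_union, not_or] at hy
  have hc := hcnt z hsupp y hy.2
  by_cases hQ : ∃ Q : Polyhedron X.toDeltaComplex m, OnCell 𝓗 Q y
  · obtain ⟨Q, hQ⟩ := hQ
    rw [hc.1 Q hQ]
    have : z Q = κ Q := if_pos ⟨y, hQ⟩
    rw [this]
    exact hκ Q ⟨y, hQ⟩ y hyU hQ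
  · rw [hc.2 (not_exists.1 hQ)]
    exact ⟨Pi.single 0 1, primitive_single 0, (hon y hy.1).resolve_left hQ U Φ hΦ hyU _⟩

theorem IsDiv.unique {U : Opens X.Realization} {Φ : X.Realization → ℝ}
    {z w : Polyhedron X.toDeltaComplex m →₀ ℤ} (hz : IsDiv U Φ z) (hw : IsDiv U Φ w) :
    z - w ∈ Rel m U := by
  obtain ⟨T, hT, hz⟩ := hz
  obtain ⟨T', hT', hw⟩ := hw
  refine mem_rel_of_thin Thin.empty fun y hy _ => ⟨U, le_rfl, hy, (hT.union hT').mono ?_⟩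
  rintro y ⟨hyU, hy⟩
  by_contra hc
  simp only [Set.mem_union, not_or] at hc
  exact hy (by rw [map_sub, (hz y hyU hc.1).unique (hw y hyU hc.2), sub_self])

theorem IsDiv.of_rel {U : Opens X.Realization} {Φ : X.Realization → ℝ}
    {z w : Polyhedron X.toDeltaComplex m →₀ ℤ} (hz : IsDiv U Φ z) (h : z - w ∈ Rel m U) :
    IsDiv U Φ w := by
  obtain ⟨T, hT, hz⟩ := hz
  refine ⟨_, hT.union (thin_cnt_ne_zero h), fun y hyU hy => ?_⟩
  simp only [Set.mem_union, Set.mem_ofPred_eq, hyU, true_and, not_or, not_not, map_sub] at hy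
  rw [← sub_eq_zero.1 hy.2]
  exact hz y hyU hy.1

theorem IsDiv.congr {U : Opens X.Realization} {Φ Ψ : X.Realization → ℝ}
    {z : Polyhedron X.toDeltaComplex m →₀ ℤ} (hz : IsDiv U Φ z) (h : ∀ y ∈ U, Φ y = Ψ y) :
    IsDiv U Ψ z := by
  obtain ⟨T, hT, hz⟩ := hz
  exact ⟨T, hT, fun y hyU hy => (hz y hyU hy).congr
    (Filter.eventually_of_mem (U.2.mem_nhds hyU) h)⟩

theorem IsDiv.mono {U V : Opens X.Realization} (h : V ≤ U) {Φ : X.Realization → ℝ}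
    {z : Polyhedron X.toDeltaComplex m →₀ ℤ} (hz : IsDiv U Φ z) : IsDiv V Φ z := by
  obtain ⟨T, hT, hz⟩ := hz
  exact ⟨T, hT, fun y hy => hz y (h hy)⟩

theorem IsDiv.add {U : Opens X.Realization} {φ ψ : PL U}
    {z w : Polyhedron X.toDeltaComplex m →₀ ℤ} (hz : IsDiv U (ext0 U φ.1) z)
    (hw : IsDiv U (ext0 U ψ.1) w) : IsDiv U (ext0 U (φ + ψ).1) (z + w) := by
  obtain ⟨𝓗, h𝓗⟩ := exists_adapted φ
  obtain ⟨𝓗', h𝓗'⟩ := exists_adapted ψ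
  obtain ⟨𝓚, h1, h2⟩ := 𝓗.exists_le 𝓗'
  replace h𝓗 := h𝓗.mono h1
  replace h𝓗' := h𝓗'.mono h2
  obtain ⟨T₀, hT₀, hon⟩ := exists_thin_onCell 𝓚
  obtain ⟨T, hT, hz⟩ := hz
  obtain ⟨T', hT', hw⟩ := hw
  refine ⟨T₀ ∪ (T ∪ T'), hT₀.union (hT.union hT'), fun y hyU hy => ?_⟩
  simp only [Set.mem_union, not_or] at hy
  -- away from a thin set, both functions have a multiplicity for a common slope vector
  obtain ⟨lam, hlam, k, l, hk, hl⟩ : ∃ lam, Primitive lam ∧ ∃ k l : ℤ,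
      HasMultDir (ext0 U φ.1) y lam k ∧ HasMultDir (ext0 U ψ.1) y lam l := by
    rcases hon y hy.1 with ⟨Q, hQ⟩ | h
    · obtain ⟨lam, hlam, h⟩ := exists_hasMultDir Q ⟨y, hQ⟩
      obtain ⟨k, hk⟩ := h U _ h𝓗
      obtain ⟨l, hl⟩ := h U _ h𝓗'
      exact ⟨lam, hlam, k, l, hk y hyU hQ, hl y hyU hQ⟩
    · exact ⟨Pi.single 0 1, primitive_single 0, 0, 0, h U _ h𝓗 hyU _, h U _ h𝓗' hyU _⟩
  rw [map_add, (hz y hyU hy.2.1).unique ⟨lam, hlam, hk⟩, (hw y hyU hy.2.2).unique ⟨lam, hlam, hl⟩]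
  refine ⟨lam, hlam, ?_⟩
  have : ext0 U (φ + ψ).1 = ext0 U φ.1 + ext0 U ψ.1 := ext0_add φ.1 ψ.1
  rw [this]
  exact hk.add hl

variable (X) in
/-- There is an assignment of formal sums to functions describing the multiplicities. -/
theorem exists_assignment : ∃ D : ∀ U : Opens X.Realization, PL U → FormalSum m U,
    ∀ (U : Opens X.Realization) (φ : PL U) (z : Polyhedron X.toDeltaComplex m →₀ ℤ),
      D U φ = QuotientAddGroup.mk z ↔ IsDiv U (ext0 U φ.1) z := by
  have hex : ∀ (U : Opens X.Realization) (φ : PL U), ∃ z, IsDiv U (ext0 U φ.1) z := fun U φ => by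
    obtain ⟨𝓗, h𝓗⟩ := exists_adapted φ
    exact h𝓗.exists_isDiv
  choose z hz using hex
  refine ⟨fun U φ => QuotientAddGroup.mk (z U φ), fun U φ w => ?_⟩
  rw [QuotientAddGroup.eq]
  constructor
  · intro h
    refine (hz U φ).of_rel ?_
    have := neg_mem h
    rwa [neg_add, neg_neg, ← sub_eq_add_neg] at this
  · intro h
    have := h.unique (hz U φ)
    rwa [sub_eq_neg_add] at this

end Existence

/-! ### Linear functions near ridges -/

section RidgeLinear

open DeltaComplex

variable {m : ℕ} {X : WeakTropicalComplex.{u} m} {r : X.cell m}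

theorem exists_eq_succAbove {m : ℕ} (θ : Fin (m + 1) ↪o Fin (m + 2)) :
    ∃ i, θ = Fin.succAboveOrderEmb i := by
  have hns : ¬ Function.Surjective θ := fun h => by
    have := Fintype.card_le_of_surjective θ h
    simp at this
  simp only [Function.Surjective, not_forall] at hns
  obtain ⟨i, hi⟩ := hns
  refine ⟨i, OrderEmbedding.range_inj.1 ?_⟩
  have h1 : Set.range (Fin.succAboveOrderEmb i) = {i}ᶜ := Fin.range_succAbove i
  have hsub : Set.range θ ⊆ {i}ᶜ := by
    rintro _ ⟨j, rfl⟩ hj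
    exact hi ⟨j, hj⟩
  rw [h1]
  refine Set.eq_of_subset_of_ncard_le hsub ?_
  rw [← h1, ← Set.image_univ, ← Set.image_univ, Set.ncard_image_of_injective _ θ.injective,
    Set.ncard_image_of_injective _ (Fin.succAboveOrderEmb i).injective]

theorem exists_link_of_face {f : X.cell (m + 1)} {θ : Fin (m + 1) ↪o Fin (m + 2)}
    (h : X.face θ f = r) : ∃ t : X.Link r, t.1.1 = f ∧ emb t = θ := by
  obtain ⟨i, rfl⟩ := exists_eq_succAbove θ
  exact ⟨⟨(f, i), h⟩, rfl, rfl⟩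

theorem eq_of_face_isolated (hr : IsEmpty (X.Link r)) {k : ℕ} {s : X.cell k}
    {θ : Fin (m + 1) ↪o Fin (k + 1)} (h : X.face θ s = r) :
    (⟨k, s⟩ : Σ k, X.cell k) = ⟨m, r⟩ := by
  have h1 := le_of_orderEmb θ
  have h2 := dim_le k s
  obtain rfl | rfl : k = m ∨ k = m + 1 := by omega
  · rw [orderEmb_eq_refl θ, X.face_id] at h
    rw [h]
  · obtain ⟨t, -⟩ := exists_link_of_face h
    exact hr.elim t

theorem eq_of_face_facet {f : X.cell (m + 1)} {k : ℕ} {s : X.cell k}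
    {θ : Fin (m + 1 + 1) ↪o Fin (k + 1)} (h : X.face θ s = f) :
    (⟨k, s⟩ : Σ k, X.cell k) = ⟨m + 1, f⟩ := by
  have h1 := le_of_orderEmb θ
  have h2 := dim_le k s
  obtain rfl : k = m + 1 := by omega
  rw [orderEmb_eq_refl θ, X.face_id] at h
  rw [h]

/-- The inclusion into `N_r` of the simplex attached for a vertex of the link. -/
noncomputable def toN (t : X.Link r) (x : Simp (m + 1)) : N X r := by
  classical
  exact ⟨⟨Sum.elim (fun t' => if t' = t then x t.1.2 else 0) fun v => x (emb t v), by
    refine ⟨?_, ?_⟩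
    · rintro (t' | v)
      · simp only [Sum.elim_inl]
        split_ifs
        exacts [stdSimplex.zero_le x _, le_rfl]
      · exact stdSimplex.zero_le x _
    · rw [Fintype.sum_sum_type]
      simp only [Sum.elim_inl, Sum.elim_inr, Finset.sum_ite_eq', Finset.mem_univ, if_true]
      rw [← stdSimplex.sum_eq_one x, Fin.sum_univ_succAbove _ t.1.2]
      rfl⟩, by
    intro t₁ t₂ h
    by_cases h1 : t₁ = t
    · refine Or.inr (if_neg ?_)
      rintro rfl
      exact h h1
    · exact Or.inl (if_neg h1)⟩

/-- The inclusion of the ridge into `N_r`. -/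
def toN₀ (x : Simp m) : N X r :=
  ⟨⟨Sum.elim (fun _ => 0) fun v => x v, by
    refine ⟨?_, ?_⟩
    · rintro (t' | v)
      exacts [le_rfl, stdSimplex.zero_le x _]
    · rw [Fintype.sum_sum_type]
      simp only [Sum.elim_inl, Sum.elim_inr, Finset.sum_const_zero, zero_add]
      exact stdSimplex.sum_eq_one x⟩, fun _ _ _ => Or.inl rfl⟩

open Classical in
theorem toN_inl (t : X.Link r) (x : Simp (m + 1)) (t' : X.Link r) :
    (toN t x).1 (Sum.inl t') = if t' = t then x t.1.2 else 0 := rfl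

theorem toN_inr (t : X.Link r) (x : Simp (m + 1)) (v : Fin (m + 1)) :
    (toN t x).1 (Sum.inr v) = x (emb t v) := rfl

theorem toN₀_inl (x : Simp m) (t : X.Link r) : (toN₀ (r := r) x).1 (Sum.inl t) = 0 := rfl

theorem toN₀_inr (x : Simp m) (v : Fin (m + 1)) : (toN₀ (r := r) x).1 (Sum.inr v) = x v := rfl

theorem inRidge_toN₀ (x : Simp m) : InRidge X r (toN₀ x) := fun _ => rfl

theorem continuous_toN (t : X.Link r) : Continuous (toN t) := by
  classical
  refine Continuous.subtype_mk (Continuous.subtype_mk (continuous_pi ?_) _) _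
  have hc : ∀ i, Continuous fun x : Simp (m + 1) => x i := fun i =>
    (continuous_apply i).comp continuous_subtype_val
  rintro (t' | v)
  · by_cases h : t' = t
    · simpa [h] using hc _
    · simpa [h] using continuous_const
  · exact hc _

theorem continuous_toN₀ : Continuous (toN₀ (X := X) (r := r)) := by
  refine Continuous.subtype_mk (Continuous.subtype_mk (continuous_pi ?_) _) _
  rintro (t' | v)
  · exact continuous_const
  · exact (continuous_apply v).comp continuous_subtype_val

theorem toN_map_emb (t : X.Link r) (x : Simp m) :
    toN t (stdSimplex.map (emb t) x) = toN₀ x := by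
  classical
  refine Subtype.ext (stdSimplex.ext (funext ?_))
  rintro (t' | v)
  · rw [toN_inl, toN₀_inl]
    split_ifs
    exacts [map_emb_apply_opposite t x, rfl]
  · rw [toN_inr, toN₀_inr, map_apply_self]

theorem proj_of_ne_zero (y : N X r) (t : X.Link r) (ht : y.1 (Sum.inl t) ≠ 0) :
    proj X r y = param t.1.1 ⟨_, insertNth_mem y t ht⟩ := by
  have h : ∃ t : X.Link r, y.1 (Sum.inl t) ≠ 0 := ⟨t, ht⟩
  have key : ∀ (t' : X.Link r) (ht' : y.1 (Sum.inl t') ≠ 0), t' = t →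
      param t'.1.1 ⟨_, insertNth_mem y t' ht'⟩ = param t.1.1 ⟨_, insertNth_mem y t ht⟩ := by
    rintro _ _ rfl
    rfl
  rw [proj, dif_pos h]
  refine key _ h.choose_spec ?_
  by_contra hne
  exact (y.2 _ t hne).elim h.choose_spec ht

theorem proj_of_inRidge (y : N X r) (hy : InRidge X r y) :
    proj X r y = param r ⟨_, inr_mem y hy⟩ := by
  have h : ¬ ∃ t : X.Link r, y.1 (Sum.inl t) ≠ 0 := by
    push Not
    exact hy
  rw [proj, dif_neg h]

theorem proj_toN₀ (x : Simp m) : proj X r (toN₀ x) = param r x :=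
  proj_of_inRidge _ (inRidge_toN₀ x)

theorem proj_toN (t : X.Link r) (x : Simp (m + 1)) : proj X r (toN t x) = param t.1.1 x := by
  classical
  by_cases hx : x t.1.2 = 0
  · obtain ⟨w, rfl⟩ := eq_map_of_forall_notMem (emb t) x (by
      intro i hi
      rcases Fin.eq_self_or_eq_succAbove t.1.2 i with rfl | ⟨v, rfl⟩
      · exact hx
      · exact absurd ⟨v, rfl⟩ hi)
    rw [toN_map_emb, proj_toN₀, param_emb]
  · rw [proj_of_ne_zero _ t (by rw [toN_inl, if_pos rfl]; exact hx)]
    congr 1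
    refine stdSimplex.ext (funext fun i => ?_)
    rcases Fin.eq_self_or_eq_succAbove t.1.2 i with rfl | ⟨v, rfl⟩
    · exact (Fin.insertNth_apply_same (α := fun _ => ℝ) t.1.2 _
        fun v => (toN t x).1 (Sum.inr v)).trans ((toN_inl t x t).trans (if_pos rfl))
    · exact Fin.insertNth_apply_succAbove (α := fun _ => ℝ) t.1.2 _
        (fun v => (toN t x).1 (Sum.inr v)) v

/-- A linear form on `L_r` in coordinates. -/
theorem form_toL (ℓ : L X r →ₗ[ℝ] ℝ) (w : NVertex X r → ℝ) [DecidableEq (NVertex X r)] :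
    ℓ (Submodule.Quotient.mk w) =
      ∑ t, w (Sum.inl t) * ℓ (Submodule.Quotient.mk (Pi.single (Sum.inl t) 1)) +
        ∑ v, w (Sum.inr v) * ℓ (Submodule.Quotient.mk (Pi.single (Sum.inr v) 1)) := by
  have h := LinearMap.pi_apply_eq_sum_univ (ℓ ∘ₗ (Submodule.span ℝ
    {(Sum.elim (fun _ => 1) (fun v => -(X.α r v : ℝ)) : NVertex X r → ℝ)}).mkQ) w
  rw [Fintype.sum_sum_type] at h
  simp only [LinearMap.comp_apply, Submodule.mkQ_apply, smul_eq_mul] at h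
  have hs : ∀ w : NVertex X r,
      (Pi.single w 1 : NVertex X r → ℝ) = fun j => if w = j then 1 else 0 :=
    fun w => funext fun i => by simp [Pi.single_apply, eq_comm]
  simp only [hs]
  exact h

/-- A function that is the pullback of an affine function on `L_r` near a point of a ridge has
multiplicity zero there. -/
theorem hasRidgeMult_zero {U : Opens X.Realization} {Φ : X.Realization → ℝ} {x : Simp m}
    (hx : param r x ∈ U) {c : ℝ} {ℓ : L X r →ₗ[ℝ] ℝ} (hℓ : IntegralForm X r ℓ)
    (h : ∀ᶠ y in 𝓝 (toN₀ (r := r) x), proj X r y ∈ U → Φ (proj X r y) = c + ℓ (toL X r y)) :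
    HasRidgeMult Φ r x 0 := by
  classical
  set a : Fin (m + 1) → ℝ := fun v => ℓ (Submodule.Quotient.mk (Pi.single (Sum.inr v) 1)) with ha
  set b : X.Link r → ℝ := fun t => ℓ (Submodule.Quotient.mk (Pi.single (Sum.inl t) 1)) with hb
  have hint : ∀ w : NVertex X r, ∃ z : ℤ, ℓ (Submodule.Quotient.mk (Pi.single w 1)) = z := by
    intro w
    convert hℓ w
  choose za hza using fun v => hint (Sum.inr v)
  choose zb hzb using fun t => hint (Sum.inl t)
  have hlin : ∀ w : NVertex X r → ℝ, ℓ (Submodule.Quotient.mk w) =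
      ∑ t, w (Sum.inl t) * b t + ∑ v, w (Sum.inr v) * a v := fun w => form_toL ℓ w
  refine ⟨fun v => c + a v, fun t => c + b t, fun i j => ⟨za i - za j, ?_⟩,
    fun t v => ⟨zb t - za v, ?_⟩, ?_, fun t => ?_, ?_⟩
  · push_cast
    rw [← hza, ← hza]
    ring
  · push_cast
    rw [← hza, ← hzb]
    ring
  · filter_upwards [continuous_toN₀.continuousAt.eventually h, eventually_param_mem hx]
      with y hy hyU
    rw [proj_toN₀, toL, hlin] at hy
    replace hy := hy hyU
    rw [hy, ev_const_add]
    have h1 : ∑ t, (toN₀ (r := r) y).1 (Sum.inl t) * b t = 0 :=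
      Finset.sum_eq_zero fun t _ => by rw [toN₀_inl, zero_mul]
    have h2 : ∑ v, (toN₀ (r := r) y).1 (Sum.inr v) * a v = ∑ v, a v * y v :=
      Finset.sum_congr rfl fun v _ => by rw [toN₀_inr, mul_comm]
    refine congrArg (c + ·) ((congrArg₂ (· + ·) h1 h2).trans (zero_add _))
  · have h0 : ∀ᶠ y in 𝓝 (toN t (stdSimplex.map (emb t) x)),
        proj X r y ∈ U → Φ (proj X r y) = c + ℓ (toL X r y) := by rwa [toN_map_emb]
    rw [← param_emb t] at hx
    filter_upwards [(continuous_toN t).continuousAt.eventually h0, eventually_param_mem hx]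
      with y hy hyU
    rw [proj_toN, toL, hlin] at hy
    replace hy := hy hyU
    have h1 : ∑ t', (toN t y).1 (Sum.inl t') * b t' = y t.1.2 * b t := by
      rw [Finset.sum_eq_single t]
      · rw [toN_inl, if_pos rfl]
      · intro t' _ hne
        rw [toN_inl, if_neg hne, zero_mul]
      · simp
    have h2 : ∑ v, (toN t y).1 (Sum.inr v) * a v = ∑ v, a v * y (emb t v) :=
      Finset.sum_congr rfl fun v _ => by rw [toN_inr, mul_comm]
    have h3 : Φ (param t.1.1 y) = c + (y t.1.2 * b t + ∑ v, a v * y (emb t v)) :=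
      hy.trans (congrArg (c + ·) (congrArg₂ (· + ·) h1 h2))
    have h4 : y t.1.2 + ∑ v, y (emb t v) = 1 := by
      rw [← stdSimplex.sum_eq_one y, Fin.sum_univ_succAbove _ t.1.2]
      rfl
    rw [h3, ev_ins]
    simp only [add_mul, Finset.sum_add_distrib, ← Finset.mul_sum]
    linear_combination -c * h4
  · have h1 := hlin (Sum.elim (fun _ => 1) fun v => -(X.α r v : ℝ))
    have h2 : (Submodule.Quotient.mk (Sum.elim (fun _ => 1) fun v => -(X.α r v : ℝ)) : L X r) = 0 :=
      (Submodule.Quotient.mk_eq_zero _).2 (Submodule.mem_span_singleton_self _)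
    rw [h2, map_zero] at h1
    simp only [Sum.elim_inl, Sum.elim_inr, one_mul, neg_mul, Finset.sum_neg_distrib] at h1
    have hα : ∑ v, (X.α r v : ℝ) = Fintype.card (X.Link r) := by
      have := X.sum_α r
      rw [Nat.card_eq_fintype_card] at this
      exact_mod_cast this
    simp only [Finset.sum_add_distrib, mul_add, ← Finset.sum_mul, hα, Finset.sum_const,
      Finset.card_univ, nsmul_eq_mul, Int.cast_zero]
    linear_combination h1

/-- Conversely, a function that is affine on the simplices of `N_r` near a point of the ridge is
the pullback of an affine function on `L_r` if its multiplicity is zero. -/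
theorem exists_linear_of_sum_eq_zero {Φ : X.Realization → ℝ} {x : Simp m} {A : Fin (m + 1) → ℝ}
    {b : X.Link r → ℝ} (hA : IntDiff A) (hb : ∀ t v, ∃ z : ℤ, b t - A v = z)
    (h1 : ∀ᶠ y in 𝓝 x, Φ (param r y) = ev A y)
    (h2 : ∀ t : X.Link r, ∀ᶠ y in 𝓝 (stdSimplex.map (emb t) x),
      Φ (param t.1.1 y) = ev (ins t A (b t)) y)
    (h3 : ∑ t, b t - ∑ v, (X.α r v : ℝ) * A v = 0) :
    ∃ (c : ℝ) (ℓ : L X r →ₗ[ℝ] ℝ), IntegralForm X r ℓ ∧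
      ∀ᶠ y in 𝓝 (toN₀ (r := r) x), Φ (proj X r y) = c + ℓ (toL X r y) := by
  classical
  set c := A 0 with hc
  have hα : ∑ v, (X.α r v : ℝ) = Fintype.card (X.Link r) := by
    have := X.sum_α r
    rw [Nat.card_eq_fintype_card] at this
    exact_mod_cast this
  set g : (NVertex X r → ℝ) →ₗ[ℝ] ℝ :=
    dotProductBilin ℝ ℝ (Sum.elim (fun t => b t - c) fun v => A v - c) with hg
  have hgw : ∀ w, g w = ∑ t, (b t - c) * w (Sum.inl t) + ∑ v, (A v - c) * w (Sum.inr v) := by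
    intro w
    exact Fintype.sum_sum_type _
  have hker : Submodule.span ℝ
      {(Sum.elim (fun _ => 1) (fun v => -(X.α r v : ℝ)) : NVertex X r → ℝ)} ≤
        LinearMap.ker g := by
    rw [Submodule.span_singleton_le_iff_mem, LinearMap.mem_ker, hgw]
    simp only [Sum.elim_inl, Sum.elim_inr, mul_one, Finset.sum_sub_distrib, mul_neg, sub_mul,
      Finset.sum_neg_distrib, ← Finset.mul_sum, hα, Finset.sum_const, Finset.card_univ,
      nsmul_eq_mul]
    have h4 : ∑ v, A v * (X.α r v : ℝ) = ∑ v, (X.α r v : ℝ) * A v :=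
      Finset.sum_congr rfl fun v _ => mul_comm _ _
    linear_combination h3 - h4
  refine ⟨c, Submodule.liftQ _ g hker, ?_, ?_⟩
  · intro w
    rw [Submodule.liftQ_apply, hgw]
    rcases w with t | v
    · obtain ⟨z, hz⟩ := hb t 0
      refine ⟨z, ?_⟩
      rw [← hz]
      simp [Pi.single_apply, hc]
    · obtain ⟨z, hz⟩ := hA v 0
      refine ⟨z, ?_⟩
      rw [← hz]
      simp [Pi.single_apply, hc]
  · -- the neighbourhoods in the simplices of `N_r` combine to a neighbourhood in `N_r`
    rw [nhds_subtype_eq_comap, Filter.eventually_comap] at h1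
    have hpr : ∀ w : NVertex X r, Continuous fun y : N X r => y.1 w := fun w =>
      (continuous_apply w).comp (continuous_subtype_val.comp continuous_subtype_val)
    have c1 : Continuous fun y : N X r => fun v => y.1 (Sum.inr v) :=
      continuous_pi fun v => hpr _
    have c2 : ∀ t : X.Link r, Continuous fun y : N X r =>
        Fin.insertNth (α := fun _ => ℝ) t.1.2 (y.1 (Sum.inl t)) fun v => y.1 (Sum.inr v) := by
      intro t
      refine continuous_pi fun i => ?_
      rcases Fin.eq_self_or_eq_succAbove t.1.2 i with rfl | ⟨v, rfl⟩
      · simpa using hpr _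
      · simpa using hpr _
    have e1 : ∀ᶠ y in 𝓝 (toN₀ (r := r) x), ∀ z : Simp m, z.1 = (fun v => y.1 (Sum.inr v)) →
        Φ (param r z) = ev A z := (c1.tendsto (toN₀ (r := r) x)).eventually h1
    have e2 : ∀ t : X.Link r, ∀ᶠ y in 𝓝 (toN₀ (r := r) x), ∀ z : Simp (m + 1),
        z.1 = (Fin.insertNth (α := fun _ => ℝ) t.1.2 (y.1 (Sum.inl t)) fun v => y.1 (Sum.inr v)) →
          Φ (param t.1.1 z) = ev (ins t A (b t)) z := by
      intro t
      have h5 := h2 t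
      rw [nhds_subtype_eq_comap, Filter.eventually_comap] at h5
      refine ((c2 t).tendsto (toN₀ (r := r) x)).eventually (p := fun v => ∀ z : Simp (m + 1),
        z.1 = v → Φ (param t.1.1 z) = ev (ins t A (b t)) z) ?_
      convert h5 using 2
      funext i
      rcases Fin.eq_self_or_eq_succAbove t.1.2 i with rfl | ⟨v, rfl⟩
      · rw [Fin.insertNth_apply_same]
        exact (map_emb_apply_opposite t x).symm
      · rw [Fin.insertNth_apply_succAbove]
        exact (map_apply_self (emb t) x v).symm
    filter_upwards [e1, Filter.eventually_all.2 e2] with y hy1 hy2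
    have hsum := stdSimplex.sum_eq_one y.1
    rw [Fintype.sum_sum_type] at hsum
    change _ = c + g _
    rw [hgw]
    have hsplit : ∑ t, (b t - c) * y.1 (Sum.inl t) + ∑ v, (A v - c) * y.1 (Sum.inr v) =
        ∑ t, b t * y.1 (Sum.inl t) + ∑ v, A v * y.1 (Sum.inr v) - c := by
      simp only [sub_mul, Finset.sum_sub_distrib, ← Finset.mul_sum]
      linear_combination -c * hsum
    refine Eq.trans ?_ (congrArg (c + ·) hsplit.symm)
    by_cases hy : InRidge X r y
    · rw [proj_of_inRidge y hy, hy1 _ rfl]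
      have : ∑ t, b t * y.1 (Sum.inl t) = 0 := Finset.sum_eq_zero fun t _ => by rw [hy t, mul_zero]
      simp only [this, zero_add, add_sub_cancel]
      rfl
    · simp only [InRidge, not_forall] at hy
      obtain ⟨t, ht⟩ := hy
      rw [proj_of_ne_zero y t ht, hy2 t _ rfl, ev_ins]
      have : ∑ t', b t' * y.1 (Sum.inl t') = b t * y.1 (Sum.inl t) := by
        refine Finset.sum_eq_single t (fun t' _ hne => ?_) (by simp)
        rw [(y.2 t' t hne).resolve_right ht, mul_zero]
      simp only [this, add_sub_cancel]
      congr 1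
      · congr 1
        exact Fin.insertNth_apply_same (α := fun _ => ℝ) t.1.2 _ fun v => y.1 (Sum.inr v)
      · refine Finset.sum_congr rfl fun v _ => ?_
        congr 1
        exact Fin.insertNth_apply_succAbove (α := fun _ => ℝ) t.1.2 _ (fun v => y.1 (Sum.inr v)) v

end RidgeLinear

/-! ### Functions with multiplicity zero are linear -/

section Generic

variable {k m : ℕ}

theorem linSpan_univ : linSpan (Set.univ : Set (Simp k)) = ⊤ := by
  classical
  rw [eq_top_iff]
  intro v _
  rw [pi_eq_sum_univ v]
  refine Submodule.sum_mem _ fun i _ => Submodule.smul_mem _ _ ?_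
  convert mem_linSpan (Set.mem_univ (stdSimplex.vertex (S := ℝ) i)) using 1
  ext j
  simp [Pi.single_apply, eq_comm]

theorem finrank_linSpan_univ : Module.finrank ℝ (linSpan (Set.univ : Set (Simp k))) = k + 1 := by
  rw [linSpan_univ, finrank_top, Module.finrank_fin_fun]

theorem ThinIn.mono_dim {m' : ℕ} (h : m ≤ m') {A : Set (Simp k)} (hA : ThinIn m A) :
    ThinIn m' A := by
  obtain ⟨𝒲, h1, h2, h3⟩ := hA
  exact ⟨𝒲, h1, fun W hW => (h2 W hW).trans h, h3⟩

theorem cvx_univ : Cvx (Set.univ : Set (Simp k)) := fun _ _ _ _ _ => trivial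

theorem thinIn_of_ev {h : Fin (k + 1) → ℝ} (hh : h ≠ 0) :
    ThinIn k {x : Simp k | ev h x = 0} := by
  obtain ⟨i, hi⟩ : ∃ i, h i ≠ 0 := Function.ne_iff.1 hh
  refine ThinIn.of_finrank_le ?_
  have h1 := finrank_linSpan_lt (h := h) (x := stdSimplex.vertex i) (by rwa [ev_vertex])
    (Set.mem_univ _) (Set.subset_univ {x : Simp k | ev h x = 0}) fun y hy => hy
  rw [finrank_linSpan_univ] at h1
  omega

theorem thinIn_not_isInt : ThinIn k {x : Simp k | ¬ IsInt x} := by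
  refine (ThinIn.iUnion (A := fun i : Fin (k + 1) => {x : Simp k | ev (Pi.single i 1) x = 0})
    fun i => thinIn_of_ev ?_).mono ?_
  · simp
  · intro x hx
    simp only [IsInt, Set.mem_ofPred_eq, not_forall, not_lt] at hx
    obtain ⟨i, hi⟩ := hx
    refine Set.mem_iUnion.2 ⟨i, ?_⟩
    change ev _ x = 0
    rw [ev_single]
    exact le_antisymm hi (stdSimplex.zero_le x i)

/-- Off a thin set there are interior points near every point of a simplex. -/
theorem exists_isInt_notMem {x₀ : Simp k} {V : Set (Simp k)} (hV : V ∈ 𝓝 x₀) {T : Set (Simp k)}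
    (hT : ThinIn k T) : ∃ x ∈ V, IsInt x ∧ x ∉ T := by
  obtain ⟨x, -, hx, hxT⟩ := cvx_univ.exists_notMem_thinIn (m := k)
    (by rw [finrank_linSpan_univ]; omega) (Set.mem_univ x₀) hV (hT.union thinIn_not_isInt)
  simp only [Set.mem_union, Set.mem_ofPred_eq, not_or, not_not] at hxT
  exact ⟨x, hx, hxT.2, hxT.1⟩

theorem isInt_mix {x y : Simp k} (hx : IsInt x) (hy : IsInt y) (t : unitInterval) :
    IsInt (mix x y t) := by
  intro i
  rw [mix_apply]
  rcases t.2.1.eq_or_lt with h | h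
  · rw [← h]
    simpa using hx i
  · have h1 := mul_pos h (hy i)
    have h2 := mul_nonneg (sub_nonneg.2 t.2.2) (hx i).le
    linarith

theorem exists_cvx_nhds {p : Simp k} {O : Set (Simp k)} (hO : O ∈ 𝓝 p) :
    ∃ V ⊆ O, IsOpen V ∧ p ∈ V ∧ Cvx V := by
  obtain ⟨ε, hε, h⟩ := Metric.mem_nhds_iff.1 hO
  refine ⟨Metric.ball p ε, h, Metric.isOpen_ball, Metric.mem_ball_self hε, fun x hx y hy t => ?_⟩
  rw [Metric.mem_ball, Subtype.dist_eq] at hx hy ⊢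
  have h1 := convex_ball (p : Fin (k + 1) → ℝ) ε (Metric.mem_ball.2 hx) (Metric.mem_ball.2 hy)
    (sub_nonneg.2 t.2.2) t.2.1 (by ring)
  exact Metric.mem_ball.1 h1

/-- A continuous function on a convex open subset of a simplex that is affine near every interior
point off a set of codimension two is affine. -/
theorem exists_ev_of_locally {O : Set (Simp k)} (hO : IsOpen O) (hOc : Cvx O) {p : Simp k}
    (hp : p ∈ O) {g : Simp k → ℝ} (hg : ContinuousOn g O) {T : Set (Simp k)} (hm : m + 1 ≤ k)
    (hT : ThinIn m T)
    (h : ∀ x ∈ O, IsInt x → x ∉ T → ∃ B, IntDiff B ∧ ∀ᶠ y in 𝓝 x, g y = ev B y) :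
    ∃ B, IntDiff B ∧ ∀ y ∈ O, g y = ev B y := by
  obtain ⟨𝒲, hfin, hdim, hcov⟩ := hT
  have hT' : ThinIn m {x : Simp k | ∃ W ∈ 𝒲, (x : Fin (k + 1) → ℝ) ∈ W} :=
    ⟨𝒲, hfin, hdim, fun x hx => hx⟩
  obtain ⟨x₀, hx₀, hx₀i, hx₀T⟩ := exists_isInt_notMem (hO.mem_nhds hp) (hT'.mono_dim (by omega))
  obtain ⟨B, hB, hB₀⟩ := h x₀ hx₀ hx₀i fun hx => hx₀T (hcov _ hx)
  refine ⟨B, hB, ?_⟩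
  -- adding `x₀` to the spaces of codimension two gives hyperplanes; a segment from `x₀` to a point
  -- off these avoids the spaces of codimension two
  set T₁ : Set (Simp k) :=
    {x | ∃ W ∈ (fun W => W ⊔ Submodule.span ℝ {(x₀ : Fin (k + 1) → ℝ)}) '' 𝒲,
      (x : Fin (k + 1) → ℝ) ∈ W} with hT₁
  have hT₁' : ThinIn k T₁ := by
    refine ⟨_, hfin.image _, ?_, fun x hx => hx⟩
    rintro _ ⟨W, hW, rfl⟩
    refine (Submodule.finrank_add_le_finrank_add_finrank _ _).trans ?_
    have h1 := hdim W hW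
    have h2 := finrank_span_le_card (R := ℝ) {(x₀ : Fin (k + 1) → ℝ)}
    rw [Set.toFinset_singleton, Finset.card_singleton] at h2
    omega
  have key : ∀ y ∈ O, IsInt y → y ∉ T₁ → g y = ev B y := by
    intro y hy hyi hyT
    have hloc : ∀ t : unitInterval, ∃ B', ∀ᶠ z in 𝓝 (mix x₀ y t), g z = ev B' z := by
      intro t
      obtain ⟨B', -, h'⟩ := h (mix x₀ y t) (hOc _ hx₀ _ hy t) (isInt_mix hx₀i hyi t) fun hx => by
        obtain ⟨W, hW, hmem⟩ := hcov _ hx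
        rcases t.2.1.eq_or_lt with h0 | h0
        · refine hx₀T ⟨W, hW, ?_⟩
          rwa [mix_coe, ← h0, zero_smul, add_zero, sub_zero, one_smul] at hmem
        · refine hyT ⟨_, ⟨W, hW, rfl⟩, ?_⟩
          have h1 : (y : Fin (k + 1) → ℝ) = (t : ℝ)⁻¹ • (mix x₀ y t : Fin (k + 1) → ℝ) +
              (-(t : ℝ)⁻¹ * (1 - t)) • (x₀ : Fin (k + 1) → ℝ) := by
            rw [mix_coe, smul_add, smul_smul, smul_smul, inv_mul_cancel₀ h0.ne', one_smul,
              neg_mul, neg_smul]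
            abel
          rw [h1]
          exact add_mem (Submodule.smul_mem _ _ (Submodule.mem_sup_left hmem))
            (Submodule.smul_mem _ _ (Submodule.mem_sup_right (Submodule.mem_span_singleton_self _)))
      exact ⟨B', h'⟩
    have hclopen : IsClopen {t : unitInterval | ∀ᶠ z in 𝓝 (mix x₀ y t), g z = ev B z} := by
      constructor
      · refine isClosed_iff_frequently.2 fun t ht => ?_
        obtain ⟨B', hB'⟩ := hloc t
        obtain ⟨t', h1, h2⟩ := (ht.and_eventually
          ((continuous_mix x₀ y).continuousAt.eventually hB'.eventually_nhds)).exists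
        have h3 : B' = B := eq_of_eventually_ev (x₀ := mix x₀ y t') (by
          filter_upwards [h1, h2] with z hz1 hz2
          rw [← hz1, ← hz2])
        rwa [h3] at hB'
      · exact isOpen_iff_mem_nhds.2 fun t ht =>
          (continuous_mix x₀ y).continuousAt.eventually (Filter.Eventually.eventually_nhds ht)
    have h0 : (0 : unitInterval) ∈ {t : unitInterval | ∀ᶠ z in 𝓝 (mix x₀ y t), g z = ev B z} := by
      change ∀ᶠ z in 𝓝 (mix x₀ y 0), g z = ev B z
      rwa [mix_zero]
    have h1 : (1 : unitInterval) ∈ {t : unitInterval | ∀ᶠ z in 𝓝 (mix x₀ y t), g z = ev B z} := by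
      rw [hclopen.eq_univ ⟨0, h0⟩]
      trivial
    have h2 := Filter.Eventually.self_of_nhds h1
    have h3 : mix x₀ y 1 = y := stdSimplex.ext (funext fun i => by simp [mix_apply])
    rwa [h3] at h2
  intro y hy
  by_contra hne
  have hcont : ContinuousAt (fun z => g z - ev B z) y :=
    (hg.continuousAt (hO.mem_nhds hy)).sub (continuous_ev B).continuousAt
  obtain ⟨z, hz, hzi, hzT⟩ := exists_isInt_notMem (k := k) (x₀ := y)
    (V := {z | z ∈ O ∧ g z - ev B z ≠ 0})
    (Filter.inter_mem (hO.mem_nhds hy) (hcont.eventually_ne (sub_ne_zero.2 hne))) hT₁'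
  exact hz.2 (sub_eq_zero.2 (key z hz.1 hzi hzT))

end Generic

section Zero

open DeltaComplex

variable {m : ℕ} {X : WeakTropicalComplex.{u} m}

/-- A function with multiplicity zero off a thin set is affine near every point of a facet. -/
theorem exists_ev_facet {U : Opens X.Realization} {Φ : X.Realization → ℝ} (hc : ContinuousOn Φ U)
    (hΦ : IsDiv U Φ 0) {f : X.cell (m + 1)} {p : Simp (m + 1)} (hp : param f p ∈ U) :
    ∃ B, IntDiff B ∧ ∀ᶠ y in 𝓝 p, Φ (param f y) = ev B y := by
  obtain ⟨T, hT, hΦ⟩ := hΦ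
  obtain ⟨O, hOU, hO, hpO, hOc⟩ := exists_cvx_nhds (eventually_param_mem hp)
  obtain ⟨B, hB, h⟩ := exists_ev_of_locally hO hOc hpO (g := fun y => Φ (param f y))
    (hc.comp (continuous_param f).continuousOn hOU) le_rfl (hT _ f) (by
      intro x hx hxi hxT
      obtain ⟨lam, -, h⟩ := hΦ _ (hOU hx) hxT
      rcases h with ⟨f', x', hx', heq, B, hB, h⟩ | ⟨r, x', hx', heq, -⟩
      · obtain ⟨rfl, rfl⟩ := param_injOn_isInt hxi heq
        refine ⟨B, hB, ?_⟩
        filter_upwards [h] with y hy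
        rw [hy, map_zero, Int.cast_zero, zero_mul, add_zero]
      · obtain ⟨θ, -⟩ := exists_face_of_param_eq hxi heq
        have := le_of_orderEmb θ
        omega)
  exact ⟨B, hB, Filter.eventually_of_mem (hO.mem_nhds hpO) h⟩

end Zero

/-! ### The kernel of the divisor map -/

section Kernel

open DeltaComplex

/-- The image of an open set of interior points of a simplex that is not a proper face is open. -/
theorem isOpen_image_param {X : DeltaComplex.{u}} {k : ℕ} {s : X.cell k}
    (hs : ∀ {k' : ℕ} {s' : X.cell k'} {θ : Fin (k + 1) ↪o Fin (k' + 1)}, X.face θ s' = s →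
      (⟨k', s'⟩ : Σ k, X.cell k) = ⟨k, s⟩) {O : Set (Simp k)} (hO : IsOpen O)
    (hOi : ∀ x ∈ O, IsInt x) : IsOpen (param s '' O) := by
  rw [isOpen_iff_param]
  intro k' s'
  by_cases h : (⟨k', s'⟩ : Σ k, X.cell k) = ⟨k, s⟩
  · cases h
    convert hO
    ext x
    constructor
    · rintro ⟨x', hx', heq⟩
      obtain ⟨-, rfl⟩ := param_injOn_isInt (hOi _ hx') heq.symm
      exact hx'
    · exact fun hx => ⟨x, hx, rfl⟩
  · convert isOpen_empty
    rw [Set.eq_empty_iff_forall_notMem]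
    rintro x ⟨x', hx', heq⟩
    obtain ⟨θ, hθ, -⟩ := exists_face_of_param_eq (hOi _ hx') heq.symm
    exact h (hs hθ)

variable {m : ℕ} {X : WeakTropicalComplex.{u} m}

theorem notMem_isolatedRidges {f : X.cell (m + 1)} {x : Simp (m + 1)} (hx : IsInt x) :
    param f x ∉ isolatedRidges X := by
  rintro ⟨r, -, x', h⟩
  obtain ⟨θ, -⟩ := exists_face_of_param_eq hx h
  have := le_of_orderEmb θ
  omega

theorem isEmpty_link_of_mem {r : X.cell m} {x : Simp m} (hx : IsInt x)
    (h : param r x ∈ isolatedRidges X) : IsEmpty (X.Link r) := by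
  obtain ⟨r', hr', x', h'⟩ := h
  obtain ⟨rfl, -⟩ := param_injOn_isInt hx h'
  exact hr'

/-- The point of `N_r` in the ridge `r` comes from a point of the ridge. -/
theorem exists_toN₀_eq {r : X.cell m} (p : N X r) (hp : InRidge X r p) : ∃ x, toN₀ x = p := by
  refine ⟨⟨_, inr_mem p hp⟩, Subtype.ext (stdSimplex.ext (funext ?_))⟩
  rintro (t | v)
  · exact (hp t).symm
  · rfl

theorem HasRidgeMult.eventually {Φ : X.Realization → ℝ} {r : X.cell m} {x : Simp m} {k : ℤ}
    (h : HasRidgeMult Φ r x k) : ∀ᶠ y in 𝓝 x, HasRidgeMult Φ r y k := by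
  obtain ⟨A, b, hA, hb, h1, h2, h3⟩ := h
  have hc : ∀ t : X.Link r, Continuous (stdSimplex.map (S := ℝ) (emb t)) := fun t =>
    stdSimplex.continuous_map _
  filter_upwards [h1.eventually_nhds, Filter.eventually_all.2 fun t =>
    (hc t).continuousAt.eventually (h2 t).eventually_nhds] with y hy1 hy2
  exact ⟨A, b, hA, hb, hy1, hy2, h3⟩

/-- Linearity near a point of a ridge, for a function with multiplicity zero that is known to be
affine on the simplices of `N_r`. -/
theorem exists_linear_of_hasRidgeMult {U : Opens X.Realization} {Φ : X.Realization → ℝ}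
    (hΦ : IsDiv U Φ 0) {r : X.cell m} {x : Simp m} (hx : param r x ∈ U) {k : ℤ}
    (h : HasRidgeMult Φ r x k) :
    ∃ (c : ℝ) (ℓ : L X r →ₗ[ℝ] ℝ), IntegralForm X r ℓ ∧
      ∀ᶠ y in 𝓝 (toN₀ (r := r) x), Φ (proj X r y) = c + ℓ (toL X r y) := by
  obtain ⟨T, hT, hΦ⟩ := hΦ
  obtain ⟨y, ⟨hyU, hy⟩, hyi, hyT⟩ := exists_isInt_notMem
    ((eventually_param_mem hx).and h.eventually) (hT _ r)
  have h0 : k = 0 := HasMult.unique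
    ⟨Pi.single 0 1, primitive_single 0, Or.inr ⟨r, y, hyi, rfl, hy⟩⟩
    (by simpa using hΦ _ hyU hyT)
  obtain ⟨A, b, hA, hb, h1, h2, h3⟩ := h
  refine exists_linear_of_sum_eq_zero hA hb h1 h2 ?_
  rw [← h3, h0, Int.cast_zero]

/-- A function whose multiplicities vanish outside of a thin set is affine on each simplex around a
ridge in some facet, so that it has a multiplicity at every point of the ridge. -/
theorem exists_hasRidgeMult_of_link {U : Opens X.Realization} {Φ : X.Realization → ℝ}
    (hc : ContinuousOn Φ U) (hΦ : IsDiv U Φ 0) {r : X.cell m} (t₀ : X.Link r) {x : Simp m}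
    (hx : param r x ∈ U) : ∃ k, HasRidgeMult Φ r x k := by
  have h : ∀ t : X.Link r, ∃ B, IntDiff B ∧ ∀ᶠ y in 𝓝 (stdSimplex.map (emb t) x),
      Φ (param t.1.1 y) = ev B y := fun t =>
    exists_ev_facet hc hΦ (by rwa [param_emb])
  choose B hB hloc using h
  have hr : ∀ t : X.Link r, ∀ᶠ y in 𝓝 x, Φ (param r y) = ev (fun v => B t (emb t v)) y := by
    intro t
    filter_upwards [(stdSimplex.continuous_map _).continuousAt.eventually (hloc t)] with y hy
    rw [← param_emb t, hy, ev_map]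
  set A : Fin (m + 1) → ℝ := fun v => B t₀ (emb t₀ v) with hA
  have hAt : ∀ t : X.Link r, (fun v => B t (emb t v)) = A := fun t =>
    eq_of_eventually_ev (x₀ := x) (by
      filter_upwards [hr t, hr t₀] with y h1 h2
      rw [← h1, ← h2])
  have hAi : IntDiff A := fun i j => hB t₀ _ _
  have hb : ∀ (t : X.Link r) (v : Fin (m + 1)), ∃ z : ℤ, B t t.1.2 - A v = z := fun t v => by
    rw [← hAt t]
    exact hB t _ _
  obtain ⟨k, hk⟩ := exists_int_ridgeMult r hAi hb
  refine ⟨k, A, fun t => B t t.1.2, hAi, hb, hr t₀, fun t => ?_, hk⟩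
  rw [← hAt t, ins_self]
  exact hloc t

/-- The divisor of a PL function vanishes if and only if the function is linear off a nowhere dense
subset of the isolated ridges. -/
theorem isDiv_zero_iff {U : Opens X.Realization} (φ : PL U) : IsDiv U (ext0 U φ.1) 0 ↔
    ∃ (V : Opens X.Realization) (h : V ≤ U),
      (U : Set X.Realization) \ V ⊆ isolatedRidges X ∧
      interior ((U : Set X.Realization) \ V) = ∅ ∧ IsLinear V (PL.res h φ).1 := by
  obtain ⟨𝓗, h𝓗⟩ := exists_adapted φ
  set Φ := ext0 U φ.1 with hΦd
  constructor
  · intro hΦ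
    -- the points of the isolated ridges where `φ` may fail to be affine
    let K : ∀ r : X.cell m, Set (Simp m) := fun r =>
      {x | ∃ h ∈ 𝓗.planes r, h ≠ 0 ∧ ev h x = 0}
    have hK : ∀ r, IsClosed (K r) := by
      intro r
      have : K r = ⋃ h ∈ {h | h ∈ 𝓗.planes r ∧ h ≠ 0}, {x | ev h x = 0} := by
        ext x
        simp [K, and_assoc]
      rw [this]
      exact ((𝓗.planes r).finite_toSet.subset fun h hh => hh.1).isClosed_biUnion fun h _ =>
        isClosed_eq (continuous_ev h) continuous_const
    have : Finite (X.cell m) := X.finite_cell m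
    have hC : IsClosed (⋃ r : {r : X.cell m // IsEmpty (X.Link r)}, param r.1 '' K r.1) :=
      isClosed_iUnion_of_finite fun r => isClosed_image_param _ (hK _)
    set V : Opens X.Realization := U ⊓ ⟨_, hC.isOpen_compl⟩ with hV
    have hVU : V ≤ U := inf_le_left
    have hdiff : (U : Set X.Realization) \ V ⊆
        ⋃ r : {r : X.cell m // IsEmpty (X.Link r)}, param r.1 '' K r.1 := by
      rintro y ⟨hyU, hyV⟩
      by_contra hy
      exact hyV ⟨hyU, hy⟩
    refine ⟨V, hVU, ?_, ?_, ?_, ?_⟩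
    · intro y hy
      obtain ⟨⟨r, hr⟩, x, -, rfl⟩ := Set.mem_iUnion.1 (hdiff hy)
      exact ⟨r, hr, x, rfl⟩
    · rw [Set.eq_empty_iff_forall_notMem]
      intro y hy
      obtain ⟨⟨r, hr⟩, x, -, rfl⟩ := Set.mem_iUnion.1 (hdiff (interior_subset hy))
      obtain ⟨x', hx', hx'i, hx'K⟩ := exists_isInt_notMem (x₀ := x) (T := K r)
        ((continuous_param r).continuousAt.preimage_mem_nhds (isOpen_interior.mem_nhds hy)) (by
          have : Finite {h // h ∈ 𝓗.planes r ∧ h ≠ 0} :=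
            ((𝓗.planes r).finite_toSet.subset fun h hh => hh.1).to_subtype
          refine (ThinIn.iUnion (A := fun h : {h // h ∈ 𝓗.planes r ∧ h ≠ 0} =>
            {x : Simp m | ev h.1 x = 0}) fun h => thinIn_of_ev h.2.2).mono ?_
          rintro y ⟨h, h1, h2, h3⟩
          exact Set.mem_iUnion.2 ⟨⟨h, h1, h2⟩, h3⟩)
      obtain ⟨⟨r', hr'⟩, x'', hx'', heq⟩ := Set.mem_iUnion.1 (hdiff (interior_subset hx'))
      obtain ⟨rfl, rfl⟩ := param_injOn_isInt hx'i heq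
      exact hx'K hx''
    · intro f p hp
      obtain ⟨B, hB, h⟩ := exists_ev_facet h𝓗.cont hΦ (hVU hp)
      obtain ⟨μ, hμ⟩ := hB.exists_eq
      refine ⟨B 0, μ, ?_⟩
      filter_upwards [h] with x hx hxV
      rw [hμ, ev_const_add, hΦd, ext0_of_mem _ (hVU hxV)] at hx
      exact hx
    · intro r p hp hpV
      obtain ⟨x, rfl⟩ := exists_toN₀_eq p hp
      rw [proj_toN₀] at hpV
      obtain ⟨k, hk⟩ : ∃ k, HasRidgeMult Φ r x k := by
        rcases isEmpty_or_nonempty (X.Link r) with hr | ⟨⟨t₀⟩⟩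
        · obtain ⟨F, hF⟩ := h𝓗.form r
          have hxK : ∀ h ∈ 𝓗.planes r, ev h x = 0 → h = 0 := by
            intro h hh hx
            by_contra h0
            exact hpV.2 (Set.mem_iUnion.2 ⟨⟨r, hr⟩, x, ⟨h, hh, h0, hx⟩, rfl⟩)
          have h1 := hF.eventually_eq hxK mem_openCell_self (hVU hpV)
          have hb : ∀ (t : X.Link r) (v : Fin (m + 1)),
              ∃ z : ℤ, (0 : ℝ) - F (sgn (𝓗.planes r) x) v = z := fun t => hr.elim t
          obtain ⟨k, hk⟩ := exists_int_ridgeMult r (hF.1 _) hb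
          exact ⟨k, _, _, hF.1 _, hb, h1, fun t => hr.elim t, hk⟩
        · exact exists_hasRidgeMult_of_link h𝓗.cont hΦ t₀ (hVU hpV)
      obtain ⟨c, ℓ, hℓ, h⟩ := exists_linear_of_hasRidgeMult hΦ (hVU hpV) hk
      refine ⟨c, ℓ, hℓ, ?_⟩
      filter_upwards [h] with y hy hyV
      rw [hΦd, ext0_of_mem _ (hVU hyV)] at hy
      exact hy
  · rintro ⟨V, hVU, hiso, hint, hlinf, hlinr⟩
    have hfacet : ∀ (f : X.cell (m + 1)) (x : Simp (m + 1)), IsInt x → param f x ∈ V →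
        ∀ lam, HasMultDir Φ (param f x) lam 0 := by
      intro f x hx hxV lam
      obtain ⟨c, μ, h⟩ := hlinf f x hxV
      refine hasMultDir_zero hx (IntDiff.const_add_int c μ) ?_ lam
      filter_upwards [h, eventually_param_mem hxV] with y hy hyV
      rw [ev_const_add, hΦd, ext0_of_mem _ (hVU hyV), ← hy hyV]
      rfl
    have hridge : ∀ (r : X.cell m) (x : Simp m), param r x ∈ V → HasRidgeMult Φ r x 0 := by
      intro r x hxV
      obtain ⟨c, ℓ, hℓ, h⟩ := hlinr r (toN₀ x) (inRidge_toN₀ x) (by rwa [proj_toN₀])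
      refine hasRidgeMult_zero hxV (c := c) hℓ ?_
      filter_upwards [h] with y hy hyV
      rw [hΦd, ext0_of_mem _ (hVU hyV), ← hy hyV]
      rfl
    obtain ⟨z, T, hT, hz⟩ := h𝓗.exists_isDiv
    refine ⟨T, hT, fun y hyU hyT => ?_⟩
    rw [map_zero]
    obtain ⟨lam, hlam, h⟩ := hz y hyU hyT
    refine ⟨lam, hlam, ?_⟩
    rcases h with ⟨f, x, hx, rfl, -⟩ | ⟨r, x, hx, rfl, h⟩
    · refine hfacet f x hx ?_ lam
      by_contra hV
      exact notMem_isolatedRidges hx (hiso ⟨hyU, hV⟩)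
    · refine Or.inr ⟨r, x, hx, rfl, ?_⟩
      by_cases hxV : param r x ∈ V
      · exact hridge r x hxV
      · -- the multiplicity is constant along an isolated ridge near `x`
        have hr := isEmpty_link_of_mem hx (hiso ⟨hyU, hxV⟩)
        obtain ⟨O, hO, hOo, hxO⟩ := mem_nhds_iff.1 (h.eventually.and (eventually_param_mem hyU))
        have hpos : IsOpen {x : Simp m | IsInt x} := by
          simp only [IsInt, Set.ofPred_forall]
          exact isOpen_iInter_of_finite fun i => isOpen_lt continuous_const
            ((continuous_apply i).comp continuous_subtype_val)
        have hopen : IsOpen (param r '' (O ∩ {x | IsInt x})) :=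
          isOpen_image_param (eq_of_face_isolated hr) (hOo.inter hpos) fun x hx => hx.2
        obtain ⟨x', hx', hx'V⟩ : ∃ x' ∈ O, param r x' ∈ V := by
          by_contra! hno
          have hsub : param r '' (O ∩ {x | IsInt x}) ⊆ interior ((U : Set X.Realization) \ V) := by
            refine interior_maximal ?_ hopen
            rintro _ ⟨x', hx', rfl⟩
            exact ⟨(hO hx'.1).2, hno x' hx'.1⟩
          rw [hint] at hsub
          exact hsub ⟨x, ⟨hxO, hx⟩, rfl⟩
        have h0 := (hO hx').1.unique (hridge r x' hx'V)
        rwa [h0] at h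

end Kernel

/-! ### Functions supported on one facet -/

section Wedge

open DeltaComplex

variable {k m : ℕ}

theorem isOpen_isInt : IsOpen {x : Simp k | IsInt x} := by
  simp only [IsInt, Set.ofPred_forall]
  exact isOpen_iInter_of_finite fun i => isOpen_lt continuous_const
    ((continuous_apply i).comp continuous_subtype_val)

/-- A convex set that is contained in a hyperplane near one of its points has dimension less than
the simplex. -/
theorem finrank_linSpan_le_of_eventually {A : Set (Simp k)} (hA : Cvx A) {x : Simp k} (hx : x ∈ A)
    {B : Fin (k + 1) → ℝ} (hB : B ≠ 0) (h : ∀ᶠ y in 𝓝 x, y ∈ A → ev B y = 0) :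
    Module.finrank ℝ (linSpan A) ≤ k := by
  have hAB : ∀ a ∈ A, ev B a = 0 := by
    intro a ha
    obtain ⟨t, h1, h2⟩ := (((tendsto_mix x a).eventually h).and self_mem_nhdsWithin).exists
    have h3 := h1 (hA x hx a ha t)
    rw [ev_mix, h.self_of_nhds hx, mul_zero, zero_add] at h3
    exact (mul_eq_zero.1 h3).resolve_left (ne_of_gt (show (0 : ℝ) < t from h2))
  obtain ⟨i, hi⟩ : ∃ i, B i ≠ 0 := Function.ne_iff.1 hB
  have h1 := finrank_linSpan_lt (h := B) (x := stdSimplex.vertex i) (by rwa [ev_vertex])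
    (Set.mem_univ _) (Set.subset_univ A) hAB
  rw [finrank_linSpan_univ] at h1
  omega

/-- A set that contains a neighbourhood of an interior point in a hyperplane spans the
hyperplane. -/
theorem le_finrank_linSpan_of_eventually {A : Set (Simp k)} {x : Simp k} (hx : IsInt x)
    {B : Fin (k + 1) → ℝ} (hBx : ev B x = 0) (h : ∀ᶠ y in 𝓝 x, ev B y = 0 → y ∈ A) :
    k ≤ Module.finrank ℝ (linSpan A) := by
  have hxA := mem_linSpan (h.self_of_nhds hBx)
  have hker : LinearMap.ker (form B) ≤ linSpan A := by
    intro w hw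
    set v : Fin (k + 1) → ℝ := w - (∑ i, w i) • (x : Fin (k + 1) → ℝ) with hv
    have hv0 : ∑ i, v i = 0 := by
      simp only [hv, Pi.sub_apply, Pi.smul_apply, smul_eq_mul, Finset.sum_sub_distrib,
        ← Finset.mul_sum]
      rw [stdSimplex.sum_eq_one x, mul_one, sub_self]
    have hvB : form B v = 0 := by
      rw [hv, map_sub, map_smul, form_coe, hBx, smul_zero, sub_zero]
      exact hw
    obtain ⟨γ, hγ, hγv⟩ := hx.exists_curve hv0
    obtain ⟨t, ⟨h1, h2⟩, h3⟩ := (((hγ.eventually h).and hγv).filter_mono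
      (nhdsWithin_le_nhds (s := {0}ᶜ)) |>.and self_mem_nhdsWithin).exists
    have hmem := mem_linSpan (h1 (by rw [ev_curve h2, hBx, hvB, mul_zero, add_zero]))
    have heq : w = (∑ i, w i) • (x : Fin (k + 1) → ℝ) +
        (t⁻¹ • (γ t : Fin (k + 1) → ℝ) - t⁻¹ • (x : Fin (k + 1) → ℝ)) := by
      ext i
      have h4 := h2 i
      have h5 : t ≠ 0 := h3
      simp only [Pi.add_apply, Pi.sub_apply, Pi.smul_apply, smul_eq_mul, h4, hv]
      field_simp
      ring
    rw [heq]
    exact add_mem (Submodule.smul_mem _ _ hxA)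
      (sub_mem (Submodule.smul_mem _ _ hmem) (Submodule.smul_mem _ _ hxA))
  refine le_trans ?_ (Submodule.finrank_mono hker)
  have h1 := LinearMap.finrank_range_add_finrank_ker (form B)
  have h2 := Submodule.finrank_le (LinearMap.range (form B))
  rw [Module.finrank_self] at h2
  rw [Module.finrank_fin_fun] at h1
  omega

/-- If an affine function that vanishes at an interior point of a simplex is nonpositive near this
point, then it is zero. -/
theorem IsInt.eq_zero_of_eventually_nonpos {x : Simp k} (hx : IsInt x) {B : Fin (k + 1) → ℝ}
    (hBx : ev B x = 0) (h : ∀ᶠ y in 𝓝 x, ev B y ≤ 0) : B = 0 := by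
  by_contra hB
  obtain ⟨u, hu⟩ := hx.exists_pos hB hBx
  obtain ⟨t, h1, h2⟩ := (((tendsto_mix x u).eventually h).and self_mem_nhdsWithin).exists
  rw [ev_mix, hBx, mul_zero, zero_add] at h1
  exact absurd h1 (not_le.2 (mul_pos (show (0 : ℝ) < t from h2) hu))

/-- Interior points are dense. -/
theorem eventually_of_isInt {p : Simp k} {g g' : Simp k → ℝ} (hg : Continuous g)
    (hg' : Continuous g') (h : ∀ᶠ y in 𝓝 p, IsInt y → g y = g' y) : ∀ᶠ y in 𝓝 p, g y = g' y := by
  filter_upwards [h.eventually_nhds] with y hy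
  by_contra hne
  obtain ⟨z, ⟨h1, h2⟩, h3, -⟩ := exists_isInt_notMem (x₀ := y) (T := ∅)
    (hy.and ((hg.sub hg').continuousAt.eventually_ne (sub_ne_zero.2 hne))) ThinIn.empty
  exact h2 (sub_eq_zero.2 (h1 h3))

variable {X : WeakTropicalComplex.{u} m}

/-- On the part `W` of the facet `f` the function `Φ` is the maximum of `0` and the affine function
with values `c + lam i` at the vertices, and it vanishes outside of `W` and the interior of `f`. -/
structure IsWedge (U : Opens X.Realization) (Φ : X.Realization → ℝ) (f : X.cell (m + 1))
    (W : Set (Simp (m + 1))) (lam : Fin (m + 2) → ℤ) (c : ℝ) : Prop where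
  isOpen : IsOpen W
  isOpen_diff : IsOpen (param f ⁻¹' U \ W)
  primitive : Primitive lam
  exists_pos : ∃ x, 0 < ev (fun i => c + (lam i : ℝ)) x
  eq_max : ∀ x ∈ W, Φ (param f x) = max (ev (fun i => c + (lam i : ℝ)) x) 0
  support : ∀ y ∈ U, Φ y ≠ 0 → ∃ x ∈ W, IsInt x ∧ param f x = y

namespace IsWedge

variable {U : Opens X.Realization} {Φ : X.Realization → ℝ} {f : X.cell (m + 1)}
  {W : Set (Simp (m + 1))} {lam : Fin (m + 2) → ℤ} {c : ℝ}

theorem ne_zero (h : IsWedge U Φ f W lam c) : (fun i => c + (lam i : ℝ)) ≠ 0 := by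
  intro h0
  obtain ⟨x, hx⟩ := h.exists_pos
  rw [h0, ev_zero] at hx
  exact lt_irrefl _ hx

theorem of_ne_zero (h : IsWedge U Φ f W lam c) {f' : X.cell (m + 1)} {x : Simp (m + 1)}
    (hx : param f' x ∈ U) (h0 : Φ (param f' x) ≠ 0) : f' = f ∧ x ∈ W := by
  obtain ⟨x', hx', hi, heq⟩ := h.support _ hx h0
  obtain ⟨rfl, rfl⟩ := param_injOn_isInt hi heq.symm
  exact ⟨rfl, hx'⟩

theorem eq_zero_ridge (h : IsWedge U Φ f W lam c) {r : X.cell m} {x : Simp m}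
    (hx : param r x ∈ U) : Φ (param r x) = 0 := by
  by_contra h0
  obtain ⟨x', -, hi, heq⟩ := h.support _ hx h0
  obtain ⟨θ, -⟩ := exists_face_of_param_eq hi heq.symm
  have := le_of_orderEmb θ
  omega

theorem eventually_zero (h : IsWedge U Φ f W lam c) {f' : X.cell (m + 1)} {x : Simp (m + 1)}
    (hx : param f' x ∈ U) (hW : ¬ (f' = f ∧ x ∈ W)) : ∀ᶠ y in 𝓝 x, Φ (param f' y) = 0 := by
  by_cases hf : f' = f
  · subst hf
    filter_upwards [h.isOpen_diff.mem_nhds ⟨hx, fun hxW => hW ⟨rfl, hxW⟩⟩] with y hy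
    by_contra h0
    exact hy.2 (h.of_ne_zero hy.1 h0).2
  · filter_upwards [eventually_param_mem hx] with y hy
    by_contra h0
    exact hf (h.of_ne_zero hy h0).1

theorem eventually_max (h : IsWedge U Φ f W lam c) {x : Simp (m + 1)} (hx : x ∈ W) :
    ∀ᶠ y in 𝓝 x, Φ (param f y) = max (ev (fun i => c + (lam i : ℝ)) y) 0 :=
  Filter.eventually_of_mem (h.isOpen.mem_nhds hx) h.eq_max

/-- The zero set is a polyhedron of dimension `m` if it meets the interior of the facet. -/
theorem isPolyhedronOfDim (h : IsWedge U Φ f W lam c) {A : Set (Simp (m + 1))}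
    (hA : IsPolyhedron A)
    (hAU : A ∩ param f ⁻¹' U = {x ∈ W | ev (fun i => c + (lam i : ℝ)) x = 0}) {x : Simp (m + 1)}
    (hxA : x ∈ A) (hxU : param f x ∈ U) (hr : m + 1 ≤ Module.finrank ℝ (linSpan A)) :
    IsPolyhedronOfDim m A := by
  refine isPolyhedronOfDim_iff.2 ⟨hA, le_antisymm ?_ hr⟩
  refine finrank_linSpan_le_of_eventually hA.cvx hxA h.ne_zero ?_
  filter_upwards [eventually_param_mem hxU] with y hy hyA
  exact (hAU.le ⟨hyA, hy⟩).2

theorem hasMultDir_facet (h : IsWedge U Φ f W lam c) {A : Set (Simp (m + 1))}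
    (hA : IsPolyhedron A)
    (hAU : A ∩ param f ⁻¹' U = {x ∈ W | ev (fun i => c + (lam i : ℝ)) x = 0})
    {f' : X.cell (m + 1)} {x : Simp (m + 1)} (hx : IsInt x) (hxU : param f' x ∈ U) :
    HasMultDir Φ (param f' x) lam (cnt (param f' x) (gen m f A)) := by
  by_cases hZ : f' = f ∧ x ∈ A
  · obtain ⟨rfl, hxA⟩ := hZ
    obtain ⟨hxW, hx0⟩ := hAU.le ⟨hxA, hxU⟩
    have hdim := h.isPolyhedronOfDim hA hAU hxA hxU (le_finrank_linSpan_of_eventually hx hx0 (by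
      filter_upwards [h.isOpen.mem_nhds hxW] with y hyW hy0
      exact (hAU.ge ⟨hyW, hy0⟩).1))
    rw [cnt_gen _ _ hdim, pcount_eq_one hx hxA]
    refine Or.inl ⟨f', x, hx, rfl, 0, IntDiff.zero, ?_⟩
    filter_upwards [h.eventually_max hxW] with y hy
    rw [ev_const_add] at hx0
    rw [hy, ev_zero, ev_const_add, Int.cast_one, one_mul, zero_add]
    congr 1
    have h1 : ∀ z : Simp (m + 1), ev (toR lam) z = ∑ i, (lam i : ℝ) * z i := fun z => rfl
    rw [h1, h1]
    linarith
  · have hcnt : cnt (param f' x) (gen m f A) = 0 := by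
      by_cases hdim : IsPolyhedronOfDim m A
      · rw [cnt_gen _ _ hdim]
        refine pcount_eq_zero fun x' hx' heq => hZ ?_
        obtain ⟨rfl, rfl⟩ := param_injOn_isInt hx heq
        exact ⟨rfl, hx'⟩
      · rw [gen, dif_neg hdim, map_zero]
    rw [hcnt]
    by_cases hW : f' = f ∧ x ∈ W
    · obtain ⟨rfl, hxW⟩ := hW
      have hne : ev (fun i => c + (lam i : ℝ)) x ≠ 0 := fun h0 =>
        hZ ⟨rfl, (hAU.ge ⟨hxW, h0⟩).1⟩
      rcases hne.lt_or_gt with hlt | hgt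
      · refine hasMultDir_zero hx IntDiff.zero ?_ lam
        filter_upwards [h.eventually_max hxW, (continuous_ev _).continuousAt.eventually_lt
          continuousAt_const hlt] with y hy hy0
        rw [hy, ev_zero, max_eq_right hy0.le]
      · refine hasMultDir_zero hx (IntDiff.const_add_int c lam) ?_ lam
        filter_upwards [h.eventually_max hxW, continuousAt_const.eventually_lt
          (continuous_ev _).continuousAt hgt] with y hy hy0
        rw [hy, max_eq_left hy0.le]
    · refine hasMultDir_zero hx IntDiff.zero ?_ lam
      filter_upwards [h.eventually_zero hxU hW] with y hy
      rw [hy, ev_zero]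

/-- If the function is a nonzero multiple of the distance to a ridge near a point of the ridge,
then its affine function is the barycentric coordinate of the opposite vertex. -/
theorem eq_single (h : IsWedge U Φ f W lam c) {f' : X.cell (m + 1)} {i : Fin (m + 2)}
    {p : Simp (m + 1)} {b : ℝ} (hb : b ≠ 0) (hpU : param f' p ∈ U)
    (hΦ : ∀ᶠ y in 𝓝 p, Φ (param f' y) = b * y i) :
    (f' = f ∧ p ∈ W) ∧ b = 1 ∧ (fun i => c + (lam i : ℝ)) = Pi.single i 1 := by
  have hW : f' = f ∧ p ∈ W := by
    by_contra hW
    obtain ⟨y, ⟨h1, h2⟩, h3, -⟩ := exists_isInt_notMem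
      ((h.eventually_zero hpU hW).and hΦ) (ThinIn.empty (m := m + 1))
    rw [h1] at h2
    exact mul_ne_zero hb (h3 i).ne' h2.symm
  refine ⟨hW, ?_⟩
  obtain ⟨rfl, hpW⟩ := hW
  have hmax := h.eventually_max hpW
  have hb0 : 0 < b := by
    obtain ⟨y, ⟨h1, h2⟩, h3, -⟩ := exists_isInt_notMem (hmax.and hΦ) (ThinIn.empty (m := m + 1))
    have h4 : 0 ≤ b * y i := by
      rw [← h2, h1]
      exact le_max_right _ _
    exact lt_of_le_of_ne (nonneg_of_mul_nonneg_left h4 (h3 i)) hb.symm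
  have hB : (fun i => c + (lam i : ℝ)) = b • (Pi.single i 1 : Fin (m + 2) → ℝ) := by
    refine eq_of_eventually_ev (x₀ := p)
      (eventually_of_isInt (continuous_ev _) (continuous_ev _) ?_)
    filter_upwards [hmax, hΦ] with y h1 h2 h3
    rw [ev_smul, ev_single]
    rw [h2] at h1
    have h4 : 0 < b * y i := mul_pos hb0 (h3 i)
    rcases le_total (ev (fun i => c + (lam i : ℝ)) y) 0 with h5 | h5
    · rw [max_eq_right h5] at h1
      exact absurd h1 h4.ne'
    · rw [max_eq_left h5] at h1
      exact h1.symm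
  have hi : c + (lam i : ℝ) = b := by simpa using congrFun hB i
  have hj : ∀ j ≠ i, c + (lam j : ℝ) = 0 := fun j hj => by simpa [hj] using congrFun hB j
  obtain ⟨j₀, hj₀⟩ := exists_ne i
  have hd : ((lam i - lam j₀ : ℤ) : ℝ) = b := by
    push_cast
    linarith [hj j₀ hj₀]
  have hlam : ∀ j ≠ i, lam j = lam j₀ := fun j hj' => by
    have h1 := hj j hj'
    have h2 := hj j₀ hj₀
    exact_mod_cast (by linarith : (lam j : ℝ) = lam j₀)
  have hunit : IsUnit (lam i - lam j₀) := by
    refine h.primitive _ fun j j' => ?_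
    by_cases h1 : j = i <;> by_cases h2 : j' = i
    · rw [h1, h2, sub_self]
      exact dvd_zero _
    · rw [h1, hlam j' h2]
    · rw [h2, hlam j h1]
      exact (dvd_sub_comm).1 dvd_rfl
    · rw [hlam j h1, hlam j' h2, sub_self]
      exact dvd_zero _
  have hb1 : b = 1 := by
    rcases Int.isUnit_iff.1 hunit with h1 | h1
    · rw [← hd, h1, Int.cast_one]
    · rw [h1] at hd
      norm_num at hd
      linarith
  exact ⟨hb1, by rw [hB, hb1, one_smul]⟩

theorem eq_one_of_mem (h : IsWedge U Φ f W lam c) {A : Set (Simp (m + 1))}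
    (hAU : A ∩ param f ⁻¹' U = {x ∈ W | ev (fun i => c + (lam i : ℝ)) x = 0}) {r : X.cell m}
    {x : Simp m} (hx : IsInt x) (hxU : param r x ∈ U) (t : X.Link r) (htf : t.1.1 = f)
    (htA : stdSimplex.map (emb t) x ∈ A) {b : ℝ}
    (hΦ : ∀ᶠ y in 𝓝 (stdSimplex.map (emb t) x), Φ (param t.1.1 y) = b * y t.1.2) : b = 1 := by
  subst htf
  rw [← param_emb t] at hxU
  obtain ⟨hW, h0⟩ := hAU.le ⟨htA, hxU⟩
  suffices hb : b ≠ 0 from (h.eq_single hb hxU hΦ).2.1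
  rintro rfl
  set B : Fin (m + 2) → ℝ := fun i => c + (lam i : ℝ) with hB
  -- otherwise the affine function is nonpositive near the ridge, hence zero on the ridge
  have hle : ∀ᶠ y in 𝓝 (stdSimplex.map (emb t) x), ev B y ≤ 0 := by
    filter_upwards [hΦ, h.eventually_max hW] with y h1 h2
    rw [h1, zero_mul] at h2
    rw [h2]
    exact le_max_left _ _
  have hr : (fun v => B (emb t v)) = 0 := by
    refine hx.eq_zero_of_eventually_nonpos (by rw [← ev_map]; exact h0) ?_
    filter_upwards [(stdSimplex.continuous_map (emb t)).continuousAt.eventually hle] with y hy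
    rwa [← ev_map]
  have hev : ∀ y, ev B y = B t.1.2 * y t.1.2 := by
    intro y
    rw [← ins_self t B, hr, ev_ins]
    simp [ins]
  obtain ⟨y, hy⟩ := h.exists_pos
  obtain ⟨z, hz, hzi, -⟩ := exists_isInt_notMem hle (ThinIn.empty (m := m + 1))
  change ev B z ≤ 0 at hz
  rw [hev] at hz hy
  have h1 : B t.1.2 ≤ 0 := nonpos_of_mul_nonpos_left hz (hzi _)
  exact absurd hy (not_lt.2 (mul_nonpos_of_nonpos_of_nonneg h1 (stdSimplex.zero_le y _)))

/-- Near an interior point of a ridge `r`, a wedge is the distance to `r` on the simplices of `N_r`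
over `f` whose face point lies in `A`, and zero on the others. The multiplicity counts the
former. -/
theorem eq_cnt_ridge (h : IsWedge U Φ f W lam c) {A : Set (Simp (m + 1))}
    (hA : IsPolyhedron A)
    (hAU : A ∩ param f ⁻¹' U = {x ∈ W | ev (fun i => c + (lam i : ℝ)) x = 0})
    {r : X.cell m} {x : Simp m} (hx : IsInt x) (hxU : param r x ∈ U) {k : ℤ}
    (hk : HasRidgeMult Φ r x k) : k = cnt (param r x) (gen m f A) := by
  classical
  obtain ⟨a, b, -, -, h1, h2, h3⟩ := hk
  have ha : a = 0 := eq_of_eventually_ev (x₀ := x) (by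
    filter_upwards [h1, eventually_param_mem hxU] with y hy hyU
    rw [← hy, h.eq_zero_ridge hyU, ev_zero])
  subst ha
  have hpU : ∀ t : X.Link r, param t.1.1 (stdSimplex.map (emb t) x) ∈ U := fun t => by
    rwa [param_emb]
  have hΦ : ∀ t : X.Link r, ∀ᶠ y in 𝓝 (stdSimplex.map (emb t) x),
      Φ (param t.1.1 y) = b t * y t.1.2 := fun t => by
    filter_upwards [h2 t] with y hy
    rw [hy, ev_ins]
    simp
  set S : Finset (X.Link r) := {t | t.1.1 = f ∧ stdSimplex.map (emb t) x ∈ A} with hS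
  have hb : ∀ t, b t = if t ∈ S then 1 else 0 := by
    intro t
    split_ifs with ht
    · rw [hS, Finset.mem_filter] at ht
      exact h.eq_one_of_mem hAU hx hxU t ht.2.1 ht.2.2 (hΦ t)
    · by_contra hb
      obtain ⟨⟨hf, hW⟩, -, hB⟩ := h.eq_single hb (hpU t) (hΦ t)
      refine ht (Finset.mem_filter.2 ⟨Finset.mem_univ _, hf, ?_⟩)
      refine (hAU.ge ⟨hW, ?_⟩).1
      rw [hB, ev_single, map_emb_apply_opposite]
  have hkS : k = S.card := by
    have : (k : ℝ) = S.card := by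
      rw [h3]
      simp [hb]
    exact_mod_cast this
  rw [hkS]
  have hinj : Set.InjOn (fun t : X.Link r => stdSimplex.map (S := ℝ) (emb t) x) S := by
    intro t ht t' ht' heq
    rw [hS, Finset.mem_coe, Finset.mem_filter] at ht ht'
    refine Subtype.ext (Prod.ext (ht.2.1.trans ht'.2.1.symm) ?_)
    by_contra hne
    obtain ⟨v, hv⟩ := Fin.exists_succAbove_eq hne
    have h4 := map_emb_apply_opposite t x
    rw [show stdSimplex.map (emb t) x = stdSimplex.map (emb t') x from heq, ← hv] at h4
    exact (hx v).ne' ((map_apply_self (emb t') x v).symm.trans h4)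
  have himage : (fun t : X.Link r => stdSimplex.map (S := ℝ) (emb t) x) '' S =
      {x' | x' ∈ A ∧ param f x' = param r x} := by
    ext x'
    constructor
    · rintro ⟨t, ht, rfl⟩
      rw [hS, Finset.mem_coe, Finset.mem_filter] at ht
      exact ⟨ht.2.2, by rw [← ht.2.1, param_emb]⟩
    · rintro ⟨hx'A, heq⟩
      obtain ⟨θ, hθ, rfl⟩ := exists_face_of_param_eq hx heq
      obtain ⟨t, ht, rfl⟩ := exists_link_of_face hθ
      exact ⟨t, Finset.mem_coe.2 (Finset.mem_filter.2 ⟨Finset.mem_univ _, ht, hx'A⟩), rfl⟩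
  by_cases hdim : IsPolyhedronOfDim m A
  · rw [cnt_gen _ _ hdim, pcount]
    simp only [Set.indicator_apply, Pi.one_apply]
    rw [Finset.sum_boole, ← Finset.card_image_of_injOn hinj]
    congr 2
    refine Finset.coe_injective ?_
    rw [Finset.coe_image, himage]
    ext x'
    simp [and_comm]
  · rw [gen, dif_neg hdim, map_zero, Nat.cast_eq_zero, Finset.card_eq_zero,
      Finset.eq_empty_iff_forall_notMem]
    intro t ht
    have hb1 : b t = 1 := by rw [hb, if_pos ht]
    rw [hS, Finset.mem_filter] at ht
    obtain ⟨-, htf, htA⟩ := ht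
    subst htf
    obtain ⟨⟨-, hW⟩, -, hB⟩ := h.eq_single (by rw [hb1]; exact one_ne_zero) (hpU t) (hΦ t)
    refine hdim (h.isPolyhedronOfDim hA hAU htA (hpU t) ?_)
    by_contra hlt
    have hthin : ThinIn m A := ThinIn.of_finrank_le (by omega)
    obtain ⟨y, hy, -, hyA⟩ := exists_isInt_notMem
      ((stdSimplex.continuous_map (emb t)).continuousAt.preimage_mem_nhds (h.isOpen.mem_nhds hW))
      (hthin.preimage (emb t))
    refine hyA (hAU.ge ⟨hy, ?_⟩).1
    rw [hB, ev_single, map_emb_apply_opposite]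

/-- The divisor of a function that is the maximum of an affine function and zero on a facet. -/
theorem isDiv (h : IsWedge U Φ f W lam c) {A : Set (Simp (m + 1))} (hA : IsPolyhedron A)
    (hAU : A ∩ param f ⁻¹' U = {x ∈ W | ev (fun i => c + (lam i : ℝ)) x = 0})
    (hex : ∃ z, IsDiv U Φ z) : IsDiv U Φ (gen m f A) := by
  obtain ⟨z, T, hT, hz⟩ := hex
  refine ⟨T, hT, fun y hyU hyT => ?_⟩
  obtain ⟨lam', hlam', ⟨f', x, hx, rfl, -⟩ | ⟨r, x, hx, rfl, hk⟩⟩ := hz y hyU hyT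
  · exact ⟨lam, h.primitive, h.hasMultDir_facet hA hAU hx hyU⟩
  · refine ⟨lam', hlam', Or.inr ⟨r, x, hx, rfl, ?_⟩⟩
    rwa [← h.eq_cnt_ridge hA hAU hx hyU hk]

end IsWedge

/-- The divisor of a function that is affine on the interior of an isolated ridge. -/
theorem isDiv_isolated {U : Opens X.Realization} {Φ : X.Realization → ℝ} {r : X.cell m}
    (hr : IsEmpty (X.Link r))
    (hU : (U : Set X.Realization) = {y | ∃ x : Simp m, IsInt x ∧ param r x = y})
    {a : Fin (m + 1) → ℝ} (ha : IntDiff a) (hΦ : ∀ x, IsInt x → Φ (param r x) = ev a x) {z : ℤ}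
    (hz : (z : ℝ) = -∑ v, a v * X.α r v) :
    IsDiv U Φ (z • gen m r (Set.univ : Set (Simp m))) := by
  refine ⟨∅, Thin.empty, fun y hy _ => ?_⟩
  rw [← SetLike.mem_coe, hU] at hy
  obtain ⟨x, hx, rfl⟩ := hy
  have hdim : IsPolyhedronOfDim m (Set.univ : Set (Simp m)) :=
    isPolyhedronOfDim_iff.2 ⟨IsPolyhedron.univ, finrank_linSpan_univ⟩
  refine ⟨Pi.single 0 1, primitive_single 0, Or.inr ⟨r, x, hx, rfl, a, fun t => hr.elim t, ha,
    fun t => hr.elim t, ?_, fun t => hr.elim t, ?_⟩⟩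
  · exact Filter.eventually_of_mem (isOpen_isInt.mem_nhds hx) hΦ
  · rw [map_zsmul, cnt_gen _ _ hdim, pcount_eq_one hx (Set.mem_univ x), smul_eq_mul, mul_one, hz]
    simp [mul_comm]

end Wedge

/-! ### Existence of the divisor -/

section Assignment

open DeltaComplex

variable {m : ℕ} {X : WeakTropicalComplex.{u} m}

theorem sum_add_eq_ev {k : ℕ} (lam : Fin (k + 1) → ℤ) (c : ℝ) (x : Simp k) :
    ∑ i, (lam i : ℝ) * x i + c = ev (fun i => c + (lam i : ℝ)) x := by
  rw [ev_const_add, add_comm]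

/-- A PL function that is affine on the interior of a simplex has integral slopes there. -/
theorem intDiff_of_ev {U : Opens X.Realization} (φ : PL U) {k : ℕ} {s : X.cell k}
    {a : Fin (k + 1) → ℝ} {x₀ : Simp k} (hx₀ : param s x₀ ∈ U)
    (h : ∀ x, IsInt x → param s x ∈ U → ext0 U φ.1 (param s x) = ev a x) : IntDiff a := by
  obtain ⟨H, F, hF⟩ := (φ.2.2 k s).exists_isForm
  obtain ⟨p, hpU, hpi, hpH⟩ := exists_isInt_notMem (T := ⋃ h : {h // h ∈ H ∧ h ≠ 0},
    {x : Simp k | ev h.1 x = 0}) (eventually_param_mem hx₀) (by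
      have : Finite {h // h ∈ H ∧ h ≠ 0} := (H.finite_toSet.subset fun h hh => hh.1).to_subtype
      exact ThinIn.iUnion fun h => thinIn_of_ev h.2.2)
  have h1 := hF.eventually_eq (p := p) (fun h hh hp => by
    by_contra h0
    exact hpH (Set.mem_iUnion.2 ⟨⟨h, hh, h0⟩, hp⟩)) mem_openCell_self hpU
  have h2 : F (sgn H p) = a := eq_of_eventually_ev (x₀ := p) (by
    filter_upwards [h1, eventually_param_mem hpU, isOpen_isInt.mem_nhds hpi] with y hy hyU hyi
    rw [← hy, h y hyi hyU])
  rw [← h2]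
  exact hF.1 _

theorem exists_isDiv {U : Opens X.Realization} (φ : PL U) : ∃ z, IsDiv U (ext0 U φ.1) z := by
  obtain ⟨𝓗, h𝓗⟩ := exists_adapted φ
  exact h𝓗.exists_isDiv

variable (X) in
theorem exists_isDivisorAssignment :
    ∃ D : ∀ U : Opens X.Realization, PL U → FormalSum m U, IsDivisorAssignment X D := by
  obtain ⟨D, hD⟩ := exists_assignment X
  refine ⟨D, ?_, ?_, ?_, ?_, ?_⟩
  · intro U φ ψ
    obtain ⟨z, hz⟩ := exists_isDiv φ
    obtain ⟨w, hw⟩ := exists_isDiv ψ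
    rw [(hD U φ z).2 hz, (hD U ψ w).2 hw, (hD U (φ + ψ) (z + w)).2 (hz.add hw)]
    rfl
  · intro U V h φ
    obtain ⟨z, hz⟩ := exists_isDiv φ
    rw [(hD U φ z).2 hz]
    refine (hD V _ z).2 ((hz.mono h).congr fun y hy => ?_)
    rw [ext0_of_mem _ (h hy), ext0_of_mem _ hy]
    rfl
  · intro U φ
    exact (hD U φ 0).trans (isDiv_zero_iff φ)
  · intro U φ f W lam c hWU hW hW' hlam hpos hmax hsupp A hA hAU
    refine (hD U φ _).2 (IsWedge.isDiv (W := W) (lam := lam) (c := c) ⟨hW, hW', hlam, ?_, ?_, ?_⟩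
      hA ?_ (exists_isDiv φ))
    · simpa only [sum_add_eq_ev] using hpos
    · intro x hx
      rw [ext0_of_mem _ (hWU hx), ← sum_add_eq_ev]
      exact hmax x hx _
    · intro y hy h0
      rw [ext0_of_mem _ hy] at h0
      exact hsupp ⟨y, hy⟩ h0
    · simpa only [sum_add_eq_ev] using hAU
  · intro U φ r hr hU a hφ
    have hint : ∀ x : Simp m, IsInt x → param r x ∈ U := fun x hx => by
      rw [← SetLike.mem_coe, hU]
      exact ⟨x, hx, rfl⟩
    have hev : ∀ x : Simp m, IsInt x → ext0 U φ.1 (param r x) = ev a x := fun x hx => by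
      rw [ext0_of_mem _ (hint x hx), hφ x (hint x hx) hx]
      rfl
    obtain ⟨x₀, -, hx₀, -⟩ := exists_isInt_notMem
      (x₀ := stdSimplex.vertex (S := ℝ) (0 : Fin (m + 1)))
      Filter.univ_mem (ThinIn.empty (m := m))
    have ha : IntDiff a := intDiff_of_ev φ (hint x₀ hx₀) fun x hx _ => hev x hx
    obtain ⟨z, hz⟩ := exists_int_ridgeMult r (b := fun t => hr.elim t) ha fun t => hr.elim t
    have hz' : (z : ℝ) = -∑ v, a v * X.α r v := by
      rw [hz]
      simp [mul_comm]
    exact ⟨z, hz', (hD U φ _).2 (isDiv_isolated hr hU ha hev hz')⟩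

end Assignment

/-! ### Construction of PL functions -/

section Construction

open DeltaComplex

/-- A function on an open subset of the realization is continuous if it is so on the parametrizing
simplices. -/
theorem continuousOn_of_param {X : DeltaComplex.{u}} {V : Opens X.Realization}
    {g : X.Realization → ℝ}
    (h : ∀ (k : ℕ) (s : X.cell k), ContinuousOn (fun x => g (param s x)) (param s ⁻¹' V)) :
    ContinuousOn g V := by
  rw [continuousOn_open_iff V.isOpen]
  intro t ht
  rw [isOpen_iff_param]
  intro k s
  exact (h k s).isOpen_inter_preimage (V.isOpen.preimage (continuous_param s)) ht

theorem isPLOn_of_ev {X : DeltaComplex.{u}} {V : Opens X.Realization} {φ : V → ℝ} {k : ℕ}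
    {s : X.cell k} {B : Fin (k + 1) → ℝ} (hB : IntDiff B)
    (h : ∀ x (hx : param s x ∈ V), φ ⟨_, hx⟩ = ev B x) : IsPLOn V φ s := by
  obtain ⟨μ, hμ⟩ := hB.exists_eq
  refine ⟨Unit, inferInstance, fun _ => Set.univ, fun _ => B 0, fun _ => μ,
    fun _ => IsPolyhedron.univ, fun _ => ⟨(), trivial⟩, fun _ x _ hx => ?_⟩
  exact (h x hx).trans ((congrArg (ev · x) hμ).trans (ev_const_add _ _ _))

/-- A function on an open set that is continuous and PL on every simplex. -/
def PL.ofParam {X : DeltaComplex.{u}} {V : Opens X.Realization} (g : X.Realization → ℝ)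
    (hc : ∀ (k : ℕ) (s : X.cell k), ContinuousOn (fun x => g (param s x)) (param s ⁻¹' V))
    (hp : ∀ (k : ℕ) (s : X.cell k), IsPLOn V (fun y => g y.1) s) : PL V :=
  ⟨fun y => g y.1, continuousOn_iff_continuous_domRestrict.1 (continuousOn_of_param hc), hp⟩

variable {m : ℕ} {X : WeakTropicalComplex.{u} m}

/-- The maximum of an affine function and zero, on the part of a facet on one side of a hyperplane,
extended by zero. -/
theorem exists_wedge {V : Opens X.Realization} (f : X.cell (m + 1)) (lam : Fin (m + 2) → ℤ) (c : ℝ)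
    (h : Fin (m + 2) → ℝ) (d : ℝ) (hd : ∀ x, param f x ∈ V → ev h x ≠ d)
    (hbd : ∀ x, param f x ∈ V → ev h x < d → ¬ IsInt x → ev (fun i => c + (lam i : ℝ)) x ≤ 0) :
    ∃ g : PL V,
      (∀ x (hx : param f x ∈ V), ev h x < d →
        g.1 ⟨_, hx⟩ = max (ev (fun i => c + (lam i : ℝ)) x) 0) ∧
      ∀ y : V, g.1 y ≠ 0 → ∃ x, ev h x < d ∧ IsInt x ∧ param f x = y := by
  classical
  set B : Fin (m + 2) → ℝ := fun i => c + (lam i : ℝ) with hB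
  set g : X.Realization → ℝ := fun y =>
    if hy : ∃ x, ev h x < d ∧ IsInt x ∧ param f x = y then max (ev B hy.choose) 0 else 0 with hg
  have g_int : ∀ x, ev h x < d → IsInt x → g (param f x) = max (ev B x) 0 := by
    intro x hx hi
    have hy : ∃ x', ev h x' < d ∧ IsInt x' ∧ param f x' = param f x := ⟨x, hx, hi, rfl⟩
    rw [hg]
    simp only [dif_pos hy]
    rw [(param_injOn_isInt hi hy.choose_spec.2.2).2]
  have g_ne : ∀ y, g y ≠ 0 → ∃ x, ev h x < d ∧ IsInt x ∧ param f x = y := by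
    intro y hy
    by_contra hne
    exact hy (dif_neg hne)
  have g_lt : ∀ x, param f x ∈ V → ev h x < d → g (param f x) = max (ev B x) 0 := by
    intro x hx hlt
    by_cases hi : IsInt x
    · exact g_int x hlt hi
    · rw [max_eq_right (hbd x hx hlt hi)]
      by_contra h0
      obtain ⟨x', -, hi', heq⟩ := g_ne _ h0
      obtain ⟨-, rfl⟩ := param_injOn_isInt hi' heq.symm
      exact hi hi'
  have g_gt : ∀ x, d ≤ ev h x → g (param f x) = 0 := by
    intro x hx
    by_contra h0
    obtain ⟨x', hlt, hi', heq⟩ := g_ne _ h0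
    obtain ⟨-, rfl⟩ := param_injOn_isInt hi' heq.symm
    exact absurd hx (not_le.2 hlt)
  have g_cell : ∀ (k : ℕ) (s : X.cell k), (⟨k, s⟩ : Σ k, X.cell k) ≠ ⟨m + 1, f⟩ →
      ∀ x, g (param s x) = 0 := by
    intro k s hs x
    by_contra h0
    obtain ⟨x', -, hi', heq⟩ := g_ne _ h0
    obtain ⟨θ, hθ, -⟩ := exists_face_of_param_eq hi' heq.symm
    exact hs (eq_of_face_facet hθ)
  refine ⟨PL.ofParam g (fun k s => ?_) (fun k s => ?_), g_lt, fun y => g_ne y.1⟩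
  · by_cases hs : (⟨k, s⟩ : Σ k, X.cell k) = ⟨m + 1, f⟩
    · cases hs
      intro x hx
      refine ContinuousAt.continuousWithinAt ?_
      rcases (hd x hx).lt_or_gt with hlt | hgt
      · refine (((continuous_ev B).max
          (continuous_const (y := (0 : ℝ)))).continuousAt (x := x)).congr ?_
        filter_upwards [eventually_param_mem hx,
          (continuous_ev h).continuousAt.eventually_lt continuousAt_const hlt] with y h1 h2
        exact (g_lt y h1 h2).symm
      · refine (continuousAt_const (y := (0 : ℝ))).congr ?_
        filter_upwards [continuousAt_const.eventually_lt
          (continuous_ev h).continuousAt hgt] with y h1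
        exact (g_gt y h1.le).symm
    · exact continuousOn_const.congr fun x _ => g_cell k s hs x
  · by_cases hs : (⟨k, s⟩ : Σ k, X.cell k) = ⟨m + 1, f⟩
    · cases hs
      refine ⟨Fin 3, inferInstance,
        ![{x | ev h x ≤ d} ∩ {x | 0 ≤ ev B x}, {x | ev h x ≤ d} ∩ {x | ev B x ≤ 0},
          {x | d ≤ ev h x}], ![c, 0, 0], ![lam, 0, 0], ?_, ?_, ?_⟩
      · intro i
        fin_cases i
        · exact (IsPolyhedron.le h d).inter (IsPolyhedron.ge B 0)
        · exact (IsPolyhedron.le h d).inter (IsPolyhedron.le B 0)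
        · exact IsPolyhedron.ge h d
      · intro x
        rcases le_total (ev h x) d with h1 | h1
        · rcases le_total 0 (ev B x) with h2 | h2
          · exact ⟨0, h1, h2⟩
          · exact ⟨1, h1, h2⟩
        · exact ⟨2, h1⟩
      · intro i x hx hxV
        change g (param f x) = _
        fin_cases i
        · rw [g_lt x hxV (lt_of_le_of_ne hx.1 (hd x hxV)), max_eq_left hx.2, hB, ev_const_add]
          rfl
        · rw [g_lt x hxV (lt_of_le_of_ne hx.1 (hd x hxV)), max_eq_right hx.2]
          simp
        · rw [g_gt x hx]
          simp
    · exact isPLOn_of_ev IntDiff.zero fun x _ => (g_cell k s hs x).trans (ev_zero x).symm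

/-- Affine functions with integral slopes on the interior of an isolated ridge. -/
theorem exists_affine {V : Opens X.Realization} {r : X.cell m} (hr : IsEmpty (X.Link r))
    (hV : (V : Set X.Realization) = {y | ∃ x : Simp m, IsInt x ∧ param r x = y})
    {a : Fin (m + 1) → ℝ} (ha : IntDiff a) :
    ∃ g : PL V, ∀ x (hx : param r x ∈ V), IsInt x → g.1 ⟨_, hx⟩ = ev a x := by
  classical
  set g : X.Realization → ℝ := fun y =>
    if hy : ∃ x : Simp m, IsInt x ∧ param r x = y then ev a hy.choose else 0 with hg
  have g_int : ∀ x, IsInt x → g (param r x) = ev a x := by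
    intro x hi
    have hy : ∃ x', IsInt x' ∧ param r x' = param r x := ⟨x, hi, rfl⟩
    rw [hg]
    simp only [dif_pos hy]
    rw [(param_injOn_isInt hi hy.choose_spec.2).2]
  have h_int : ∀ x, param r x ∈ V → IsInt x := by
    intro x hx
    rw [← SetLike.mem_coe, hV] at hx
    obtain ⟨x', hi, heq⟩ := hx
    obtain ⟨-, rfl⟩ := param_injOn_isInt hi heq.symm
    exact hi
  have h_cell : ∀ (k : ℕ) (s : X.cell k), (⟨k, s⟩ : Σ k, X.cell k) ≠ ⟨m, r⟩ →
      ∀ x, param s x ∉ V := by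
    intro k s hs x hx
    rw [← SetLike.mem_coe, hV] at hx
    obtain ⟨x', hi', heq⟩ := hx
    obtain ⟨θ, hθ, -⟩ := exists_face_of_param_eq hi' heq.symm
    exact hs (eq_of_face_isolated hr hθ)
  refine ⟨PL.ofParam g (fun k s => ?_) (fun k s => ?_), fun x _ hi => g_int x hi⟩
  · by_cases hs : (⟨k, s⟩ : Σ k, X.cell k) = ⟨m, r⟩
    · cases hs
      exact (continuous_ev a).continuousOn.congr fun x hx => g_int x (h_int x hx)
    · exact fun x hx => (h_cell k s hs x hx).elim
  · by_cases hs : (⟨k, s⟩ : Σ k, X.cell k) = ⟨m, r⟩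
    · cases hs
      exact isPLOn_of_ev ha fun x hx => g_int x (h_int x hx)
    · exact isPLOn_of_ev IntDiff.zero fun x hx => (h_cell k s hs x hx).elim

end Construction

/-! ### Uniqueness of the divisor -/

section Uniqueness

open DeltaComplex

variable {m : ℕ} {X : WeakTropicalComplex.{u} m}

/-- A function on an open set of interior points of a facet is linear if it is affine. -/
theorem isLinear_facet {V : Opens X.Realization} {f : X.cell (m + 1)} {O : Set (Simp (m + 1))}
    (hO : IsOpen O) (hOi : ∀ x ∈ O, IsInt x) (hV : (V : Set X.Realization) = param f '' O)
    {ψ : V → ℝ} {B : Fin (m + 2) → ℝ} (hB : IntDiff B)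
    (hψ : ∀ x ∈ O, ext0 V ψ (param f x) = ev B x) : IsLinear V ψ := by
  have hmem : ∀ {y}, y ∈ V ↔ y ∈ param f '' O := by
    intro y
    rw [← SetLike.mem_coe, hV]
  constructor
  · intro f' p hp
    obtain ⟨x, hx, heq⟩ := hmem.1 hp
    obtain ⟨rfl, rfl⟩ := param_injOn_isInt (hOi x hx) heq.symm
    obtain ⟨μ, hμ⟩ := hB.exists_eq
    refine ⟨B 0, μ, ?_⟩
    filter_upwards [hO.mem_nhds hx] with y hy hyV
    rw [← ext0_of_mem ψ hyV, hψ y hy]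
    exact (congrArg (ev · y) hμ).trans (ev_const_add _ _ _)
  · intro r p hp hpV
    obtain ⟨x', rfl⟩ := exists_toN₀_eq p hp
    rw [proj_toN₀] at hpV
    obtain ⟨x, hx, heq⟩ := hmem.1 hpV
    obtain ⟨θ, -⟩ := exists_face_of_param_eq (hOi x hx) heq.symm
    have := le_of_orderEmb θ
    omega

/-- The neighbourhood of a part of the interior of a ridge meets the facets in neighbourhoods of
the corresponding parts of their faces. -/
theorem param_facet_mem_star {r : X.cell m} {A : Set (Fin (m + 1) → ℝ)}
    (hA : ∀ v ∈ A, ∀ i, 0 < v i) {f : X.cell (m + 1)} {x : Simp (m + 1)} :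
    param f x ∈ star r A ↔ ∃ t : X.Link r, t.1.1 = f ∧ (fun v => x (emb t v)) ∈ A := by
  rw [param_mem_star hA]
  constructor
  · rintro ⟨θ, hθ, hx⟩
    obtain ⟨t, ht, rfl⟩ := exists_link_of_face hθ
    exact ⟨t, ht, hx⟩
  · rintro ⟨t, rfl, hx⟩
    exact ⟨emb t, t.2, hx⟩

theorem param_ridge_mem_star {r r' : X.cell m} {A : Set (Fin (m + 1) → ℝ)}
    (hA : ∀ v ∈ A, ∀ i, 0 < v i) {x : Simp m} :
    param r' x ∈ star r A ↔ r' = r ∧ (x : Fin (m + 1) → ℝ) ∈ A := by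
  rw [param_mem_star hA]
  constructor
  · rintro ⟨θ, hθ, hx⟩
    rw [orderEmb_eq_refl θ] at hθ hx
    rw [X.face_id] at hθ
    exact ⟨hθ, hx⟩
  · rintro ⟨rfl, hx⟩
    exact ⟨RelEmbedding.refl _, X.face_id _, hx⟩

/-- A function near a part of the interior of a ridge is linear if it is affine on the simplices of
`N_r` and its multiplicity is zero. -/
theorem isLinear_star {V : Opens X.Realization} {r : X.cell m} {A : Set (Fin (m + 1) → ℝ)}
    (hA : ∀ v ∈ A, ∀ i, 0 < v i) (hAo : IsOpen A) (hV : (V : Set X.Realization) = star r A)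
    {ψ : V → ℝ} {a : Fin (m + 1) → ℝ} {b : X.Link r → ℝ} (ha : IntDiff a)
    (hb : ∀ t v, ∃ z : ℤ, b t - a v = z)
    (hr : ∀ x : Simp m, (x : Fin (m + 1) → ℝ) ∈ A → ext0 V ψ (param r x) = ev a x)
    (ht : ∀ (t : X.Link r) (x : Simp (m + 1)), (fun v => x (emb t v)) ∈ A →
      ext0 V ψ (param t.1.1 x) = ev (ins t a (b t)) x)
    (hsum : ∑ t, b t - ∑ v, (X.α r v : ℝ) * a v = 0) : IsLinear V ψ := by
  have hmem : ∀ {y}, y ∈ V ↔ y ∈ star r A := by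
    intro y
    rw [← SetLike.mem_coe, hV]
  have hopen : ∀ t : X.Link r, IsOpen {x : Simp (m + 1) | (fun v => x (emb t v)) ∈ A} := fun t =>
    hAo.preimage (continuous_pi fun v => (continuous_apply (emb t v)).comp continuous_subtype_val)
  constructor
  · intro f p hp
    obtain ⟨t, rfl, hpA⟩ := (param_facet_mem_star hA).1 (hmem.1 hp)
    have hB : IntDiff (ins t a (b t)) := by
      intro i j
      rcases Fin.eq_self_or_eq_succAbove t.1.2 i with rfl | ⟨v, rfl⟩ <;>
        rcases Fin.eq_self_or_eq_succAbove t.1.2 j with hj | ⟨w, rfl⟩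
      · exact ⟨0, by rw [hj, sub_self, Int.cast_zero]⟩
      · simpa [ins] using hb t w
      · rw [hj]
        obtain ⟨z, hz⟩ := hb t v
        exact ⟨-z, by rw [Int.cast_neg, ← hz]; simp [ins]⟩
      · simpa [ins] using ha v w
    obtain ⟨μ, hμ⟩ := hB.exists_eq
    refine ⟨ins t a (b t) 0, μ, ?_⟩
    filter_upwards [(hopen t).mem_nhds hpA] with y hy hyV
    rw [← ext0_of_mem ψ hyV, ht t y hy]
    exact (congrArg (ev · y) hμ).trans (ev_const_add _ _ _)
  · intro r' p hp hpV
    obtain ⟨x, rfl⟩ := exists_toN₀_eq p hp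
    rw [proj_toN₀] at hpV
    obtain ⟨rfl, hxA⟩ := (param_ridge_mem_star hA).1 (hmem.1 hpV)
    have h1 : ∀ᶠ y in 𝓝 x, ext0 V ψ (param r' y) = ev a y :=
      Filter.eventually_of_mem ((hAo.preimage continuous_subtype_val).mem_nhds hxA) hr
    have h2 : ∀ t : X.Link r', ∀ᶠ y in 𝓝 (stdSimplex.map (emb t) x),
        ext0 V ψ (param t.1.1 y) = ev (ins t a (b t)) y := by
      intro t
      refine Filter.eventually_of_mem ((hopen t).mem_nhds ?_) (ht t)
      have h3 : (fun v => stdSimplex.map (emb t) x (emb t v)) = (x : Fin (m + 1) → ℝ) :=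
        funext fun v => map_apply_self (emb t) x v
      rwa [Set.mem_ofPred_eq, h3]
    obtain ⟨c, ℓ, hℓ, h⟩ := exists_linear_of_sum_eq_zero ha hb h1 h2 hsum
    refine ⟨c, ℓ, hℓ, ?_⟩
    filter_upwards [h] with y hy hyV
    rw [← ext0_of_mem ψ hyV, hy]

theorem PL.ext0_sub_zsmul {V : Opens X.Realization} (φ g : PL V) (k : ℤ) {y : X.Realization}
    (hy : y ∈ V) : ext0 V (φ - k • g).1 y = ext0 V φ.1 y - k * ext0 V g.1 y := by
  rw [ext0_of_mem _ hy, ext0_of_mem _ hy, ext0_of_mem _ hy]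
  simp

namespace IsDivisorAssignment

variable {D : ∀ U : Opens X.Realization, PL U → FormalSum m U}

theorem eq_zero_of_isLinear (hD : IsDivisorAssignment X D) {V : Opens X.Realization} {φ : PL V}
    (h : IsLinear V φ.1) : D V φ = 0 :=
  (hD.eq_zero_iff V φ).2 ⟨V, le_rfl, by simp, by simp, h⟩

theorem eq_zsmul (hD : IsDivisorAssignment X D) {V : Opens X.Realization} {φ g : PL V} {k : ℤ}
    (h : IsLinear V (φ - k • g).1) : D V φ = k • D V g := by
  have h1 := hD.eq_zero_of_isLinear h
  set F : PL V →+ FormalSum m V := AddMonoidHom.mk' (D V) (hD.add V) with hF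
  have h2 : F (φ - k • g) = 0 := h1
  rw [map_sub, map_zsmul, sub_eq_zero] at h2
  exact h2

/-- The divisor of a function as in `exists_wedge`. -/
theorem eq_cls (hD : IsDivisorAssignment X D) {V : Opens X.Realization} {f : X.cell (m + 1)}
    {lam : Fin (m + 2) → ℤ} {c : ℝ} (hlam : Primitive lam)
    (hpos : ∃ x, 0 < ev (fun i => c + (lam i : ℝ)) x) {h : Fin (m + 2) → ℝ} {d : ℝ}
    (hd : ∀ x, param f x ∈ V → ev h x ≠ d) {g : PL V}
    (hg : ∀ x (hx : param f x ∈ V), ev h x < d →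
      g.1 ⟨_, hx⟩ = max (ev (fun i => c + (lam i : ℝ)) x) 0)
    (hsupp : ∀ y : V, g.1 y ≠ 0 → ∃ x, ev h x < d ∧ IsInt x ∧ param f x = y)
    {A : Set (Simp (m + 1))} (hA : IsPolyhedron A)
    (hAV : ∀ x, param f x ∈ V →
      (x ∈ A ↔ ev h x < d ∧ ev (fun i => c + (lam i : ℝ)) x = 0)) :
    D V g = cls m V f A := by
  have hVo : IsOpen (param f ⁻¹' (V : Set X.Realization)) := V.isOpen.preimage (continuous_param f)
  refine hD.supported V g f (param f ⁻¹' V ∩ {x | ev h x < d}) lam c Set.inter_subset_left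
    (hVo.inter (isOpen_lt (continuous_ev h) continuous_const)) ?_ hlam ?_ ?_ ?_ A hA ?_
  · convert hVo.inter
      (isOpen_lt continuous_const (continuous_ev h) : IsOpen {x | d < ev h x}) using 1
    ext x
    simp only [Set.mem_sdiff, Set.mem_inter_iff, not_and, Set.mem_ofPred_eq, not_lt]
    constructor
    · exact fun hx => ⟨hx.1, lt_of_le_of_ne (hx.2 hx.1) (hd x hx.1).symm⟩
    · exact fun hx => ⟨hx.1, fun _ => hx.2.le⟩
  · simpa only [sum_add_eq_ev] using hpos
  · intro x hx hxV
    rw [sum_add_eq_ev]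
    exact hg x hxV hx.2
  · intro y hy
    obtain ⟨x, h1, h2, h3⟩ := hsupp y hy
    exact ⟨x, ⟨by rw [Set.mem_preimage, h3]; exact y.2, h1⟩, h2, h3⟩
  · simp only [sum_add_eq_ev]
    ext x
    constructor
    · rintro ⟨hxA, hxV⟩
      obtain ⟨h1, h2⟩ := (hAV x hxV).1 hxA
      exact ⟨⟨hxV, h1⟩, h2⟩
    · rintro ⟨⟨hxV, h1⟩, h2⟩
      exact ⟨(hAV x hxV).2 ⟨h1, h2⟩, hxV⟩

variable {D' : ∀ U : Opens X.Realization, PL U → FormalSum m U}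

/-- Uniqueness near a generic point of a facet. -/
theorem exists_eq_facet (hD : IsDivisorAssignment X D) (hD' : IsDivisorAssignment X D')
    {U : Opens X.Realization} (φ : PL U) {f : X.cell (m + 1)} {x : Simp (m + 1)} (hx : IsInt x)
    (hxU : param f x ∈ U) {lam : Fin (m + 2) → ℤ} (hlam : Primitive lam) {k : ℤ}
    (hφ : HasFacetMult (ext0 U φ.1) f x lam k) :
    ∃ (V : Opens X.Realization) (h : V ≤ U), param f x ∈ V ∧
      D V (PL.res h φ) = D' V (PL.res h φ) := by
  obtain ⟨B, hB, hloc⟩ := hφ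
  obtain ⟨O, hO, hOo, hxO⟩ := mem_nhds_iff.1
    (hloc.and ((eventually_param_mem hxU).and (isOpen_isInt.mem_nhds hx)))
  have hOi : ∀ y ∈ O, IsInt y := fun y hy => (hO hy).2.2
  set V : Opens X.Realization := ⟨param f '' O, isOpen_image_param eq_of_face_facet hOo hOi⟩ with hV
  have hVO : ∀ {y}, param f y ∈ V ↔ y ∈ O := by
    intro y
    constructor
    · rintro ⟨y', hy', heq⟩
      obtain ⟨-, rfl⟩ := param_injOn_isInt (hOi _ hy') heq.symm
      exact hy'
    · exact fun hy => ⟨y, hy, rfl⟩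
  have hVU : V ≤ U := by
    rintro _ ⟨y, hy, rfl⟩
    exact (hO hy).2.1
  set c : ℝ := -ev (toR lam) x with hc
  have hev : ∀ y, ev (fun i => c + (lam i : ℝ)) y = ev (toR lam) y - ev (toR lam) x := by
    intro y
    rw [ev_const_add, hc, neg_add_eq_sub]
    rfl
  obtain ⟨g, hg, hsupp⟩ := exists_wedge (V := V) f lam c 0 1 (fun y _ => by rw [ev_zero]; norm_num)
    fun y hy _ hi => absurd (hOi y (hVO.1 hy)) hi
  have hne : (fun i => c + (lam i : ℝ)) ≠ 0 := by
    intro h0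
    obtain ⟨i, j, hij⟩ := hlam.exists_ne
    have h1 : c + (lam i : ℝ) = 0 := congrFun h0 i
    have h2 : c + (lam j : ℝ) = 0 := congrFun h0 j
    exact hij (by exact_mod_cast (by linarith : (lam i : ℝ) = lam j))
  have hcls : ∀ {E : ∀ U : Opens X.Realization, PL U → FormalSum m U},
      IsDivisorAssignment X E → E V (PL.res hVU φ) =
        k • cls m V f {y | ev (fun i => c + (lam i : ℝ)) y = 0} := by
    intro E hE
    rw [← hE.eq_cls hlam (hx.exists_pos hne (by rw [hev, sub_self]))
      (fun y _ => by rw [ev_zero]; norm_num) hg hsupp (IsPolyhedron.eq _ 0)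
      fun y _ => ⟨fun hy => ⟨by rw [ev_zero]; norm_num, hy⟩, fun hy => hy.2⟩]
    refine hE.eq_zsmul (isLinear_facet hOo hOi rfl hB fun y hy => ?_)
    have hyV := hVO.2 hy
    have h1 := (hO hy).1
    rw [PL.ext0_sub_zsmul _ _ _ hyV, ext0_of_mem _ hyV, ext0_of_mem _ hyV,
      hg y hyV (by rw [ev_zero]; norm_num), hev]
    change ext0 U φ.1 (param f y) = _ at h1
    rw [ext0_of_mem _ (hVU hyV)] at h1
    change φ.1 ⟨_, hVU hyV⟩ - _ = _
    rw [h1, add_sub_cancel_right]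
  exact ⟨V, hVU, hVO.2 hxO, (hcls hD).trans (hcls hD').symm⟩

end IsDivisorAssignment

end Uniqueness

section RidgeUniqueness

open DeltaComplex

variable {m : ℕ} {X : WeakTropicalComplex.{u} m}

theorem exists_pos_lt {k : ℕ} {x : Simp k} (hx : IsInt x) : ∃ d > 0, ∀ i, d < x i := by
  obtain ⟨i, -, hi⟩ := Finset.univ.exists_min_image (fun i => x i) ⟨0, Finset.mem_univ _⟩
  exact ⟨x i / 2, half_pos (hx i), fun j =>
    (half_lt_self (hx i)).trans_le (hi j (Finset.mem_univ _))⟩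

/-- The coordinates at the vertices of a ridge determine the point of a facet and its topology. -/
theorem eventually_comp_emb {r : X.cell m} (t : X.Link r) {x : Simp m} {p : Simp (m + 1) → Prop}
    (h : ∀ᶠ y in 𝓝 (stdSimplex.map (emb t) x), p y) :
    ∀ᶠ v in 𝓝 (x : Fin (m + 1) → ℝ), ∀ y : Simp (m + 1), (fun i => y (emb t i)) = v → p y := by
  have hc : Continuous fun (y : Simp (m + 1)) (i : Fin (m + 1)) => y (emb t i) :=
    continuous_pi fun i => (continuous_apply (emb t i)).comp continuous_subtype_val
  have hinj : Function.Injective fun (y : Simp (m + 1)) (i : Fin (m + 1)) => y (emb t i) := by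
    intro y z hyz
    have h1 : ∀ i, y (emb t i) = z (emb t i) := congrFun hyz
    have h2 : ∀ w : Simp (m + 1), w t.1.2 = 1 - ∑ i, w (emb t i) := by
      intro w
      rw [← stdSimplex.sum_eq_one w, Fin.sum_univ_succAbove _ t.1.2]
      exact (add_sub_cancel_right _ _).symm
    refine stdSimplex.ext (funext fun i => ?_)
    rcases Fin.eq_self_or_eq_succAbove t.1.2 i with rfl | ⟨v, rfl⟩
    · rw [h2, h2]
      simp only [h1]
    · exact h1 v
  rw [(hc.isClosedEmbedding hinj).nhds_eq_comap, Filter.eventually_comap] at h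
  have hx : (fun i => stdSimplex.map (emb t) x (emb t i)) = (x : Fin (m + 1) → ℝ) :=
    funext fun i => map_apply_self (emb t) x i
  rwa [hx] at h

theorem ev_cast_single {k : ℕ} (i : Fin (k + 1)) (x : Simp k) :
    ev (fun j => (0 : ℝ) + ((Pi.single i 1 : Fin (k + 1) → ℤ) j : ℝ)) x = x i := by
  have h : (fun j => (0 : ℝ) + ((Pi.single i 1 : Fin (k + 1) → ℤ) j : ℝ)) = Pi.single i 1 := by
    ext j
    by_cases h : j = i
    · subst h
      simp
    · simp [h]
  rw [h, ev_single]

namespace IsDivisorAssignment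

variable {D D' : ∀ U : Opens X.Realization, PL U → FormalSum m U}

/-- Uniqueness near a generic point of a ridge that lies in a facet: after subtracting a multiple of
the distance to the ridge on one of the simplices of `N_r`, the function is linear. -/
theorem exists_eq_ridge (hD : IsDivisorAssignment X D) (hD' : IsDivisorAssignment X D')
    {U : Opens X.Realization} (φ : PL U) {r : X.cell m} (t₀ : X.Link r) {x : Simp m} (hx : IsInt x)
    (hxU : param r x ∈ U) {k : ℤ} (hφ : HasRidgeMult (ext0 U φ.1) r x k) :
    ∃ (V : Opens X.Realization) (h : V ≤ U), param r x ∈ V ∧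
      D V (PL.res h φ) = D' V (PL.res h φ) := by
  classical
  obtain ⟨a, b, ha, hb, h1, h2, h3⟩ := hφ
  obtain ⟨d, hd0, hd⟩ := exists_pos_lt hx
  -- a neighbourhood of `x` over which the coordinate at a vertex of a facet is less than `d` at the
  -- vertex opposite to the ridge, and greater than `d` at the vertices of the ridge
  have e1 : ∀ᶠ v in 𝓝 (x : Fin (m + 1) → ℝ), ∀ i, d < v i :=
    Filter.eventually_all.2 fun i =>
      continuousAt_const.eventually_lt (continuous_apply i).continuousAt (hd i)
  have e2 : ∀ᶠ v in 𝓝 (x : Fin (m + 1) → ℝ), ∀ y : Simp m, (y : Fin (m + 1) → ℝ) = v →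
      ext0 U φ.1 (param r y) = ev a y ∧ param r y ∈ U := by
    have := h1.and (eventually_param_mem hxU)
    rwa [nhds_subtype_eq_comap, Filter.eventually_comap] at this
  have e3 : ∀ t : X.Link r, ∀ᶠ v in 𝓝 (x : Fin (m + 1) → ℝ), ∀ y : Simp (m + 1),
      (fun i => y (emb t i)) = v → (ext0 U φ.1 (param t.1.1 y) = ev (ins t a (b t)) y ∧
        param t.1.1 y ∈ U) ∧ ev (Pi.single t.1.2 1) y < d := fun t =>
    eventually_comp_emb t (((h2 t).and (eventually_param_mem (by rwa [param_emb]))).and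
      ((continuous_ev _).continuousAt.eventually_lt continuousAt_const (by
        rwa [ev_single, map_emb_apply_opposite])))
  obtain ⟨A, hA, hAo, hxA⟩ := mem_nhds_iff.1 ((e1.and e2).and (Filter.eventually_all.2 e3))
  have hApos : ∀ v ∈ A, ∀ i, 0 < v i := fun v hv i => hd0.trans ((hA hv).1.1 i)
  set V : Opens X.Realization := ⟨star r A, isOpen_star hApos hAo⟩ with hV
  have hfV : ∀ {f : X.cell (m + 1)} {y : Simp (m + 1)}, param f y ∈ V →
      ∃ t : X.Link r, t.1.1 = f ∧ (fun v => y (emb t v)) ∈ A := fun h =>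
    (param_facet_mem_star hApos).1 h
  have htV : ∀ {t : X.Link r} {y : Simp (m + 1)}, (fun v => y (emb t v)) ∈ A → param t.1.1 y ∈ V :=
    fun {t y} h => (param_facet_mem_star hApos).2 ⟨t, rfl, h⟩
  have hrV : ∀ {y : Simp m}, (y : Fin (m + 1) → ℝ) ∈ A → param r y ∈ V :=
    fun h => (param_ridge_mem_star hApos).2 ⟨rfl, h⟩
  have hVU : V ≤ U := by
    intro y hy
    obtain ⟨j, s, w, -, rfl⟩ := exists_param_isInt y
    obtain ⟨θ, -⟩ := (param_mem_star hApos).1 hy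
    have hl := le_of_orderEmb θ
    have hl' := dim_le j s
    obtain rfl | rfl : j = m ∨ j = m + 1 := by omega
    · obtain ⟨rfl, hw⟩ := (param_ridge_mem_star hApos).1 hy
      exact ((hA hw).1.2 w rfl).2
    · obtain ⟨t, rfl, hw⟩ := hfV hy
      exact ((hA hw).2 t w rfl).1.2
  set i₀ := t₀.1.2 with hi₀
  -- on the part over `t₀` the coordinate at `i₀` is small, on the other parts it is large
  have hside : ∀ {t : X.Link r} {y : Simp (m + 1)}, t.1.1 = t₀.1.1 → (fun v => y (emb t v)) ∈ A →
      (t = t₀ ∧ y i₀ < d) ∨ d < y i₀ := by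
    intro t y htf hy
    by_cases ht : i₀ = t.1.2
    · refine Or.inl ⟨Subtype.ext (Prod.ext htf ht.symm), ?_⟩
      have := ((hA hy).2 t y rfl).2
      rwa [ev_single, ← ht] at this
    · obtain ⟨v, hv⟩ := Fin.exists_succAbove_eq ht
      refine Or.inr ?_
      rw [← hv]
      exact (hA hy).1.1 v
  have hne : ∀ y, param t₀.1.1 y ∈ V → ev (Pi.single i₀ 1) y ≠ d := by
    intro y hy
    obtain ⟨t, htf, hyA⟩ := hfV hy
    rw [ev_single]
    rcases hside htf hyA with ⟨-, h⟩ | h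
    exacts [h.ne, h.ne']
  obtain ⟨g, hg, hsupp⟩ := exists_wedge (V := V) t₀.1.1 (Pi.single i₀ 1) 0 (Pi.single i₀ 1) d hne
    (by
      intro y hy hlt hi
      rw [ev_cast_single]
      rw [ev_single] at hlt
      obtain ⟨t, htf, hyA⟩ := hfV hy
      obtain ⟨rfl, -⟩ | h := hside htf hyA
      · simp only [IsInt, not_forall] at hi
        obtain ⟨j, hj⟩ := hi
        rcases Fin.eq_self_or_eq_succAbove t.1.2 j with rfl | ⟨v, rfl⟩
        · exact not_lt.1 hj
        · exact absurd (hApos _ hyA v) hj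
      · exact absurd hlt h.not_gt)
  have hgr : ∀ y : Simp m, (y : Fin (m + 1) → ℝ) ∈ A → ext0 V g.1 (param r y) = 0 := by
    intro y hy
    by_contra h0
    rw [ext0_of_mem _ (hrV hy)] at h0
    obtain ⟨w, -, hw, heq⟩ := hsupp _ h0
    obtain ⟨θ, -⟩ := exists_face_of_param_eq hw heq.symm
    have := le_of_orderEmb θ
    omega
  have hgt : ∀ (t : X.Link r) (y : Simp (m + 1)), (fun v => y (emb t v)) ∈ A →
      ext0 V g.1 (param t.1.1 y) = if t = t₀ then y t.1.2 else 0 := by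
    intro t y hy
    rw [ext0_of_mem _ (htV hy)]
    split_ifs with ht
    · subst ht
      have hlt := ((hA hy).2 t y rfl).2
      rw [hg y (htV hy) hlt, ev_cast_single, max_eq_left (stdSimplex.zero_le y _)]
    · by_contra h0
      obtain ⟨w, hw, hwi, heq⟩ := hsupp _ h0
      obtain ⟨htf, rfl⟩ := param_injOn_isInt hwi heq.symm
      rw [ev_single] at hw
      rcases hside htf hy with ⟨h, -⟩ | h
      exacts [ht h, h.not_gt hw]
  have hcls : ∀ {E : ∀ U : Opens X.Realization, PL U → FormalSum m U},
      IsDivisorAssignment X E → E V (PL.res hVU φ) =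
        k • cls m V t₀.1.1 {y | ev (Pi.single i₀ 1) y = 0} := by
    intro E hE
    rw [← hE.eq_cls (primitive_single i₀)
      ⟨stdSimplex.vertex i₀, by rw [ev_cast_single, ← ev_single, ev_vertex]; simp⟩ hne hg hsupp
      (IsPolyhedron.eq _ 0) fun y _ => by
        rw [ev_cast_single, Set.mem_ofPred_eq, ev_single]
        exact ⟨fun h => ⟨by rwa [h], h⟩, fun h => h.2⟩]
    refine hE.eq_zsmul (isLinear_star (a := a) (b := fun t => b t - if t = t₀ then (k : ℝ) else 0)
      hApos hAo rfl ha ?_ ?_ ?_ ?_)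
    · intro t v
      obtain ⟨z, hz⟩ := hb t v
      refine ⟨z - if t = t₀ then k else 0, ?_⟩
      push_cast
      rw [← hz]
      ring
    · intro y hy
      rw [PL.ext0_sub_zsmul _ _ _ (hrV hy), hgr y hy, mul_zero, sub_zero, ← ((hA hy).1.2 y rfl).1,
        ext0_of_mem _ (hrV hy), ext0_of_mem _ (hVU (hrV hy))]
      rfl
    · intro t y hy
      have h4 := ((hA hy).2 t y rfl).1.1
      rw [ext0_of_mem _ (hVU (htV hy)), ev_ins] at h4
      rw [PL.ext0_sub_zsmul _ _ _ (htV hy), hgt t y hy, ext0_of_mem _ (htV hy), ev_ins]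
      change φ.1 ⟨_, hVU (htV hy)⟩ - _ = _
      rw [h4]
      split_ifs <;> ring
    · rw [Finset.sum_sub_distrib, Finset.sum_ite_eq', if_pos (Finset.mem_univ _), h3]
      ring
  exact ⟨V, hVU, hrV hxA, (hcls hD).trans (hcls hD').symm⟩

/-- Uniqueness near a generic point of an isolated ridge. -/
theorem exists_eq_isolated (hD : IsDivisorAssignment X D) (hD' : IsDivisorAssignment X D')
    {U : Opens X.Realization} (φ : PL U) {r : X.cell m} (hr : IsEmpty (X.Link r)) {x : Simp m}
    (hx : IsInt x) (hxU : param r x ∈ U) {k : ℤ} (hφ : HasRidgeMult (ext0 U φ.1) r x k) :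
    ∃ (V : Opens X.Realization) (h : V ≤ U), param r x ∈ V ∧
      D V (PL.res h φ) = D' V (PL.res h φ) := by
  obtain ⟨a, b, ha, -, h1, -, -⟩ := hφ
  set R : Opens X.Realization :=
    ⟨param r '' {x | IsInt x}, isOpen_image_param (eq_of_face_isolated hr) isOpen_isInt
      fun x hx => hx⟩ with hR
  obtain ⟨g, hg⟩ := exists_affine (V := R) hr rfl ha
  obtain ⟨O, hO, hOo, hxO⟩ := mem_nhds_iff.1
    (h1.and ((eventually_param_mem hxU).and (isOpen_isInt.mem_nhds hx)))
  set V : Opens X.Realization :=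
    ⟨param r '' O, isOpen_image_param (eq_of_face_isolated hr) hOo fun y hy => (hO hy).2.2⟩ with hV
  have hVU : V ≤ U := by
    rintro _ ⟨y, hy, rfl⟩
    exact (hO hy).2.1
  have hVR : V ≤ R := by
    rintro _ ⟨y, hy, rfl⟩
    exact ⟨y, (hO hy).2.2, rfl⟩
  have heq : PL.res hVU φ = PL.res hVR g := by
    refine Subtype.ext (funext ?_)
    rintro ⟨_, ⟨y, hy, rfl⟩⟩
    have h2 := (hO hy).1
    change ext0 U φ.1 (param r y) = _ at h2
    rw [ext0_of_mem _ (hO hy).2.1] at h2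
    exact h2.trans (hg y _ (hO hy).2.2).symm
  refine ⟨V, hVU, ⟨x, hxO, rfl⟩, ?_⟩
  obtain ⟨z, hz, h3⟩ := hD.ridge R g r hr rfl a fun y hy hi => hg y hy hi
  obtain ⟨z', hz', h4⟩ := hD'.ridge R g r hr rfl a fun y hy hi => hg y hy hi
  have hzz : z = z' := by exact_mod_cast hz.trans hz'.symm
  rw [heq, hD.res, hD'.res, h3, h4, hzz]

/-- The divisor is determined by its properties. -/
theorem unique (hD : IsDivisorAssignment X D) (hD' : IsDivisorAssignment X D') : D = D' := by
  funext U φ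
  obtain ⟨z, hz⟩ := QuotientAddGroup.mk_surjective (D U φ)
  obtain ⟨z', hz'⟩ := QuotientAddGroup.mk_surjective (D' U φ)
  obtain ⟨w, T, hT, hw⟩ := exists_isDiv φ
  have hrel : -z + z' ∈ Rel m U := by
    refine mem_rel_of_thin hT fun y hyU hyT => ?_
    obtain ⟨V, hVU, hyV, hV⟩ : ∃ (V : Opens X.Realization) (h : V ≤ U), y ∈ V ∧
        D V (PL.res h φ) = D' V (PL.res h φ) := by
      obtain ⟨lam, hlam, ⟨f, x, hx, rfl, h⟩ | ⟨r, x, hx, rfl, h⟩⟩ := hw y hyU hyT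
      · exact hD.exists_eq_facet hD' φ hx hyU hlam h
      · rcases isEmpty_or_nonempty (X.Link r) with hr | ⟨⟨t₀⟩⟩
        · exact hD.exists_eq_isolated hD' φ hr hx hyU h
        · exact hD.exists_eq_ridge hD' φ t₀ hx hyU h
    refine ⟨V, hVU, hyV, thin_cnt_ne_zero ?_⟩
    rw [hD.res, hD'.res, ← hz, ← hz'] at hV
    exact QuotientAddGroup.eq.1 hV
  rw [← hz, ← hz']
  exact QuotientAddGroup.eq.2 hrel

end IsDivisorAssignment

end RidgeUniqueness

end Trop

theorem mainTheorem4 {m : ℕ} (X : Trop.WeakTropicalComplex.{u} m) :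
    ∃! D : (∀ U : TopologicalSpace.Opens X.Realization, Trop.PL U → Trop.FormalSum m U),
      Trop.IsDivisorAssignment X D := by
  obtain ⟨D, hD⟩ := Trop.exists_isDivisorAssignment X
  exact ⟨D, hD, fun D' hD' => hD'.unique hD⟩
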